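/- Let $\mathcal L\subset\mathbb R^2$ be a lattice with basis $\ell_1,\ell_2$, let $m\ge 1$, let $s_1,\dots,s_m$ be distinct points of the fundamental domain $\{x_1\ell_1+x_2\ell_2 : x_1,x_2\in[0,1)\}$, let $Z_1,\dots,Z_m>0$, and put $\mathcal S=\{s_i+\ell : 1\le i\le m,\ \ell\in\mathcal L\}$ and $\tilde M=\mathbb R^2\setminus\mathcal S$. Identify $\mathbb R^2$ with $\mathbb C$. Let $V\in C^\infty(\tilde M,\mathbb R)$ be $\mathcal L$-periodic and Coulombic, that is, for small $\varepsilon>0$ and every $i$ the function on $\{|Q|<\varepsilon\}$ equal to $V(s_i+Q^2)\,Q\bar Q$ for $Q\neq 0$ and to $-Z_i$ for $Q=0$ is $C^\infty$. On $T^*\tilde M=\{(p,q): p\in\mathbb R^2,\ q\in\tilde M\}$ let $\tilde\omega=dq_1\wedge dp_1+dq_2\wedge dp_2$ and $\tilde H(p,q)=\tfrac12|p|^2+V(q)$. An *extension* of $(T^*\tilde M,\tilde\omega,\tilde H)$ is a triple $(P,\omega,H)$ consisting of a smooth four-dimensional manifold $P$ (Hausdorff, second countable) that contains $T^*\tilde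 M$ as a dense open submanifold, a smooth symplectic form $\omega$ on $P$ with $\omega|_{T^*\tilde M}=\tilde\omega$, and a smooth function $H:P\to\mathbb R$ with $H|_{T^*\tilde M}=\tilde H$, such that the projection $(p,q)\mapsto q$ extends to a continuous map $\pi:P\to\mathbb R^2$ and, as a set, $P=T^*\tilde M\;\sqcup\;\bigsqcup_{\sigma\in\mathcal S}C_\sigma$, where each $C_\sigma$ is a copy of the cylinder $\mathbb R\times S^1$ and $\pi(C_\sigma)=\{\sigma\}$. It is *complete* if the Hamiltonian vector field $X_H$, defined by $\omega(X_H,\cdot)=dH$, generates a smooth flow $\Phi^t:P\to P$ for all $t\in\mathbb R$. Then: 1. There exists a complete extension $(P,\omega,H)$. In it each $C_\sigma$ is a smoothly embedded cylinder $\mathbb R\times S^1$. 2. It is the unique complete extension: for every complete extension $(P',\omega',H')$ there is exactly one diffeomorphism $\varphi:P\to P'$ that is the identity on $T^*\tilde M$ and satisfies $\varphi^*\omega'=\omega$ and $H'\circ\varphi=H$. 3. For every $E\in\mathbb R$ that is a regular value of $V:\tilde M\to\mathbb R$, the energy shell $\Sigma_E=\{x\in P: H(x)=E\}$ is a smooth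 (embedded) three-dimensional submanifold of $P$, invariant under the flow $\Phi^t$. -/

import Mathlib

open Set Topology Manifold
open scoped ContDiff

noncomputable section

namespace CoulombRegularization

/-- The model of real four-dimensional manifolds: the real vector space `ℂ × ℂ ≅ ℝ⁴`.
A point is read as `(p, q)`, momentum first. -/
abbrev I4 : ModelWithCorners ℝ (ℂ × ℂ) (ℂ × ℂ) := 𝓘(ℝ, ℂ × ℂ)

section Potential

/-- The set `𝓢 = {sᵢ + ℓ}` of all nuclei; the lattice is the integer span of the basis `b`. -/
def nuclei (b : Module.Basis (Fin 2) ℝ ℂ) {m : ℕ} (s : Fin m → ℂ) : Set ℂ :=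
  {q | ∃ i, ∃ l ∈ Submodule.span ℤ (range b), q = s i + l}

/-- The function `Q ↦ V(s + Q²) Q Q̄`, with the value `-Z` at `Q = 0`. -/
def leviCivita (V : ℂ → ℝ) (s : ℂ) (Z : ℝ) (Q : ℂ) : ℝ :=
  if Q = 0 then -Z else V (s + Q ^ 2) * Complex.normSq Q

/-- A Coulombic periodic potential: smooth and periodic off the nuclei (the values of `V` at the
nuclei are irrelevant), with `leviCivita V (s i) (Z i)` smooth near `0`. -/
structure IsCoulombic (b : Module.Basis (Fin 2) ℝ ℂ) {m : ℕ} (s : Fin m → ℂ) (Z : Fin m → ℝ)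
    (V : ℂ → ℝ) : Prop where
  smooth : ContDiffOn ℝ ∞ V (nuclei b s)ᶜ
  periodic : ∀ q ∈ (nuclei b s)ᶜ, ∀ l ∈ Submodule.span ℤ (range b), V (q + l) = V q
  coulomb : ∃ ε > 0, ∀ i, ContDiffOn ℝ ∞ (leviCivita V (s i) (Z i)) (Metric.ball 0 ε)

/-- `T*(ℝ² ∖ S)` as an open subset of `ℂ × ℂ`, with points `(p, q)`. -/
def cotangentBundle (S : Set ℂ) : Set (ℂ × ℂ) := {x | x.2 ∉ S}

/-- The Hamiltonian `½ p² + V(q)`. -/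
def hamiltonian (V : ℂ → ℝ) (x : ℂ × ℂ) : ℝ := Complex.normSq x.1 / 2 + V x.2

/-- The two-form `dq₁ ∧ dp₁ + dq₂ ∧ dp₂` evaluated on the vectors `v = (δp, δq)` and `w`. -/
def canonicalForm (v w : ℂ × ℂ) : ℝ :=
  (v.2.re * w.1.re - v.1.re * w.2.re) + (v.2.im * w.1.im - v.1.im * w.2.im)

end Potential

section Symplectic

variable {P : Type} [TopologicalSpace P] [ChartedSpace (ℂ × ℂ) P]

/-- A two-form on `P`, without regularity: an alternating bilinear form on each tangent space. -/
abbrev TwoForm (P : Type) [TopologicalSpace P] [ChartedSpace (ℂ × ℂ) P] : Type :=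
  ∀ x : P, TangentSpace I4 x [⋀^Fin 2]→L[ℝ] ℝ

/-- The expression of a two-form in the chart `e`: its pullback under `e⁻¹`. -/
def TwoForm.inChart (Ω : TwoForm P) (e : OpenPartialHomeomorph P (ℂ × ℂ)) (y : ℂ × ℂ) :
    (ℂ × ℂ) [⋀^Fin 2]→L[ℝ] ℝ :=
  (Ω (e.symm y)).compContinuousLinearMap (mfderiv I4 I4 e.symm y)

/-- A smooth symplectic form: smooth, closed and nondegenerate. -/
structure IsSymplecticForm (Ω : TwoForm P) : Prop where
  smooth : ∀ e ∈ IsManifold.maximalAtlas I4 ∞ P, ContDiffOn ℝ ∞ (Ω.inChart e) e.target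
  closed : ∀ e ∈ IsManifold.maximalAtlas I4 ∞ P, ∀ y ∈ e.target, extDeriv (Ω.inChart e) y = 0
  nondegenerate : ∀ (x : P) (v : TangentSpace I4 x),
    (∀ w : TangentSpace I4 x, Ω x ![v, w] = 0) → v = 0

/-- `X` is the Hamiltonian vector field of `H` for `Ω`, that is, `Ω(X, ·) = dH`. -/
def IsHamiltonianField (Ω : TwoForm P) (H : P → ℝ) (X : ∀ x : P, TangentSpace I4 x) : Prop :=
  ∀ (x : P) (w : TangentSpace I4 x), Ω x ![X x, w] = mfderiv I4 𝓘(ℝ, ℝ) H x w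

/-- `Φ` is a smooth Hamiltonian flow, defined for all times, generated by `H`. -/
structure IsCompleteHamiltonianFlow (Ω : TwoForm P) (H : P → ℝ) (Φ : ℝ → P → P) : Prop where
  smooth : ContMDiff (𝓘(ℝ, ℝ).prod I4) I4 ∞ (fun z : ℝ × P => Φ z.1 z.2)
  zero : ∀ x, Φ 0 x = x
  add : ∀ t u x, Φ (t + u) x = Φ t (Φ u x)
  generated : ∃ X : ∀ x : P, TangentSpace I4 x, IsHamiltonianField Ω H X ∧
    ∀ x, IsMIntegralCurve (I := I4) (fun t => Φ t x) X

/-- `A` is an embedded smooth `k`-dimensional submanifold: around each of its points there is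
a chart of `P` that maps `A` to (an open part of) a `k`-dimensional linear subspace. -/
def IsEmbeddedSubmanifold (k : ℕ) (A : Set P) : Prop :=
  ∀ x ∈ A, ∃ e ∈ IsManifold.maximalAtlas I4 ∞ P, x ∈ e.source ∧
    ∃ W : Submodule ℝ (ℂ × ℂ), Module.finrank ℝ W = k ∧ e '' (e.source ∩ A) = e.target ∩ W

end Symplectic

/-- A smooth extension `(P, Ω, H)` of the Hamiltonian system `½ p² + V(q)` on `T*(ℝ² ∖ S)`, in
which `P` is the disjoint union of `T*(ℝ² ∖ S)` (a dense open part) and, as a set, of one cylinder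
`ℝ × S¹` lying over each point of `S`. -/
structure Extension (S : Set ℂ) (V : ℂ → ℝ) where
  /-- The phase space, a smooth manifold of real dimension four. -/
  P : Type
  [top : TopologicalSpace P]
  [charted : ChartedSpace (ℂ × ℂ) P]
  [manifold : IsManifold I4 ∞ P]
  [t2 : T2Space P]
  [secondCountable : SecondCountableTopology P]
  /-- The identification of an open subset of `P` with `T*(ℝ² ∖ S)`: a chart `(p, q)` of `P`. -/
  coord : OpenPartialHomeomorph P (ℂ × ℂ)
  coord_mem : coord ∈ IsManifold.maximalAtlas I4 ∞ P
  coord_target : coord.target = cotangentBundle S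
  dense_source : Dense coord.source
  /-- The continuous extension to `P` of the projection `(p, q) ↦ q`. -/
  proj : P → ℂ
  proj_continuous : Continuous proj
  proj_coord : ∀ x ∈ coord.source, proj x = (coord x).2
  /-- The cylinder over each singularity. -/
  cyl : S → ℝ × Circle → P
  cyl_injective : ∀ s, Function.Injective (cyl s)
  proj_cyl : ∀ s z, proj (cyl s z) = s
  cyl_cover : ∀ x, x ∉ coord.source → ∃ s z, cyl s z = x
  /-- The symplectic form. -/
  Ω : TwoForm P
  symplectic : IsSymplecticForm Ω
  form_coord : ∀ y ∈ cotangentBundle S, ∀ v w, Ω.inChart coord y ![v, w] = canonicalForm v w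
  /-- The Hamiltonian function. -/
  H : P → ℝ
  H_smooth : ContMDiff I4 𝓘(ℝ, ℝ) ∞ H
  H_coord : ∀ y ∈ cotangentBundle S, H (coord.symm y) = hamiltonian V y

attribute [instance] Extension.top Extension.charted Extension.manifold Extension.t2
  Extension.secondCountable

namespace Extension

variable {S : Set ℂ} {V : ℂ → ℝ}

/-- The extension carries a Hamiltonian flow that is complete. -/
def IsComplete (X : Extension S V) : Prop := ∃ Φ, IsCompleteHamiltonianFlow X.Ω X.H Φ

/-- The energy shell `Σ_E`. -/
def energyShell (X : Extension S V) (E : ℝ) : Set X.P := {x | X.H x = E}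

/-- A diffeomorphism of two extensions that restricts to the identity on `T*(ℝ² ∖ S)` and carries
the symplectic form and the Hamiltonian of one to those of the other. -/
structure IsIso (X Y : Extension S V) (φ : X.P ≃ₘ^∞⟮I4, I4⟯ Y.P) : Prop where
  coord : ∀ y ∈ cotangentBundle S, φ (X.coord.symm y) = Y.coord.symm y
  form : ∀ (x : X.P) (v w : TangentSpace I4 x),
    Y.Ω (φ x) ![mfderiv I4 I4 φ x v, mfderiv I4 I4 φ x w] = X.Ω x ![v, w]
  energy : ∀ x, Y.H (φ x) = X.H x

end Extension

/-- `E` is a regular value of the potential on `ℝ² ∖ S`. -/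
def IsRegularValue (S : Set ℂ) (V : ℂ → ℝ) (E : ℝ) : Prop :=
  ∀ q ∉ S, V q = E → Function.Surjective (fderiv ℝ V q)

end CoulombRegularization

end

open CoulombRegularization

noncomputable section

namespace CoulombRegularization

/-! The phase space is taken to be the set of trajectories. A point of `Phase S V` is a curve in the
plane, defined for all times, that solves Newton's equation off the nuclei and at each nucleus
undergoes an isolated collision at which it retraces its path. The momentum and position at time `t`
give a chart on the curves that are not at a nucleus at time `t`. Collision times are isolated, so
these charts cover the space and any two points lie in a common one; no chart centred at a collision
is needed. The transition maps are the time-`(u - t)` maps of the regularized flow, the flow on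
phase space is translation of time and so is complete by construction, and the energy and the
canonical form are read off in any chart. What has to be proved is that enough such curves exist and
that the flow maps are smooth and symplectic, also across collisions.

Both rest on Levi-Civita's substitution. With `q = σ + Q²`, `p = P / (2 Q̄)` and `dt = |Q|² ds`, the
function `|Q|² (H - E)` becomes `|P|²/8 + f(Q) - E |Q|²`, where `f` is smooth by the Coulomb
hypothesis. Energy and time are carried along as coordinates. On the zero level the value `Q = 0`
forces `|P|² = 8Z > 0`: hence collisions are isolated and physical time is strictly increasing in
`s`. The symmetry `Q ↦ -Q` combined with reversal of `s` turns a collision into a reflection of the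
physical curve. Reflection also gives uniqueness of continuation, so a curve is determined by one
collision-free state (`eventuallyEq_on_of_state_eq`).

Completeness: bounded energy near a nucleus confines `(Q, P, E, T)` to a compact set, so solutions
exist for a time uniform in the position and the energy bound
(`LocallyCoulomb.exists_uniform_time`). Periodicity reduces positions to a compact set, and
conservation of energy permits restarting for ever.

Smoothness across a collision: the flow map is a lift to Levi-Civita coordinates, then the smooth
regularized flow stopped by the implicit function theorem at a given physical time, then projection
(`LCFlow.contDiffAt_flowMap`). Symplecticity is an identity between continuous functions. It holds
along collision-free pieces by the variational equation, and states with a collision ahead are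
limits of states without one, obtained by displacing `Q` orthogonally to `P` (`LCFlow.mem_closure`,
`Phase.flow_induction`).

The collisions with one nucleus are parametrized by energy and direction: the direction is `P² /
(8Z)`, which forgets exactly the sign ambiguity of `(Q, P)`. In a chart at a later time this
parametrization is an immersion, and it is proper because energy restricts to the projection of the
cylinder to its line.

Uniqueness: the flow `Ψ` of a complete extension must agree with the regularized flow on
coordinates, again by density, so `γ ↦ Ψ (-t) (state of γ at t)` does not depend on `t`. It is
injective and a local diffeomorphism; it is onto because points near an added cylinder have bounded
energy and positions near a nucleus, so their trajectories accumulate in `Phase`. Energy shells are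
regular level sets, since every point may be examined in a chart at a collision-free time. -/

open Filter


/-! ### Inverse function theorem with a smooth inverse -/

section LocalDiffeo

variable {E F : Type*} [NormedAddCommGroup E] [NormedSpace ℝ E] [CompleteSpace E]
  [NormedAddCommGroup F] [NormedSpace ℝ F]

/-- The inverse function theorem, with an inverse that is smooth on the whole of its domain. -/
theorem exists_smooth_localInverse {f : E → F} {U : Set E} (hU : IsOpen U)
    (hf : ContDiffOn ℝ ∞ f U) {x : E} (hx : x ∈ U) (A : E ≃L[ℝ] F)
    (hA : HasFDerivAt f (A : E →L[ℝ] F) x) :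
    ∃ e : OpenPartialHomeomorph E F, x ∈ e.source ∧ e.source ⊆ U ∧ (∀ y, e y = f y) ∧
      ContDiffOn ℝ ∞ e.symm e.target := by
  have hfx : ContDiffAt ℝ ∞ f x := hf.contDiffAt (hU.mem_nhds hx)
  let e₀ := hfx.toOpenPartialHomeomorph f hA (by simp)
  -- Invertible operators form an open set, so the chart can be restricted to points where the
  -- derivative is invertible; this makes the inverse smooth on its whole domain and not only at one
  -- point.
  let W : Set E := U ∩ fderiv ℝ f ⁻¹' range ((↑) : (E ≃L[ℝ] F) → E →L[ℝ] F)
  have hW : IsOpen W := (hf.continuousOn_fderiv_of_isOpen hU (by simp)).isOpen_inter_preimage hU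
    ContinuousLinearEquiv.isOpen
  refine ⟨e₀.restrOpen W hW, ⟨hfx.mem_toOpenPartialHomeomorph_source hA (by simp), hx, A,
    hA.fderiv.symm⟩, fun y hy => hy.2.1, fun y => rfl, ?_⟩
  intro y hy
  have hys := (e₀.restrOpen W hW).map_target hy
  obtain ⟨B, hB⟩ := hys.2.2
  have hU' : U ∈ 𝓝 ((e₀.restrOpen W hW).symm y) := hU.mem_nhds hys.2.1
  have hd : HasFDerivAt (e₀.restrOpen W hW) (B : E →L[ℝ] F) ((e₀.restrOpen W hW).symm y) := by
    rw [hB]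
    exact ((hf.contDiffAt hU').differentiableAt (by simp)).hasFDerivAt
  exact ((e₀.restrOpen W hW).contDiffAt_symm hy hd (hf.contDiffAt hU')).contDiffWithinAt

end LocalDiffeo

/-! ### Smoothness of composition operators on spaces of continuous functions -/

section Superposition


/-- The bilinear pairing of continuous families of operators with continuous families of vectors. -/
def pointwiseApply (X : Type*) [TopologicalSpace X] [CompactSpace X]
    (E F : Type*) [NormedAddCommGroup E] [NormedSpace ℝ E]
    [NormedAddCommGroup F] [NormedSpace ℝ F] :
    C(X, E →L[ℝ] F) →L[ℝ] C(X, E) →L[ℝ] C(X, F) :=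
  LinearMap.mkContinuous₂
    (LinearMap.mk₂ ℝ (fun (A : C(X, E →L[ℝ] F)) (γ : C(X, E)) =>
        (⟨fun t => A t (γ t), by fun_prop⟩ : C(X, F)))
      (fun A B γ => by ext t; simp) (fun c A γ => by ext t; simp)
      (fun A γ δ => by ext t; simp) (fun c A γ => by ext t; simp)) 1 (fun A γ => by
        rw [ContinuousMap.norm_le _ (by positivity)]
        intro t
        simp only [LinearMap.mk₂_apply, ContinuousMap.coe_mk, one_mul]
        exact ((A t).le_opNorm _).trans (mul_le_mul (A.norm_coe_le_norm t) (γ.norm_coe_le_norm t)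
          (norm_nonneg _) (norm_nonneg A)))

variable {X : Type*} [TopologicalSpace X] [CompactSpace X]

/-- The mean value inequality applies at each parameter separately, and it is uniform because `γ ↦
f' ∘ γ` is continuous for the supremum norm. -/
theorem hasFDerivAt_postcomp {E F : Type*} [NormedAddCommGroup E] [NormedSpace ℝ E]
    [NormedAddCommGroup F] [NormedSpace ℝ F] (f : C(E, F)) (f' : C(E, E →L[ℝ] F))
    (hf : ∀ x, HasFDerivAt f (f' x) x) (γ : C(X, E)) :
    HasFDerivAt (fun γ : C(X, E) => f.comp γ) (pointwiseApply X E F (f'.comp γ)) γ := by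
  rw [hasFDerivAt_iff_isLittleO_nhds_zero, Asymptotics.isLittleO_iff]
  intro c hc
  have hcont : Continuous (fun δ : C(X, E) => f'.comp δ) := ContinuousMap.continuous_postcomp f'
  obtain ⟨r, hr, hr'⟩ := Metric.eventually_nhds_iff.1
    (hcont.continuousAt.eventually (Metric.ball_mem_nhds (f'.comp γ) hc))
  filter_upwards [Metric.ball_mem_nhds (0 : C(X, E)) hr] with h hh
  rw [mem_ball_zero_iff] at hh
  rw [ContinuousMap.norm_le _ (by positivity)]
  intro t
  have key : ∀ y ∈ Metric.ball (γ t) r, ‖f' y - f' (γ t)‖ ≤ c := by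
    intro y hy
    -- Translating the whole curve by a constant moves its value at `t` to `y` at the same cost in
    -- the supremum norm; this turns continuity in function space into a pointwise estimate with one
    -- radius for all `t`.
    have h1 : dist (γ + ContinuousMap.const X (y - γ t)) γ < r := by
      rw [dist_eq_norm, add_sub_cancel_left]
      refine lt_of_le_of_lt ((ContinuousMap.norm_le _ (norm_nonneg (y - γ t))).2 fun s => le_rfl) ?_
      rwa [← dist_eq_norm]
    have h2 := (ContinuousMap.norm_coe_le_norm _ t).trans
      ((dist_eq_norm (f'.comp (γ + ContinuousMap.const X (y - γ t))) (f'.comp γ)).symm.le.trans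
        (hr' h1).le)
    simpa using h2
  have hht : ‖h t‖ < r := (h.norm_coe_le_norm t).trans_lt hh
  have h3 := (convex_ball (γ t) r).norm_image_sub_le_of_norm_hasFDerivWithin_le'
    (f := f) (f' := f') (φ := f' (γ t)) (C := c)
    (fun y _ => (hf y).hasFDerivWithinAt) key (Metric.mem_ball_self hr)
    (y := γ t + h t) (by simpa [dist_eq_norm] using hht)
  simp only [add_sub_cancel_left] at h3
  exact h3.trans (mul_le_mul_of_nonneg_left (h.norm_coe_le_norm t) hc.le)

/-- The derivative is a bounded linear map applied to composition with `fderiv ℝ f`, so one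
derivative is gained by induction. The spaces vary inside the induction because the target changes
from `F` to `E →L[ℝ] F`. -/
theorem contDiff_postcomp_nat (n : ℕ) : ∀ {E F : Type} [NormedAddCommGroup E] [NormedSpace ℝ E]
    [NormedAddCommGroup F] [NormedSpace ℝ F] (f : C(E, F)), ContDiff ℝ n f →
    ContDiff ℝ n (fun γ : C(X, E) => f.comp γ) := by
  induction n with
  | zero =>
    intro E F _ _ _ _ f _
    exact contDiff_zero.2 (ContinuousMap.continuous_postcomp f)
  | succ n ih =>
    intro E F _ _ _ _ f hf
    have hf1 : ContDiff ℝ n (fderiv ℝ f) := hf.fderiv_right (by norm_cast)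
    let f' : C(E, E →L[ℝ] F) := ⟨fderiv ℝ f, hf1.continuous⟩
    rw [Nat.cast_succ, contDiff_succ_iff_hasFDerivAt]
    refine ⟨fun γ => pointwiseApply X E F (f'.comp γ), ?_, ?_⟩
    · exact (pointwiseApply X E F).contDiff.comp (ih f' hf1)
    · exact fun γ => hasFDerivAt_postcomp f f'
        (fun x => (hf.differentiable (by simp) x).hasFDerivAt) γ

/-- Composition with a smooth map is a smooth map between spaces of continuous functions. -/
theorem contDiff_postcomp {E F : Type} [NormedAddCommGroup E] [NormedSpace ℝ E]
    [NormedAddCommGroup F] [NormedSpace ℝ F] (f : C(E, F)) (hf : ContDiff ℝ ∞ f) :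
    ContDiff ℝ ∞ (fun γ : C(X, E) => f.comp γ) :=
  contDiff_infty.2 fun n => contDiff_postcomp_nat n f (hf.of_le (by exact_mod_cast le_top))

end Superposition


/-! ### Smooth dependence of solutions of ordinary differential equations on time and initial value
-/

section SmoothFlow

/-- The interval `[-1, 1]`. -/
abbrev UnitInterval : Type := Icc (-1 : ℝ) 1

/-- The right endpoint of `[-1, 1]`. -/
def rightEnd : UnitInterval := ⟨1, by norm_num, le_rfl⟩

/-- The continuous extension of a function on `[-1, 1]` that is constant outside. -/
def extendLine {E : Type} [NormedAddCommGroup E] (g : C(UnitInterval, E)) (u : ℝ) : E := g (projIcc (-1) 1 (by norm_num) u)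

theorem continuous_extendLine {E : Type} [NormedAddCommGroup E] (g : C(UnitInterval, E)) : Continuous (extendLine g) :=
  g.continuous.comp continuous_projIcc

theorem norm_extendLine_le {E : Type} [NormedAddCommGroup E] (g : C(UnitInterval, E)) (u : ℝ) : ‖extendLine g u‖ ≤ ‖g‖ :=
  g.norm_coe_le_norm _

variable {E : Type} [NormedAddCommGroup E] [NormedSpace ℝ E] [CompleteSpace E]

/-- The primitive of a continuous function on `[-1, 1]` that vanishes at `0`. -/
def primitiveMap (E : Type) [NormedAddCommGroup E] [NormedSpace ℝ E] [CompleteSpace E] :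
    C(UnitInterval, E) →L[ℝ] C(UnitInterval, E) :=
  LinearMap.mkContinuous
    { toFun := fun g => ⟨fun t => ∫ u in (0 : ℝ)..t, extendLine g u,
        (intervalIntegral.continuous_primitive
          (fun a b => (continuous_extendLine g).intervalIntegrable a b) 0).comp
          continuous_subtype_val⟩
      map_add' := fun g h => by
        ext t
        exact intervalIntegral.integral_add ((continuous_extendLine g).intervalIntegrable _ _)
          ((continuous_extendLine h).intervalIntegrable _ _)
      map_smul' := fun c g => by
        ext t
        exact intervalIntegral.integral_smul c (extendLine g) } 1 (fun g => by
    rw [ContinuousMap.norm_le _ (by positivity)]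
    intro t
    refine (intervalIntegral.norm_integral_le_of_norm_le_const
      (fun u _ => norm_extendLine_le g u)).trans ?_
    have : |(t : ℝ) - 0| ≤ 1 := by rw [sub_zero]; exact abs_le.2 t.2
    nlinarith [norm_nonneg g])

theorem primitiveMap_apply (g : C(UnitInterval, E)) (t : UnitInterval) :
    primitiveMap E g t = ∫ u in (0 : ℝ)..t, extendLine g u := rfl

/-- The map whose zeros in `γ` are the solutions of `γ' = w f(γ)`, `γ(0) = x`, on `[-1, 1]`,
together with the parameters `w` and `x`. -/
def integralEquation (f : C(E, E)) (z : ℝ × E × C(UnitInterval, E)) :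
    ℝ × E × C(UnitInterval, E) :=
  (z.1, z.2.1, z.2.2 - ContinuousMap.const _ z.2.1 - z.1 • primitiveMap E (f.comp z.2.2))

/-- Constant functions, as a continuous linear map. -/
def constMap (E : Type) [NormedAddCommGroup E] [NormedSpace ℝ E] :
    E →L[ℝ] C(UnitInterval, E) :=
  LinearMap.mkContinuous
    { toFun := fun x => ContinuousMap.const _ x
      map_add' := fun x y => rfl
      map_smul' := fun c x => rfl } 1 (fun x => by
    rw [ContinuousMap.norm_le _ (by positivity)]
    intro t
    exact (one_mul ‖x‖).ge)

theorem contDiff_integralEquation (f : C(E, E)) (hf : ContDiff ℝ ∞ f) :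
    ContDiff ℝ ∞ (integralEquation f) := by
  have h1 : ContDiff ℝ ∞ (fun z : ℝ × E × C(UnitInterval, E) => primitiveMap E (f.comp z.2.2)) :=
    (primitiveMap E).contDiff.comp ((contDiff_postcomp f hf).comp contDiff_snd.snd)
  exact contDiff_fst.prodMk (contDiff_snd.fst.prodMk
    ((contDiff_snd.snd.sub ((constMap E).contDiff.comp contDiff_snd.fst)).sub
      (contDiff_fst.smul h1)))

/-- The linearization of `integralEquation f` at `w = 0` and a constant function. -/
def linearizedEquation (c : C(UnitInterval, E)) :
    (ℝ × E × C(UnitInterval, E)) ≃L[ℝ] (ℝ × E × C(UnitInterval, E)) :=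
  ContinuousLinearEquiv.equivOfInverse
    ((ContinuousLinearMap.fst ℝ _ _).prod (((ContinuousLinearMap.fst ℝ _ _).comp
      (ContinuousLinearMap.snd ℝ _ _)).prod
      (((ContinuousLinearMap.snd ℝ _ _).comp (ContinuousLinearMap.snd ℝ _ _) -
        (constMap E).comp ((ContinuousLinearMap.fst ℝ _ _).comp (ContinuousLinearMap.snd ℝ _ _))) -
        (ContinuousLinearMap.fst ℝ _ _).smulRight c)))
    ((ContinuousLinearMap.fst ℝ _ _).prod (((ContinuousLinearMap.fst ℝ _ _).comp
      (ContinuousLinearMap.snd ℝ _ _)).prod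
      (((ContinuousLinearMap.snd ℝ _ _).comp (ContinuousLinearMap.snd ℝ _ _) +
        (constMap E).comp ((ContinuousLinearMap.fst ℝ _ _).comp (ContinuousLinearMap.snd ℝ _ _))) +
        (ContinuousLinearMap.fst ℝ _ _).smulRight c)))
    (fun z => Prod.ext rfl (Prod.ext rfl (by simp; abel)))
    (fun z => Prod.ext rfl (Prod.ext rfl (by simp; abel)))

/-- The nonlinear term carries the factor `w`, so at `w = 0` its derivative in `γ` drops out. What
remains is triangular and is inverted by changing signs. -/
theorem hasFDerivAt_integralEquation (f : C(E, E)) (hf : ContDiff ℝ ∞ f) (x : E) :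
    HasFDerivAt (integralEquation f)
      (linearizedEquation (primitiveMap E (f.comp (ContinuousMap.const _ x))) :
        (ℝ × E × C(UnitInterval, E)) →L[ℝ] (ℝ × E × C(UnitInterval, E)))
      (0, x, ContinuousMap.const _ x) := by
  have h1 : DifferentiableAt ℝ
      (fun z : ℝ × E × C(UnitInterval, E) => primitiveMap E (f.comp z.2.2))
      (0, x, ContinuousMap.const _ x) :=
    ((primitiveMap E).contDiff.comp ((contDiff_postcomp f hf).comp
      contDiff_snd.snd)).contDiffAt.differentiableAt (by simp)
  have h2 := (hasFDerivAt_fst (𝕜 := ℝ) (p := ((0 : ℝ), x, ContinuousMap.const UnitInterval x))).smul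
    h1.hasFDerivAt
  have h3 := hasFDerivAt_fst (𝕜 := ℝ) (p := ((0 : ℝ), x, ContinuousMap.const UnitInterval x))
  have h4 := hasFDerivAt_snd (𝕜 := ℝ) (p := ((0 : ℝ), x, ContinuousMap.const UnitInterval x))
  have h5 := h3.prodMk (h4.fst.prodMk ((h4.snd.sub
    ((constMap E).hasFDerivAt.comp (0, x, ContinuousMap.const UnitInterval x) h4.fst)).sub h2))
  refine h5.congr_fderiv ?_
  ext z <;> simp [linearizedEquation]

/-- A smooth, globally Lipschitz vector field has a smooth local flow. -/
theorem exists_smooth_flow_of_lipschitz (f : C(E, E)) (hf : ContDiff ℝ ∞ f) {K : NNReal}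
    (hK : LipschitzWith K f) (x₀ : E) :
    ∃ w > 0, ∃ N : Set E, IsOpen N ∧ x₀ ∈ N ∧ ∃ ψ : ℝ → E → E,
      ContDiffOn ℝ ∞ (fun z : ℝ × E => ψ z.1 z.2) (Ioo (-w) w ×ˢ N) ∧
      ∀ x ∈ N, ψ 0 x = x ∧ ∀ t ∈ Ioo (-w) w, HasDerivAt (fun s => ψ s x) (f (ψ t x)) t := by
  obtain ⟨e, he, -, hef, hes⟩ := exists_smooth_localInverse isOpen_univ
    (contDiff_integralEquation f hf).contDiffOn (mem_univ _) _ (hasFDerivAt_integralEquation f hf x₀)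
  -- The third component `0` expresses that the integral equation holds: inverting at `j (t, x)`
  -- yields the solution of `γ' = t f(γ)` with `γ(0) = x`, whose value at the right end is the flow
  -- at time `t`.
  let j : ℝ × E → ℝ × E × C(UnitInterval, E) := fun z => (z.1, z.2, 0)
  have hj : ContDiff ℝ ∞ j := contDiff_fst.prodMk (contDiff_snd.prodMk contDiff_const)
  have hmem : e.target ∈ 𝓝 (j (0, x₀)) := by
    refine e.open_target.mem_nhds ?_
    have : j (0, x₀) = e (0, x₀, ContinuousMap.const _ x₀) := by
      rw [hef]
      simp [j, integralEquation]
    rw [this]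
    exact e.map_source he
  have hnhds := hj.continuous.continuousAt.preimage_mem_nhds hmem
  rw [nhds_prod_eq, mem_prod_iff] at hnhds
  obtain ⟨I₀, hI₀, N₀, hN₀, hIN⟩ := hnhds
  obtain ⟨w, hw, hwI⟩ := Metric.mem_nhds_iff.1 hI₀
  obtain ⟨N, hNN₀, hN, hxN⟩ := mem_nhds_iff.1 hN₀
  rw [Real.ball_eq_Ioo, zero_sub, zero_add] at hwI
  have hsub : ∀ t ∈ Ioo (-w) w, ∀ x ∈ N, j (t, x) ∈ e.target := fun t ht x hx =>
    hIN (mk_mem_prod (hwI ht) (hNN₀ hx))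
  let γ : ℝ → E → C(UnitInterval, E) := fun t x => (e.symm (j (t, x))).2.2
  have hγ : ∀ t ∈ Ioo (-w) w, ∀ x ∈ N, ∀ u, γ t x u = x + ∫ v in (0 : ℝ)..u,
      t • f (extendLine (γ t x) v) := by
    intro t ht x hx u
    have h1 := e.right_inv (hsub t ht x hx)
    rw [hef] at h1
    have h2 : (e.symm (j (t, x))).1 = t := congrArg Prod.fst h1
    have h3 : (e.symm (j (t, x))).2.1 = x := congrArg (fun z => z.2.1) h1
    have h4 : γ t x - ContinuousMap.const _ (e.symm (j (t, x))).2.1 -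
      (e.symm (j (t, x))).1 • primitiveMap E (f.comp (γ t x)) = 0 := congrArg (fun z => z.2.2) h1
    rw [h2, h3] at h4
    have h5 := congrArg (fun g : C(UnitInterval, E) => g u) h4
    simp only [ContinuousMap.sub_apply, ContinuousMap.const_apply, ContinuousMap.smul_apply,
      primitiveMap_apply, ContinuousMap.zero_apply] at h5
    rw [intervalIntegral.integral_smul]
    rw [sub_sub, sub_eq_zero] at h5
    exact h5
  let c : ℝ → E → ℝ → E := fun t x u => x + ∫ v in (0 : ℝ)..u, t • f (extendLine (γ t x) v)
  have hc0 : ∀ t x, c t x 0 = x := fun t x => by simp [c]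
  have hc : ∀ t ∈ Ioo (-w) w, ∀ x ∈ N, ∀ u ∈ Icc (-1 : ℝ) 1,
      HasDerivAt (c t x) (t • f (c t x u)) u := by
    intro t ht x hx u hu
    have h1 : Continuous fun v => t • f (extendLine (γ t x) v) :=
      (f.continuous.comp (continuous_extendLine _)).const_smul t
    have h2 := (intervalIntegral.integral_hasDerivAt_right (h1.intervalIntegrable 0 u)
      h1.stronglyMeasurable.stronglyMeasurableAtFilter h1.continuousAt).const_add x
    have h3 : extendLine (γ t x) u = c t x u := by
      rw [extendLine, projIcc_of_mem _ hu]
      exact hγ t ht x hx ⟨u, hu⟩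
    rwa [h3] at h2
  -- Solutions with different speeds `s` and `T` are reparametrizations of one another, by
  -- uniqueness. This turns differentiation in the parameter `s` into differentiation along one
  -- fixed solution.
  have hcT : ∀ T ∈ Ioo 0 w, ∀ s ∈ Icc (-T) T, ∀ x ∈ N, c s x 1 = c T x (s / T) := by
    intro T hT s hs x hx
    have hTI : T ∈ Ioo (-w) w := ⟨by linarith [hT.1, hT.2], hT.2⟩
    have hsI : s ∈ Ioo (-w) w := ⟨by linarith [hs.1, hT.2], by linarith [hs.2, hT.2]⟩
    have hquot : ∀ u ∈ Icc (0 : ℝ) 1, u * (s / T) ∈ Icc (-1 : ℝ) 1 := by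
      intro u hu
      have h1 : |s / T| ≤ 1 := by
        rw [abs_div, abs_of_pos hT.1, div_le_one hT.1]
        exact abs_le.2 hs
      have h2 : |u * (s / T)| ≤ 1 := by
        rw [abs_mul, abs_of_nonneg hu.1]
        nlinarith [abs_nonneg (s / T), hu.2, hu.1]
      exact abs_le.1 h2
    have h1 : ∀ u ∈ Icc (0 : ℝ) 1, HasDerivAt (c s x) (s • f (c s x u)) u := fun u hu =>
      hc s hsI x hx u ⟨by linarith [hu.1], hu.2⟩
    have h2 : ∀ u ∈ Icc (0 : ℝ) 1, HasDerivAt (fun u => c T x (u * (s / T)))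
        (s • f (c T x (u * (s / T)))) u := by
      intro u hu
      have h3 := (hc T hTI x hx _ (hquot u hu)).scomp u ((hasDerivAt_id u).mul_const (s / T))
      rw [one_mul, smul_smul, div_mul_cancel₀ _ hT.1.ne'] at h3
      exact h3
    have h4 := ODE_solution_unique (v := fun _ y => s • f y) (K := ‖s‖₊ * K)
      (f := c s x) (g := fun u => c T x (u * (s / T))) (a := 0) (b := 1)
      (fun _ => (lipschitzWith_smul s).comp hK)
      (fun u hu => (h1 u hu).continuousAt.continuousWithinAt)
      (fun u hu => (h1 u ⟨hu.1, hu.2.le⟩).hasDerivWithinAt)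
      (fun u hu => (h2 u hu).continuousAt.continuousWithinAt)
      (fun u hu => (h2 u ⟨hu.1, hu.2.le⟩).hasDerivWithinAt)
      (by simp only [zero_mul, hc0])
    have h5 := h4 (right_mem_Icc.2 zero_le_one)
    simpa using h5
  have hψc : ∀ t ∈ Ioo (-w) w, ∀ x ∈ N, γ t x rightEnd = c t x 1 := fun t ht x hx => hγ t ht x hx rightEnd
  refine ⟨w, hw, N, hN, hxN, fun t x => γ t x rightEnd, ?_, fun x hx => ⟨?_, fun t ht => ?_⟩⟩
  · have h1 : ContDiffOn ℝ ∞ (fun z : ℝ × E => e.symm (j z)) (Ioo (-w) w ×ˢ N) :=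
      hes.comp hj.contDiffOn fun z hz => hsub z.1 hz.1 z.2 hz.2
    exact (ContinuousMap.evalCLM ℝ rightEnd).contDiff.comp_contDiffOn h1.snd.snd
  · have h0 : (0 : ℝ) ∈ Ioo (-w) w := ⟨by linarith, hw⟩
    show γ 0 x rightEnd = x
    rw [hψc 0 h0 x hx]
    simp [c]
  · obtain ⟨T, hT1, hT2⟩ := exists_between (abs_lt.2 ht)
    have hT : T ∈ Ioo 0 w := ⟨(abs_nonneg t).trans_lt hT1, hT2⟩
    have hTI : T ∈ Ioo (-w) w := ⟨by linarith [hT.1], hT2⟩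
    obtain ⟨ht1, ht2⟩ := abs_lt.1 hT1
    have heq : (fun s => γ s x rightEnd) =ᶠ[𝓝 t] fun s => c T x (s / T) := by
      filter_upwards [Ioo_mem_nhds ht1 ht2] with s hs
      rw [hψc s ⟨by linarith [hs.1], by linarith [hs.2]⟩ x hx]
      exact hcT T hT s ⟨hs.1.le, hs.2.le⟩ x hx
    have h1 : t / T ∈ Icc (-1 : ℝ) 1 := by
      refine abs_le.1 ?_
      rw [abs_div, abs_of_pos hT.1, div_le_one hT.1]
      exact hT1.le
    have h2 := (hc T hTI x hx _ h1).scomp t ((hasDerivAt_id t).div_const T)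
    rw [smul_smul, one_div_mul_cancel hT.1.ne', one_smul] at h2
    have h3 := h2.congr_of_eventuallyEq heq
    rwa [← heq.eq_of_nhds] at h3

/-- A vector field that is smooth on an open set has a smooth local flow near each point. -/
theorem exists_smooth_flow [FiniteDimensional ℝ E] {f : E → E} {U : Set E} (hU : IsOpen U)
    (hf : ContDiffOn ℝ ∞ f U) {x₀ : E} (hx₀ : x₀ ∈ U) :
    ∃ w > 0, ∃ N : Set E, IsOpen N ∧ x₀ ∈ N ∧ ∃ ψ : ℝ → E → E,
      ContDiffOn ℝ ∞ (fun z : ℝ × E => ψ z.1 z.2) (Ioo (-w) w ×ˢ N) ∧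
      ∀ x ∈ N, ψ 0 x = x ∧ ∀ t ∈ Ioo (-w) w, ψ t x ∈ U ∧
        HasDerivAt (fun s => ψ s x) (f (ψ t x)) t := by
  obtain ⟨r, hr, hrU⟩ := Metric.isOpen_iff.1 hU x₀ hx₀
  -- The cut-off field has compact support and so is globally Lipschitz; it coincides with `f` on
  -- the ball of radius `r / 3`, in which short solutions remain.
  let χ : ContDiffBump x₀ := ⟨r / 3, r / 2, by positivity, by linarith⟩
  have hg : ContDiff ℝ ∞ fun x => χ x • f x := by
    rw [contDiff_iff_contDiffAt]
    intro x
    by_cases hx : x ∈ U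
    · exact χ.contDiff.contDiffAt.smul (hf.contDiffAt (hU.mem_nhds hx))
    · have h1 : (fun x => χ x • f x) =ᶠ[𝓝 x] fun _ => 0 := by
        have h2 : x ∉ tsupport χ := fun h => hx (hrU (by
          rw [χ.tsupport_eq] at h
          exact (Metric.closedBall_subset_ball (by show r / 2 < r; linarith)) h))
        have h3 := notMem_tsupport_iff_eventuallyEq.1 h2
        filter_upwards [h3] with y hy
        rw [hy]
        simp
      exact contDiffAt_const.congr_of_eventuallyEq h1
  have hsupp : HasCompactSupport fun x => χ x • f x := χ.hasCompactSupport.smul_right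
  obtain ⟨K, hK⟩ := (hg.of_le (m := 1) (by simp)).lipschitzWith_of_hasCompactSupport hsupp (by simp)
  obtain ⟨w, hw, N, hN, hxN, ψ, hψ, hψ'⟩ :=
    exists_smooth_flow_of_lipschitz ⟨_, hg.continuous⟩ hg hK x₀
  have h0 : ((0 : ℝ), x₀) ∈ Ioo (-w) w ×ˢ N := ⟨⟨by linarith, hw⟩, hxN⟩
  have hmem : (fun z : ℝ × E => ψ z.1 z.2) ⁻¹' Metric.ball x₀ (r / 3) ∈ 𝓝 ((0 : ℝ), x₀) := by
    have h1 : (0 : ℝ) ∈ Ioo (-w) w := ⟨by linarith, hw⟩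
    refine (hψ.continuousOn.continuousAt ((isOpen_Ioo.prod hN).mem_nhds h0)).preimage_mem_nhds ?_
    show Metric.ball x₀ (r / 3) ∈ 𝓝 (ψ 0 x₀)
    rw [(hψ' x₀ hxN).1]
    exact Metric.ball_mem_nhds _ (by positivity)
  have hmem' := Filter.inter_mem hmem ((isOpen_Ioo.prod hN).mem_nhds h0)
  rw [nhds_prod_eq, mem_prod_iff] at hmem'
  obtain ⟨I₁, hI₁, N₁, hN₁, hIN⟩ := hmem'
  obtain ⟨w', hw', hwI⟩ := Metric.mem_nhds_iff.1 hI₁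
  obtain ⟨N', hNN', hN', hxN'⟩ := mem_nhds_iff.1 hN₁
  rw [Real.ball_eq_Ioo, zero_sub, zero_add] at hwI
  have hsub : ∀ t ∈ Ioo (-w') w', ∀ x ∈ N', (t, x) ∈ Ioo (-w) w ×ˢ N ∧
      ψ t x ∈ Metric.ball x₀ (r / 3) := fun t ht x hx =>
    ⟨(hIN (mk_mem_prod (hwI ht) (hNN' hx))).2, (hIN (mk_mem_prod (hwI ht) (hNN' hx))).1⟩
  refine ⟨w', hw', N', hN', hxN', ψ, hψ.mono fun z hz => (hsub z.1 hz.1 z.2 hz.2).1,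
    fun x hx => ⟨(hψ' x (hsub 0 ⟨by linarith, hw'⟩ x hx).1.2).1, fun t ht => ?_⟩⟩
  obtain ⟨h1, h2⟩ := hsub t ht x hx
  refine ⟨hrU (Metric.ball_subset_ball (by linarith) h2), ?_⟩
  have h3 := (hψ' x h1.2).2 t h1.1
  have h4 : χ (ψ t x) = 1 := χ.one_of_mem_closedBall (Metric.ball_subset_closedBall h2)
  simpa [h4] using h3

omit [CompleteSpace E] in
/-- Two solutions of an ordinary differential equation with the same initial value agree near it. -/
theorem eventuallyEq_of_hasDerivAt {f : E → E} {U : Set E} (hU : IsOpen U)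
    (hf : ContDiffOn ℝ ∞ f U) {α β : ℝ → E} {t₀ : ℝ} (hα₀ : α t₀ ∈ U)
    (hα : ∀ᶠ t in 𝓝 t₀, HasDerivAt α (f (α t)) t) (hβ : ∀ᶠ t in 𝓝 t₀, HasDerivAt β (f (β t)) t)
    (h : α t₀ = β t₀) : α =ᶠ[𝓝 t₀] β := by
  obtain ⟨K, s, hs, hK⟩ := ((hf.contDiffAt (hU.mem_nhds hα₀)).of_le
    (m := 1) (by simp)).exists_lipschitzOnWith
  have h1 : ∀ᶠ t in 𝓝 t₀, α t ∈ s := hα.self_of_nhds.continuousAt.eventually hs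
  have h2 : ∀ᶠ t in 𝓝 t₀, β t ∈ s := hβ.self_of_nhds.continuousAt.eventually (h ▸ hs)
  exact ODE_solution_unique_of_eventually (v := fun _ => f) (s := fun _ => s)
    (Eventually.of_forall fun _ => hK) (hα.and h1) (hβ.and h2) h

end SmoothFlow


/-! ### Regularized curves and uniqueness of their continuation -/

/-- The gradient of a real function on the plane. -/
def grad (V : ℂ → ℝ) (q : ℂ) : ℂ := ⟨fderiv ℝ V q 1, fderiv ℝ V q Complex.I⟩

theorem fderiv_eq_grad (V : ℂ → ℝ) (q v : ℂ) :
    fderiv ℝ V q v = (grad V q).re * v.re + (grad V q).im * v.im := by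
  have h : v = v.re • (1 : ℂ) + v.im • Complex.I := by
    apply Complex.ext <;> simp
  conv_lhs => rw [h]
  rw [map_add, map_smul, map_smul]
  simp [grad, mul_comm]

theorem contDiffOn_grad {V : ℂ → ℝ} {U : Set ℂ} (hU : IsOpen U) (hV : ContDiffOn ℝ ∞ V U) :
    ContDiffOn ℝ ∞ (grad V) U := by
  have h := hV.fderiv_of_isOpen (m := ∞) hU (by simp)
  have h1 : ContDiffOn ℝ ∞ (fun q => fderiv ℝ V q 1) U := h.clm_apply contDiffOn_const
  have h2 : ContDiffOn ℝ ∞ (fun q => fderiv ℝ V q Complex.I) U := h.clm_apply contDiffOn_const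
  exact (Complex.equivRealProdCLM.symm : (ℝ × ℝ) →L[ℝ] ℂ).contDiff.comp_contDiffOn (h1.prodMk h2)

/-- A potential with a Coulomb singularity of negative sign at each point of a set `S` without
accumulation points. -/
structure LocallyCoulomb (S : Set ℂ) (V : ℂ → ℝ) : Prop where
  smooth : ContDiffOn ℝ ∞ V Sᶜ
  isolated : ∀ q, ∀ᶠ u in 𝓝[≠] q, u ∉ S
  coulomb : ∀ σ ∈ S, ∃ Z > 0, ∃ ε > 0, ContDiffOn ℝ ∞ (leviCivita V σ Z) (Metric.ball 0 ε)

/-- The Hamiltonian vector field of `½ p² + V(q)`. -/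
def newtonField (V : ℂ → ℝ) (x : ℂ × ℂ) : ℂ × ℂ := (-grad V x.2, x.1)

/-- Momentum and position of a curve at time `t`. -/
def state (γ : ℝ → ℂ) (t : ℝ) : ℂ × ℂ := (deriv γ t, γ t)

/-- Near the time `t`, the curve `γ` solves Newton's equation if it is off `S`, and it is reflected
by an isolated collision if `γ t ∈ S`. -/
structure IsRegularizedAt (S : Set ℂ) (V : ℂ → ℝ) (γ : ℝ → ℂ) (t : ℝ) : Prop where
  continuousAt : ContinuousAt γ t
  newton : γ t ∉ S → HasDerivAt (state γ) (newtonField V (state γ t)) t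
  reflect : γ t ∈ S → ∀ᶠ u in 𝓝 0, γ (t + u) = γ (t - u)
  isolated : γ t ∈ S → ∀ᶠ u in 𝓝[≠] t, γ u ∉ S

theorem state_congr {γ δ : ℝ → ℂ} {t : ℝ} (h : γ =ᶠ[𝓝 t] δ) : state γ t = state δ t :=
  Prod.ext h.deriv_eq h.eq_of_nhds

theorem state_eventuallyEq {γ δ : ℝ → ℂ} {t : ℝ} (h : γ =ᶠ[𝓝 t] δ) : state γ =ᶠ[𝓝 t] state δ :=
  h.eventuallyEq_nhds.mono fun _ hu => state_congr hu

theorem state_comp_add (γ : ℝ → ℂ) (a t : ℝ) : state (fun u => γ (a + u)) t = state γ (a + t) :=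
  Prod.ext (deriv_comp_const_add γ a t) rfl

section

variable {S : Set ℂ} {V : ℂ → ℝ}

theorem LocallyCoulomb.isClosed (hC : LocallyCoulomb S V) : IsClosed S := by
  rw [← isOpen_compl_iff, isOpen_iff_mem_nhds]
  intro q hq
  have h := hC.isolated q
  rw [eventually_nhdsWithin_iff] at h
  filter_upwards [h] with u hu
  by_cases huq : u = q
  · rwa [huq]
  · exact hu huq

theorem LocallyCoulomb.isOpen_cotangentBundle (hC : LocallyCoulomb S V) :
    IsOpen (cotangentBundle S) :=
  hC.isClosed.isOpen_compl.preimage continuous_snd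

theorem LocallyCoulomb.contDiffOn_newtonField (hC : LocallyCoulomb S V) :
    ContDiffOn ℝ ∞ (newtonField V) (cotangentBundle S) :=
  (((contDiffOn_grad hC.isClosed.isOpen_compl hC.smooth).comp contDiffOn_snd
    fun _ hx => hx).neg).prodMk contDiffOn_fst

theorem IsRegularizedAt.congr {γ δ : ℝ → ℂ} {t : ℝ} (h : IsRegularizedAt S V γ t)
    (he : γ =ᶠ[𝓝 t] δ) : IsRegularizedAt S V δ t where
  continuousAt := h.continuousAt.congr he
  newton ht := by
    rw [← he.eq_of_nhds] at ht
    rw [← state_congr he]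
    exact (h.newton ht).congr_of_eventuallyEq (state_eventuallyEq he).symm
  reflect ht := by
    rw [← he.eq_of_nhds] at ht
    have h1 : Tendsto (fun u => t + u) (𝓝 0) (𝓝 t) :=
      (continuous_const.add continuous_id).tendsto' (0 : ℝ) t (by simp)
    have h2 : Tendsto (fun u => t - u) (𝓝 0) (𝓝 t) :=
      (continuous_const.sub continuous_id).tendsto' (0 : ℝ) t (by simp)
    filter_upwards [h.reflect ht, h1.eventually he, h2.eventually he] with u hu h3 h4
    rw [← h3, ← h4, hu]
  isolated ht := by
    rw [← he.eq_of_nhds] at ht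
    filter_upwards [h.isolated ht, he.filter_mono nhdsWithin_le_nhds] with u hu h3
    rwa [← h3]

theorem IsRegularizedAt.comp_add {γ : ℝ → ℂ} {a t : ℝ} (h : IsRegularizedAt S V γ (a + t)) :
    IsRegularizedAt S V (fun u => γ (a + u)) t where
  continuousAt := h.continuousAt.comp (continuous_const.add continuous_id).continuousAt
  newton ht := by
    have h1 : state (fun u => γ (a + u)) = fun u => state γ (a + u) :=
      funext fun u => state_comp_add γ a u
    rw [h1]
    exact (h.newton ht).comp_const_add a t
  reflect ht := by
    simpa only [add_assoc, add_sub_assoc] using h.reflect ht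
  isolated ht := by
    have h1 : Tendsto (fun u => a + u) (𝓝[≠] t) (𝓝[≠] (a + t)) := by
      refine tendsto_nhdsWithin_of_tendsto_nhds_of_eventually_within _ ?_ ?_
      · exact ((continuous_const.add continuous_id).tendsto t).mono_left nhdsWithin_le_nhds
      · filter_upwards [self_mem_nhdsWithin] with u hu
        simpa using hu
    exact h1.eventually (h.isolated ht)

/-- A solution of Newton's equation in phase space gives a regularized curve. -/
theorem isRegularizedAt_of_hasDerivAt {α : ℝ → ℂ × ℂ} {t : ℝ}
    (hα : ∀ᶠ u in 𝓝 t, HasDerivAt α (newtonField V (α u)) u) (hS : (α t).2 ∉ S) :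
    IsRegularizedAt S V (fun u => (α u).2) t ∧ state (fun u => (α u).2) =ᶠ[𝓝 t] α := by
  have h1 : state (fun u => (α u).2) =ᶠ[𝓝 t] α := by
    filter_upwards [hα] with u hu
    have h2 : HasDerivAt (fun v => (α v).2) (newtonField V (α u)).2 u := hu.snd
    exact Prod.ext h2.deriv rfl
  refine ⟨⟨continuous_snd.continuousAt.comp hα.self_of_nhds.continuousAt, fun _ => ?_, fun h => absurd h hS,
    fun h => absurd h hS⟩, h1⟩
  rw [h1.eq_of_nhds]
  exact hα.self_of_nhds.congr_of_eventuallyEq h1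

/-- Off `S` both states solve the same smooth first-order equation, so ordinary local uniqueness
applies. -/
theorem eventuallyEq_of_state_eq (hC : LocallyCoulomb S V) {γ δ : ℝ → ℂ} {t : ℝ}
    (hγ : ∀ᶠ u in 𝓝 t, IsRegularizedAt S V γ u) (hδ : ∀ᶠ u in 𝓝 t, IsRegularizedAt S V δ u)
    (hS : γ t ∉ S) (h : state γ t = state δ t) : γ =ᶠ[𝓝 t] δ := by
  have hδS : δ t ∉ S := by
    have h0 : γ t = δ t := congrArg Prod.snd h
    rwa [← h0]
  have key : ∀ {ξ : ℝ → ℂ}, (∀ᶠ u in 𝓝 t, IsRegularizedAt S V ξ u) → ξ t ∉ S →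
      ∀ᶠ u in 𝓝 t, HasDerivAt (state ξ) (newtonField V (state ξ u)) u := by
    intro ξ hξ hξS
    filter_upwards [hξ, hξ.self_of_nhds.continuousAt.eventually
      (hC.isClosed.isOpen_compl.mem_nhds hξS)] with u hu hu'
    exact hu.newton hu'
  have h1 := eventuallyEq_of_hasDerivAt hC.isOpen_cotangentBundle hC.contDiffOn_newtonField
    (show state γ t ∈ cotangentBundle S from hS) (key hγ hS) (key hδ hδS) h
  exact h1.mono fun u hu => congrArg Prod.snd hu

/-- Momentum as well as position is continuous at a collision-free time, so equality of states
passes to the limit. At a collision only positions would pass to the limit. -/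
theorem eventuallyEq_of_mem_closure (hC : LocallyCoulomb S V) {γ δ : ℝ → ℂ} {t : ℝ}
    (hγ : ∀ᶠ u in 𝓝 t, IsRegularizedAt S V γ u) (hδ : ∀ᶠ u in 𝓝 t, IsRegularizedAt S V δ u)
    (hS : γ t ∉ S) (h : t ∈ closure {u | γ =ᶠ[𝓝 u] δ}) : γ =ᶠ[𝓝 t] δ := by
  rw [mem_closure_iff_frequently] at h
  have h1 : γ t = δ t := tendsto_nhds_unique_of_frequently_eq hγ.self_of_nhds.continuousAt
    hδ.self_of_nhds.continuousAt (h.mono fun u hu => hu.eq_of_nhds)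
  have hδS : δ t ∉ S := by rwa [← h1]
  exact eventuallyEq_of_state_eq hC hγ hδ hS (tendsto_nhds_unique_of_frequently_eq
    (hγ.self_of_nhds.newton hS).continuousAt (hδ.self_of_nhds.newton hδS).continuousAt
    (h.mono fun u hu => state_congr hu))

theorem eventuallyEq_on_of_regular (hC : LocallyCoulomb S V) {γ δ : ℝ → ℂ} {J : Set ℝ}
    (hJ : IsPreconnected J) (hJo : IsOpen J)
    (hγ : ∀ u ∈ J, IsRegularizedAt S V γ u) (hδ : ∀ u ∈ J, IsRegularizedAt S V δ u)
    (hS : ∀ u ∈ J, γ u ∉ S) (h : ∃ u ∈ J, γ =ᶠ[𝓝 u] δ) : ∀ u ∈ J, γ =ᶠ[𝓝 u] δ := by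
  refine hJ.subset_of_closure_inter_subset (u := {u | γ =ᶠ[𝓝 u] δ}) isOpen_setOfPred_eventually_nhds ?_ ?_
  · obtain ⟨u, hu, hu'⟩ := h
    exact ⟨u, hu, hu'⟩
  · rintro u ⟨hu, huJ⟩
    exact eventuallyEq_of_mem_closure hC (eventually_of_mem (hJo.mem_nhds huJ) hγ)
      (eventually_of_mem (hJo.mem_nhds huJ) hδ) (hS u huJ) hu

theorem exists_reflection_interval {γ : ℝ → ℂ} {t : ℝ} (h : IsRegularizedAt S V γ t)
    (hS : γ t ∈ S) : ∀ᶠ η in 𝓝[>] (0 : ℝ), ∀ u, |u| < η → γ (t + u) = γ (t - u) ∧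
      (u ≠ 0 → γ (t + u) ∉ S) := by
  have h1 := h.isolated hS
  rw [eventually_nhdsWithin_iff] at h1
  have h3 : Tendsto (fun u => t + u) (𝓝 0) (𝓝 t) :=
    (continuous_const.add continuous_id).tendsto' (0 : ℝ) t (by simp)
  have h2 := (h.reflect hS).and (h3.eventually h1)
  obtain ⟨η, hη, h4⟩ := Metric.eventually_nhds_iff.1 h2
  filter_upwards [Ioo_mem_nhdsGT hη] with η' hη' u hu
  obtain ⟨h5, h6⟩ := h4 (y := u) (by rw [Real.dist_0_eq_abs]; exact hu.trans hη'.2)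
  exact ⟨h5, fun hu0 => h6 (by simpa using hu0)⟩

/-- Regularized curves are determined by momentum and position at one time. -/
theorem eventuallyEq_on_of_state_eq (hC : LocallyCoulomb S V) {γ δ : ℝ → ℂ} {J : Set ℝ}
    (hJ : IsPreconnected J) (hJo : IsOpen J)
    (hγ : ∀ u ∈ J, IsRegularizedAt S V γ u) (hδ : ∀ u ∈ J, IsRegularizedAt S V δ u)
    {t₀ : ℝ} (ht₀ : t₀ ∈ J) (hS : γ t₀ ∉ S) (h : state γ t₀ = state δ t₀) :
    ∀ u ∈ J, γ =ᶠ[𝓝 u] δ := by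
  refine hJ.subset_of_closure_inter_subset (u := {u | γ =ᶠ[𝓝 u] δ}) isOpen_setOfPred_eventually_nhds
    ⟨t₀, ht₀, eventuallyEq_of_state_eq hC (eventually_of_mem (hJo.mem_nhds ht₀) hγ)
      (eventually_of_mem (hJo.mem_nhds ht₀) hδ) hS h⟩ ?_
  rintro t ⟨ht, htJ⟩
  by_cases hγS : γ t ∈ S
  swap
  · exact eventuallyEq_of_mem_closure hC (eventually_of_mem (hJo.mem_nhds htJ) hγ)
      (eventually_of_mem (hJo.mem_nhds htJ) hδ) hγS ht
  have hδS : δ t ∈ S := by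
    rw [← tendsto_nhds_unique_of_frequently_eq (hγ t htJ).continuousAt (hδ t htJ).continuousAt
      ((mem_closure_iff_frequently.1 ht).mono fun u hu => hu.eq_of_nhds)]
    exact hγS
  obtain ⟨r, hr, hrJ⟩ := Metric.isOpen_iff.1 hJo t htJ
  obtain ⟨η, ⟨h1, h2⟩, hη⟩ := (((exists_reflection_interval (hγ t htJ) hγS).and
    (exists_reflection_interval (hδ t htJ) hδS)).and (Ioo_mem_nhdsGT hr)).exists
  have hsub : ∀ u, |u| < η → t + u ∈ J := fun u hu => hrJ (by
    rw [Metric.mem_ball, Real.dist_eq, add_sub_cancel_left]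
    exact hu.trans hη.2)
  obtain ⟨u, hu, huA⟩ := (mem_closure_iff_nhds.1 ht) _ (Metric.ball_mem_nhds t hη.1)
  rw [Metric.mem_ball, Real.dist_eq] at hu
  by_cases hut : u = t
  · rwa [hut] at huA
  -- One common point on a side of the collision gives agreement on that whole side, since the side
  -- is collision-free. Reflection of both curves then carries the agreement to the other side.
  have key : ∀ a b : ℝ, -η ≤ a → b ≤ η → (∀ v ∈ Ioo a b, v ≠ 0) → u - t ∈ Ioo a b →
      ∀ v ∈ Ioo a b, γ (t + v) = δ (t + v) := by
    intro a b ha hb h0 hab v hv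
    have hlt : ∀ x ∈ Ioo (t + a) (t + b), |x - t| < η := fun x hx =>
      abs_lt.2 ⟨by linarith [hx.1], by linarith [hx.2]⟩
    have h3 := eventuallyEq_on_of_regular hC (J := Ioo (t + a) (t + b)) isPreconnected_Ioo isOpen_Ioo
      (fun x hx => hγ x (by simpa using hsub (x - t) (hlt x hx)))
      (fun x hx => hδ x (by simpa using hsub (x - t) (hlt x hx)))
      (fun x hx => by
        simpa using (h1 (x - t) (hlt x hx)).2
          (h0 _ ⟨by linarith [hx.1], by linarith [hx.2]⟩))
      ⟨u, ⟨by linarith [hab.1], by linarith [hab.2]⟩, huA⟩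
    exact (h3 (t + v) ⟨by linarith [hv.1], by linarith [hv.2]⟩).eq_of_nhds
  have hzero : γ (t + 0) = δ (t + 0) := by
    rw [add_zero]
    exact tendsto_nhds_unique_of_frequently_eq (hγ t htJ).continuousAt (hδ t htJ).continuousAt
      ((mem_closure_iff_frequently.1 ht).mono fun u hu => hu.eq_of_nhds)
  have hmain : ∀ v, |v| < η → γ (t + v) = δ (t + v) := by
    intro v hv
    obtain ⟨hv1, hv2⟩ := abs_lt.1 hv
    obtain ⟨hu1, hu2⟩ := abs_lt.1 hu
    rcases lt_trichotomy (u - t) 0 with hlt | heq | hgt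
    · have hneg := key (-η) 0 le_rfl hη.1.le (fun v hv => hv.2.ne) ⟨hu1, hlt⟩
      rcases lt_trichotomy v 0 with h3 | rfl | h3
      · exact hneg v ⟨hv1, h3⟩
      · exact hzero
      · rw [(h1 v hv).1, (h2 v hv).1]
        exact hneg (-v) ⟨by linarith, by linarith⟩
    · exact absurd (by linarith) hut
    · have hpos := key 0 η (by linarith [hη.1]) le_rfl (fun v hv => hv.1.ne') ⟨hgt, hu2⟩
      rcases lt_trichotomy v 0 with h3 | rfl | h3
      · have h4 := h1 (-v) (by rwa [abs_neg])
        have h5 := h2 (-v) (by rwa [abs_neg])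
        rw [sub_neg_eq_add] at h4 h5
        rw [← h4.1, ← h5.1]
        exact hpos (-v) ⟨by linarith, by linarith⟩
      · exact hzero
      · exact hpos v ⟨h3, hv2⟩
  filter_upwards [Metric.ball_mem_nhds t hη.1] with x hx
  rw [Metric.mem_ball, Real.dist_eq] at hx
  simpa using hmain (x - t) hx

end


theorem two_le_infty : (2 : WithTop ℕ∞) ≤ ∞ := WithTop.coe_le_coe.2 (le_top : ((2 : ℕ∞) ≤ ⊤))

/-! ### Continuation of local relations in time, and conservation of energy -/

section Relation

/-- A transitive relation on a dense set of times that holds locally holds globally. -/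
theorem relation_of_local {J D : Set ℝ} (hJ : IsPreconnected J) (hJo : IsOpen J)
    (hD : ∀ t ∈ J, ∀ᶠ u in 𝓝[≠] t, u ∈ D) {R : ℝ → ℝ → Prop}
    (htrans : ∀ u v w, u ∈ D → v ∈ D → w ∈ D → R u v → R v w → R u w)
    (hloc : ∀ t ∈ J, ∃ N ∈ 𝓝 t, ∀ u ∈ N ∩ D, ∀ v ∈ N ∩ D, R u v) {u v : ℝ}
    (hu : u ∈ J ∩ D) (hv : v ∈ J ∩ D) : R u v := by
  have hopen : IsOpen {t | ∀ᶠ w in 𝓝 t, w ∈ D → R u w} := isOpen_setOfPred_eventually_nhds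
  have h := hJ.subset_of_closure_inter_subset hopen ?_ ?_
  · exact (h hv.1).self_of_nhds hv.2
  · obtain ⟨N, hN, hN'⟩ := hloc u hu.1
    refine ⟨u, hu.1, ?_⟩
    filter_upwards [hN] with w hw hwD
    exact hN' u ⟨mem_of_mem_nhds hN, hu.2⟩ w ⟨hw, hwD⟩
  · rintro t ⟨ht, htJ⟩
    obtain ⟨N, hN, hN'⟩ := hloc t htJ
    obtain ⟨a, haN, ha⟩ := mem_closure_iff_nhds.1 ht (interior N ∩ J)
      (Filter.inter_mem (interior_mem_nhds.2 hN) (hJo.mem_nhds htJ))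
    have h1 : ∀ᶠ w in 𝓝[≠] a, w ∈ N ∧ (w ∈ D → R u w) ∧ w ∈ D := by
      filter_upwards [nhdsWithin_le_nhds (isOpen_interior.mem_nhds haN.1),
        nhdsWithin_le_nhds (show ∀ᶠ w in 𝓝 a, w ∈ D → R u w from ha), hD a haN.2] with w h1 h2 h3
      exact ⟨interior_subset h1, h2, h3⟩
    -- The point `a` need not lie in `D`. A nearby point `w` of `D` inside `N` serves as the
    -- intermediate link for transitivity.
    obtain ⟨w, hwN, hwR, hwD⟩ := h1.exists
    show ∀ᶠ w in 𝓝 t, w ∈ D → R u w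
    filter_upwards [hN] with x hx hxD
    exact htrans u w x hu.2 hwD hxD (hwR hwD) (hN' w ⟨hwN, hwD⟩ x ⟨hx, hxD⟩)

end Relation

section Energy

variable {S : Set ℂ} {V : ℂ → ℝ}

theorem IsRegularizedAt.eventually_notMem (hC : LocallyCoulomb S V) {γ : ℝ → ℂ} {t : ℝ}
    (h : IsRegularizedAt S V γ t) : ∀ᶠ u in 𝓝[≠] t, γ u ∉ S := by
  by_cases ht : γ t ∈ S
  · exact h.isolated ht
  · exact nhdsWithin_le_nhds (h.continuousAt.eventually (hC.isClosed.isOpen_compl.mem_nhds ht))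

theorem hasDerivAt_hamiltonian (hC : LocallyCoulomb S V) {α : ℝ → ℂ × ℂ} {t : ℝ}
    (h : HasDerivAt α (newtonField V (α t)) t) (ht : (α t).2 ∉ S) :
    HasDerivAt (fun u => hamiltonian V (α u)) 0 t := by
  have h1 : HasDerivAt (fun u => (α u).1) (-grad V (α t).2) t := h.fst
  have h2 : HasDerivAt (fun u => (α u).2) (α t).1 t := h.snd
  have h3 : HasFDerivAt V (fderiv ℝ V (α t).2) (α t).2 :=
    ((hC.smooth.contDiffAt (hC.isClosed.isOpen_compl.mem_nhds ht)).differentiableAt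
      (by simp)).hasFDerivAt
  have h4 := h3.comp_hasDerivAt t h2
  have h5 : HasDerivAt (fun u => (α u).1.re) (-grad V (α t).2).re t :=
    Complex.reCLM.hasFDerivAt.comp_hasDerivAt t h1
  have h6 : HasDerivAt (fun u => (α u).1.im) (-grad V (α t).2).im t :=
    Complex.imCLM.hasFDerivAt.comp_hasDerivAt t h1
  have h7 := ((((h5.mul h5).add (h6.mul h6)).div_const 2).add h4)
  refine (h7.congr_deriv ?_).congr_of_eventuallyEq (Eventually.of_forall fun u => ?_)
  · rw [fderiv_eq_grad]
    simp only [Complex.neg_re, Complex.neg_im]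
    ring
  · simp [hamiltonian, Complex.normSq_apply]

theorem hamiltonian_eq_of_regular (hC : LocallyCoulomb S V) {γ : ℝ → ℂ} {J : Set ℝ}
    (hJ : IsPreconnected J) (hJo : IsOpen J) (hγ : ∀ u ∈ J, IsRegularizedAt S V γ u)
    (hS : ∀ u ∈ J, γ u ∉ S) {u v : ℝ} (hu : u ∈ J) (hv : v ∈ J) :
    hamiltonian V (state γ u) = hamiltonian V (state γ v) := by
  have h : ∀ t ∈ J, HasDerivAt (fun u => hamiltonian V (state γ u)) 0 t := fun t ht =>
    hasDerivAt_hamiltonian hC ((hγ t ht).newton (hS t ht)) (hS t ht)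
  exact hJo.is_const_of_deriv_eq_zero hJ
    (fun t ht => (h t ht).differentiableAt.differentiableWithinAt) (fun t ht => (h t ht).deriv) hu hv

/-- Reflection in time reverses the velocity, and the Hamiltonian is even in the momentum. -/
theorem hamiltonian_reflect {γ : ℝ → ℂ} {t u : ℝ} (h : ∀ᶠ v in 𝓝 u, γ (t + v) = γ (t - v)) :
    hamiltonian V (state γ (t + u)) = hamiltonian V (state γ (t - u)) := by
  have h1 : (fun v => γ (t + v)) =ᶠ[𝓝 u] fun v => γ (t - v) := h
  have h2 := h1.deriv_eq
  rw [deriv_comp_const_add, deriv_comp_const_sub] at h2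
  simp only [hamiltonian, state, h2, h.self_of_nhds, Complex.normSq_neg]

/-- The energy is constant along a regularized curve. -/
theorem hamiltonian_eq (hC : LocallyCoulomb S V) {γ : ℝ → ℂ} {J : Set ℝ}
    (hJ : IsPreconnected J) (hJo : IsOpen J) (hγ : ∀ u ∈ J, IsRegularizedAt S V γ u)
    {u v : ℝ} (hu : u ∈ J) (hv : v ∈ J) (huS : γ u ∉ S) (hvS : γ v ∉ S) :
    hamiltonian V (state γ u) = hamiltonian V (state γ v) := by
  refine relation_of_local (D := {t | γ t ∉ S}) hJ hJo
    (fun t ht => (hγ t ht).eventually_notMem hC)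
    (R := fun u v => hamiltonian V (state γ u) = hamiltonian V (state γ v))
    (fun _ _ _ _ _ _ h1 h2 => h1.trans h2) ?_ ⟨hu, huS⟩ ⟨hv, hvS⟩
  intro t ht
  obtain ⟨r, hr, hrJ⟩ := Metric.isOpen_iff.1 hJo t ht
  by_cases htS : γ t ∈ S
  · obtain ⟨η, h1, hη, hηr⟩ := ((exists_reflection_interval (hγ t ht) htS).and
      (Ioo_mem_nhdsGT hr)).exists
    have hlt : ∀ x ∈ Ioo (t - η) (t + η), |x - t| < η := fun x hx =>
      abs_lt.2 ⟨by linarith [hx.1], by linarith [hx.2]⟩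
    have hneg : ∀ x ∈ Ioo (t - η) t, ∀ y ∈ Ioo (t - η) t,
        hamiltonian V (state γ x) = hamiltonian V (state γ y) := by
      intro x hx y hy
      refine hamiltonian_eq_of_regular hC isPreconnected_Ioo isOpen_Ioo ?_ ?_ hx hy
      · intro z hz
        exact hγ z (hrJ (by
          rw [Metric.mem_ball, Real.dist_eq]
          exact (hlt z ⟨hz.1, by linarith [hz.2]⟩).trans hηr))
      · intro z hz
        have h2 := (h1 (z - t) (hlt z ⟨hz.1, by linarith [hz.2]⟩)).2 (by linarith [hz.2])
        rwa [add_sub_cancel] at h2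
    -- Each time after the collision is exchanged for its mirror image before it, so that all
    -- comparisons take place in one collision-free interval.
    have hpos : ∀ x ∈ Ioo (t - η) (t + η), x ≠ t → ∃ y ∈ Ioo (t - η) t,
        hamiltonian V (state γ x) = hamiltonian V (state γ y) := by
      intro x hx hxt
      rcases lt_or_gt_of_ne hxt with h | h
      · exact ⟨x, ⟨hx.1, h⟩, rfl⟩
      · refine ⟨t - (x - t), ⟨by linarith [hx.2], by linarith⟩, ?_⟩
        have h2 : ∀ᶠ v in 𝓝 (x - t), γ (t + v) = γ (t - v) := by
          filter_upwards [Ioo_mem_nhds (show -η < x - t by linarith)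
            (show x - t < η by linarith [hx.2])] with v hv
          exact (h1 v (abs_lt.2 hv)).1
        have h3 := hamiltonian_reflect (V := V) h2
        rwa [add_sub_cancel] at h3
    refine ⟨Ioo (t - η) (t + η), Ioo_mem_nhds (by linarith) (by linarith), ?_⟩
    rintro x ⟨hx, hxS⟩ y ⟨hy, hyS⟩
    obtain ⟨x', hx', hxx'⟩ := hpos x hx (fun h => hxS (h ▸ htS))
    obtain ⟨y', hy', hyy'⟩ := hpos y hy (fun h => hyS (h ▸ htS))
    rw [hxx', hyy']
    exact hneg x' hx' y' hy'
  · obtain ⟨ρ, hρ, hρS⟩ := Metric.eventually_nhds_iff_ball.1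
      ((hγ t ht).continuousAt.eventually (hC.isClosed.isOpen_compl.mem_nhds htS))
    refine ⟨Metric.ball t (min r ρ), Metric.ball_mem_nhds t (lt_min hr hρ), ?_⟩
    rintro x ⟨hx, -⟩ y ⟨hy, -⟩
    exact hamiltonian_eq_of_regular hC (convex_ball _ _).isPreconnected Metric.isOpen_ball
      (fun z hz => hγ z (hrJ (Metric.ball_subset_ball (min_le_left _ _) hz)))
      (fun z hz => hρS z (Metric.ball_subset_ball (min_le_right _ _) hz)) hx hy

end Energy

/-! ### The variational equation -/

section Variational

variable {E : Type*} [NormedAddCommGroup E] [NormedSpace ℝ E]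

/-- The derivative of a flow in the initial value solves the linearized equation. -/
theorem hasDerivAt_fderiv_flow {f : E → E} {U : Set E} (hU : IsOpen U) (hf : ContDiffOn ℝ ∞ f U)
    {ψ : ℝ → E → E} {W : Set (ℝ × E)} (hW : IsOpen W)
    (hψ : ContDiffOn ℝ ∞ (fun z : ℝ × E => ψ z.1 z.2) W)
    (hmem : ∀ z ∈ W, ψ z.1 z.2 ∈ U)
    (hode : ∀ z ∈ W, HasDerivAt (fun s => ψ s z.2) (f (ψ z.1 z.2)) z.1)
    {t : ℝ} {x : E} (hx : (t, x) ∈ W) (v : E) :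
    HasDerivAt (fun s => fderiv ℝ (ψ s) x v)
      (fderiv ℝ f (ψ t x) (fderiv ℝ (ψ t) x v)) t := by
  set Ψ : ℝ × E → E := fun z => ψ z.1 z.2 with hΨ
  have hat : ∀ z ∈ W, ContDiffAt ℝ ∞ Ψ z := fun z hz => hψ.contDiffAt (hW.mem_nhds hz)
  have hdiff : ∀ z ∈ W, HasFDerivAt Ψ (fderiv ℝ Ψ z) z := fun z hz =>
    ((hat z hz).differentiableAt (by simp)).hasFDerivAt
  have hpartial : ∀ z ∈ W, fderiv ℝ (ψ z.1) z.2 v = fderiv ℝ Ψ z (0, v) := by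
    intro z hz
    have h1 : HasFDerivAt (fun y : E => (z.1, y)) (ContinuousLinearMap.inr ℝ ℝ E) z.2 :=
      hasFDerivAt_prodMk_right z.1 z.2
    have h2 : HasFDerivAt (ψ z.1) ((fderiv ℝ Ψ z).comp (ContinuousLinearMap.inr ℝ ℝ E)) z.2 :=
      HasFDerivAt.comp (f := fun y : E => (z.1, y)) z.2 (hdiff z hz) h1
    rw [h2.fderiv]
    simp
  have htime : ∀ z ∈ W, fderiv ℝ Ψ z (1, 0) = f (Ψ z) := by
    intro z hz
    have h1 : HasDerivAt (fun s : ℝ => (s, z.2)) ((1 : ℝ), (0 : E)) z.1 :=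
      (hasDerivAt_id z.1).prodMk (hasDerivAt_const z.1 z.2)
    exact (HasFDerivAt.comp_hasDerivAt (f := fun s : ℝ => (s, z.2)) z.1 (hdiff z hz) h1).unique
      (hode z hz)
  have h2 : HasFDerivAt (fderiv ℝ Ψ) (fderiv ℝ (fderiv ℝ Ψ) (t, x)) (t, x) :=
    (((hat _ hx).fderiv_right (m := 1) (by rw [one_add_one_eq_two]; exact two_le_infty)).differentiableAt (by simp)).hasFDerivAt
  have hline : HasDerivAt (fun s : ℝ => (s, x)) ((1 : ℝ), (0 : E)) t :=
    (hasDerivAt_id t).prodMk (hasDerivAt_const t x)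
  have h3 : HasDerivAt (fun s => fderiv ℝ Ψ (s, x) (0, v))
      (fderiv ℝ (fderiv ℝ Ψ) (t, x) (1, 0) (0, v)) t := by
    have h4 := h2.comp_hasDerivAt t hline
    exact (ContinuousLinearMap.apply ℝ E ((0 : ℝ), v)).hasFDerivAt.comp_hasDerivAt t h4
  -- Symmetry of the second derivative exchanges differentiation in time with differentiation in the
  -- initial value.
  have hsymm : fderiv ℝ (fderiv ℝ Ψ) (t, x) (1, 0) (0, v) =
      fderiv ℝ (fderiv ℝ Ψ) (t, x) (0, v) (1, 0) :=
    ((hat _ hx).isSymmSndFDerivAt (by simpa using two_le_infty)).eq _ _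
  have h5 : fderiv ℝ (fderiv ℝ Ψ) (t, x) (0, v) (1, 0) =
      fderiv ℝ f (ψ t x) (fderiv ℝ (ψ t) x v) := by
    have h6 : HasFDerivAt (fun z => fderiv ℝ Ψ z (1, 0))
        ((ContinuousLinearMap.apply ℝ E ((1 : ℝ), (0 : E))).comp
          (fderiv ℝ (fderiv ℝ Ψ) (t, x))) (t, x) :=
      (ContinuousLinearMap.apply ℝ E ((1 : ℝ), (0 : E))).hasFDerivAt.comp (t, x) h2
    have h7 : HasFDerivAt (fun z => f (Ψ z)) ((fderiv ℝ f (Ψ (t, x))).comp (fderiv ℝ Ψ (t, x)))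
        (t, x) :=
      HasFDerivAt.comp (f := Ψ) (t, x) (((hf.contDiffAt (hU.mem_nhds (hmem _ hx))).differentiableAt
        (by simp)).hasFDerivAt) (hdiff _ hx)
    have h8 : (fun z => fderiv ℝ Ψ z (1, 0)) =ᶠ[𝓝 (t, x)] fun z => f (Ψ z) :=
      eventually_of_mem (hW.mem_nhds hx) htime
    have h9 := (h7.congr_of_eventuallyEq h8).unique h6
    have h10 := congrArg (fun A : ℝ × E →L[ℝ] E => A (0, v)) h9
    rw [hpartial _ hx]
    exact h10.symm
  rw [hsymm, h5] at h3
  refine h3.congr_of_eventuallyEq ?_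
  have h6 : ∀ᶠ s in 𝓝 t, (s, x) ∈ W :=
    hline.continuousAt.eventually (hW.mem_nhds hx)
  filter_upwards [h6] with s hs
  exact hpartial _ hs

end Variational

/-! ### Symplecticity of Newton's flow away from collisions -/

section Symplectic

variable {S : Set ℂ} {V : ℂ → ℝ}

theorem hasDerivAt_canonicalForm {α β : ℝ → ℂ × ℂ} {α' β' : ℂ × ℂ} {t : ℝ}
    (hα : HasDerivAt α α' t) (hβ : HasDerivAt β β' t) :
    HasDerivAt (fun s => canonicalForm (α s) (β s))
      (canonicalForm α' (β t) +
        canonicalForm (α t) β') t := by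
  have aux : ∀ {ξ : ℝ → ℂ × ℂ} {ξ' : ℂ × ℂ}, HasDerivAt ξ ξ' t →
      (HasDerivAt (fun s => (ξ s).1.re) ξ'.1.re t ∧ HasDerivAt (fun s => (ξ s).1.im) ξ'.1.im t) ∧
      HasDerivAt (fun s => (ξ s).2.re) ξ'.2.re t ∧ HasDerivAt (fun s => (ξ s).2.im) ξ'.2.im t := by
    intro ξ ξ' h
    have h1 : HasDerivAt (fun s => (ξ s).1) ξ'.1 t := h.fst
    have h2 : HasDerivAt (fun s => (ξ s).2) ξ'.2 t := h.snd
    exact ⟨⟨Complex.reCLM.hasFDerivAt.comp_hasDerivAt t h1,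
      Complex.imCLM.hasFDerivAt.comp_hasDerivAt t h1⟩,
      Complex.reCLM.hasFDerivAt.comp_hasDerivAt t h2,
      Complex.imCLM.hasFDerivAt.comp_hasDerivAt t h2⟩
  obtain ⟨⟨a1, a2⟩, a3, a4⟩ := aux hα
  obtain ⟨⟨b1, b2⟩, b3, b4⟩ := aux hβ
  refine ((((a3.mul b1).sub (a1.mul b3)).add ((a4.mul b2).sub (a2.mul b4))).congr_deriv ?_)
  simp only [canonicalForm]
  ring

/-- This is the symmetry of the Hessian of `V`; it is what makes the linearized Newton field
infinitesimally symplectic. -/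
theorem fderiv_grad_symm (hC : LocallyCoulomb S V) {q : ℂ} (hq : q ∉ S) (a b : ℂ) :
    (fderiv ℝ (grad V) q a).re * b.re + (fderiv ℝ (grad V) q a).im * b.im =
      (fderiv ℝ (grad V) q b).re * a.re + (fderiv ℝ (grad V) q b).im * a.im := by
  have hat := hC.smooth.contDiffAt (hC.isClosed.isOpen_compl.mem_nhds hq)
  have h2 : HasFDerivAt (fderiv ℝ V) (fderiv ℝ (fderiv ℝ V) q) q :=
    ((hat.fderiv_right (m := 1) (by rw [one_add_one_eq_two]; exact two_le_infty)).differentiableAt (by simp)).hasFDerivAt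
  have hg : HasFDerivAt (grad V) (fderiv ℝ (grad V) q) q :=
    (((contDiffOn_grad hC.isClosed.isOpen_compl hC.smooth).contDiffAt
      (hC.isClosed.isOpen_compl.mem_nhds hq)).differentiableAt (by simp)).hasFDerivAt
  have key : ∀ a b : ℂ, (fderiv ℝ (grad V) q a).re * b.re + (fderiv ℝ (grad V) q a).im * b.im =
      fderiv ℝ (fderiv ℝ V) q a b := by
    intro a b
    have h3 : HasFDerivAt (fun u => fderiv ℝ V u b)
        ((ContinuousLinearMap.apply ℝ ℝ b).comp (fderiv ℝ (fderiv ℝ V) q)) q :=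
      (ContinuousLinearMap.apply ℝ ℝ b).hasFDerivAt.comp q h2
    have h4 : HasFDerivAt (fun u => fderiv ℝ V u b)
        (b.re • Complex.reCLM.comp (fderiv ℝ (grad V) q) +
          b.im • Complex.imCLM.comp (fderiv ℝ (grad V) q)) q := by
      have h5 := ((Complex.reCLM.hasFDerivAt.comp q hg).const_mul b.re).add
        ((Complex.imCLM.hasFDerivAt.comp q hg).const_mul b.im)
      refine h5.congr_of_eventuallyEq (Eventually.of_forall fun u => ?_)
      exact (fderiv_eq_grad V u b).trans (by simp [mul_comm])
    have h6 := congrArg (fun A : ℂ →L[ℝ] ℝ => A a) (h4.unique h3)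
    simp at h6
    rw [← h6]
    ring
  rw [key, key]
  exact (hat.isSymmSndFDerivAt (by simpa using two_le_infty)).eq a b

/-- The linearization of Newton's equation is infinitesimally symplectic. -/
theorem canonicalForm_fderiv_newtonField (hC : LocallyCoulomb S V) {x : ℂ × ℂ} (hx : x.2 ∉ S)
    (v w : ℂ × ℂ) : canonicalForm (fderiv ℝ (newtonField V) x v) w +
      canonicalForm v (fderiv ℝ (newtonField V) x w) = 0 := by
  have hg : HasFDerivAt (grad V) (fderiv ℝ (grad V) x.2) x.2 :=
    (((contDiffOn_grad hC.isClosed.isOpen_compl hC.smooth).contDiffAt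
      (hC.isClosed.isOpen_compl.mem_nhds hx)).differentiableAt (by simp)).hasFDerivAt
  have h1 : HasFDerivAt (newtonField V)
      ((-(fderiv ℝ (grad V) x.2).comp (ContinuousLinearMap.snd ℝ ℂ ℂ)).prod
        (ContinuousLinearMap.fst ℝ ℂ ℂ)) x :=
    (HasFDerivAt.comp x hg hasFDerivAt_snd).neg.prodMk hasFDerivAt_fst
  rw [h1.fderiv]
  have h2 := fderiv_grad_symm hC hx v.2 w.2
  simp only [canonicalForm, ContinuousLinearMap.prod_apply, neg_apply,
    ContinuousLinearMap.comp_apply, ContinuousLinearMap.coe_fst', ContinuousLinearMap.coe_snd',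
    Complex.neg_re, Complex.neg_im]
  linarith

/-- The flow of Newton's equation is symplectic. -/
theorem canonicalForm_fderiv_flow (hC : LocallyCoulomb S V) {w : ℝ} {N : Set (ℂ × ℂ)}
    (hN : IsOpen N) {ψ : ℝ → ℂ × ℂ → ℂ × ℂ}
    (hψ : ContDiffOn ℝ ∞ (fun z : ℝ × ℂ × ℂ => ψ z.1 z.2) (Ioo (-w) w ×ˢ N))
    (hψ' : ∀ x ∈ N, ψ 0 x = x ∧ ∀ t ∈ Ioo (-w) w, ψ t x ∈ cotangentBundle S ∧
        HasDerivAt (fun s => ψ s x) (newtonField V (ψ t x)) t)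
    {t : ℝ} (ht : t ∈ Ioo (-w) w) {x : ℂ × ℂ} (hx : x ∈ N) (v v' : ℂ × ℂ) :
    canonicalForm (fderiv ℝ (ψ t) x v) (fderiv ℝ (ψ t) x v') = canonicalForm v v' := by
  have hd : ∀ s ∈ Ioo (-w) w, HasDerivAt (fun s => canonicalForm (fderiv ℝ (ψ s) x v)
      (fderiv ℝ (ψ s) x v')) 0 s := by
    intro s hs
    have h1 := fun a : ℂ × ℂ => hasDerivAt_fderiv_flow hC.isOpen_cotangentBundle
      hC.contDiffOn_newtonField (isOpen_Ioo.prod hN) hψ (fun z hz => ((hψ' z.2 hz.2).2 z.1 hz.1).1)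
      (fun z hz => ((hψ' z.2 hz.2).2 z.1 hz.1).2) (mk_mem_prod hs hx) a
    exact (hasDerivAt_canonicalForm (h1 v) (h1 v')).congr_deriv
      (canonicalForm_fderiv_newtonField hC ((hψ' x hx).2 s hs).1 _ _)
  have h0 : (0 : ℝ) ∈ Ioo (-w) w := by
    have := ht.1.trans ht.2
    constructor <;> linarith
  have h1 := isOpen_Ioo.is_const_of_deriv_eq_zero isPreconnected_Ioo
    (fun s hs => (hd s hs).differentiableAt.differentiableWithinAt) (fun s hs => (hd s hs).deriv)
    ht h0
  have h2 : ψ 0 =ᶠ[𝓝 x] id := eventually_of_mem (hN.mem_nhds hx) fun y hy => (hψ' y hy).1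
  rw [h1, h2.fderiv_eq]
  simp

end Symplectic


/-! ### Levi-Civita coordinates and the regularized vector field -/

/-- The extended Levi-Civita space, with points `(Q, P, E, T)`. -/
abbrev LCSpace : Type := ℂ × ℂ × ℝ × ℝ

/-- The regularized Hamiltonian vector field on the extended Levi-Civita space. -/
def lcField (f : ℂ → ℝ) (z : LCSpace) : LCSpace :=
  (z.2.1 / 4, -grad f z.1 + 2 * z.2.2.1 * z.1, 0, Complex.normSq z.1)

/-- The regularized Hamiltonian. -/
def lcEnergy (f : ℂ → ℝ) (z : LCSpace) : ℝ :=
  Complex.normSq z.2.1 / 8 + f z.1 - z.2.2.1 * Complex.normSq z.1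

/-- Momentum and position of a point of the extended Levi-Civita space. -/
def lcDown (σ : ℂ) (z : LCSpace) : ℂ × ℂ := (z.2.1 / (2 * (starRingEnd ℂ) z.1), σ + z.1 ^ 2)

/-- Levi-Civita coordinates around a nucleus. -/
structure CollisionChart (S : Set ℂ) (V : ℂ → ℝ) (σ : ℂ) (Z ε : ℝ) : Prop where
  mem : σ ∈ S
  Z_pos : 0 < Z
  ε_pos : 0 < ε
  smooth : ContDiffOn ℝ ∞ (leviCivita V σ Z) (Metric.ball 0 ε)
  notMem : ∀ Q ∈ Metric.ball (0 : ℂ) ε, Q ≠ 0 → σ + Q ^ 2 ∉ S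

theorem contDiff_normSq : ContDiff ℝ ∞ Complex.normSq := by
  have h : ContDiff ℝ ∞ fun z : ℂ => z.re * z.re + z.im * z.im :=
    (Complex.reCLM.contDiff.mul Complex.reCLM.contDiff).add
      (Complex.imCLM.contDiff.mul Complex.imCLM.contDiff)
  simpa only [← Complex.normSq_apply] using h

theorem hasDerivAt_normSq {Q : ℝ → ℂ} {Q' : ℂ} {s : ℝ} (h : HasDerivAt Q Q' s) :
    HasDerivAt (fun u => Complex.normSq (Q u)) (2 * ((Q s).re * Q'.re + (Q s).im * Q'.im)) s := by
  have h5 : HasDerivAt (fun u => (Q u).re) Q'.re s := Complex.reCLM.hasFDerivAt.comp_hasDerivAt s h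
  have h6 : HasDerivAt (fun u => (Q u).im) Q'.im s := Complex.imCLM.hasFDerivAt.comp_hasDerivAt s h
  refine (((h5.mul h5).add (h6.mul h6)).congr_deriv (by ring)).congr_of_eventuallyEq
    (Eventually.of_forall fun u => Complex.normSq_apply _)

section

variable {S : Set ℂ} {V : ℂ → ℝ} {σ : ℂ} {Z ε : ℝ}

theorem LocallyCoulomb.exists_collisionChart (hC : LocallyCoulomb S V) (hσ : σ ∈ S) :
    ∃ Z ε, CollisionChart S V σ Z ε := by
  obtain ⟨Z, hZ, ε₁, hε₁, h1⟩ := hC.coulomb σ hσ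
  have h2 := hC.isolated σ
  rw [eventually_nhdsWithin_iff] at h2
  have h3 : Tendsto (fun Q : ℂ => σ + Q ^ 2) (𝓝 0) (𝓝 σ) :=
    (by fun_prop : Continuous fun Q : ℂ => σ + Q ^ 2).tendsto' 0 σ (by simp)
  obtain ⟨ε₂, hε₂, h4⟩ := Metric.eventually_nhds_iff_ball.1 (h3.eventually h2)
  refine ⟨Z, min ε₁ ε₂, hσ, hZ, lt_min hε₁ hε₂,
    h1.mono (Metric.ball_subset_ball (min_le_left _ _)), fun Q hQ hQ0 => ?_⟩
  exact h4 Q (Metric.ball_subset_ball (min_le_right _ _) hQ) (by simpa using hQ0)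

theorem leviCivita_neg (V : ℂ → ℝ) (σ : ℂ) (Z : ℝ) (Q : ℂ) :
    leviCivita V σ Z (-Q) = leviCivita V σ Z Q := by
  simp [leviCivita]

/-- The regularized potential depends only on `Q²` and `|Q|`, hence is even and has odd gradient.
This is the source of the symmetry `Q ↦ -Q` that makes collisions reflections. -/
theorem grad_leviCivita_neg (V : ℂ → ℝ) (σ : ℂ) (Z : ℝ) (Q : ℂ) :
    grad (leviCivita V σ Z) (-Q) = -grad (leviCivita V σ Z) Q := by
  have h : ∀ v, fderiv ℝ (leviCivita V σ Z) (-Q) v = -fderiv ℝ (leviCivita V σ Z) Q v := by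
    intro v
    have h1 : leviCivita V σ Z ∘ ContinuousLinearEquiv.neg ℝ = leviCivita V σ Z :=
      funext fun Q => leviCivita_neg V σ Z Q
    have h2 := (ContinuousLinearEquiv.neg ℝ (M := ℂ)).comp_right_fderiv (f := leviCivita V σ Z)
      (x := Q)
    rw [h1] at h2
    rw [h2]
    simp
  apply Complex.ext <;> simp [grad, h]

theorem leviCivita_zero (V : ℂ → ℝ) (σ : ℂ) (Z : ℝ) : leviCivita V σ Z 0 = -Z := by
  simp [leviCivita]

theorem leviCivita_of_ne (V : ℂ → ℝ) (σ : ℂ) (Z : ℝ) {Q : ℂ} (hQ : Q ≠ 0) :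
    leviCivita V σ Z Q = V (σ + Q ^ 2) * Complex.normSq Q := by
  simp [leviCivita, hQ]

/-- The open domain of the Levi-Civita vector field. -/
def lcDomain (ε : ℝ) : Set LCSpace := {z | z.1 ∈ Metric.ball 0 ε}

theorem isOpen_lcDomain (ε : ℝ) : IsOpen (lcDomain ε) := Metric.isOpen_ball.preimage continuous_fst

theorem CollisionChart.contDiffOn_lcField (h : CollisionChart S V σ Z ε) :
    ContDiffOn ℝ ∞ (lcField (leviCivita V σ Z)) (lcDomain ε) := by
  have h1 : ContDiffOn ℝ ∞ (fun z : LCSpace => grad (leviCivita V σ Z) z.1) (lcDomain ε) :=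
    (contDiffOn_grad Metric.isOpen_ball h.smooth).comp contDiffOn_fst fun z hz => hz
  have h2 : ContDiff ℝ ∞ (fun z : LCSpace => 2 * (z.2.2.1 : ℂ) * z.1) :=
    (contDiff_const.mul (Complex.ofRealCLM.contDiff.comp contDiff_snd.snd.fst)).mul contDiff_fst
  have h3 : ContDiff ℝ ∞ (fun z : LCSpace => z.2.1 / 4) := contDiff_snd.fst.div_const 4
  exact h3.contDiffOn.prodMk ((h1.neg.add h2.contDiffOn).prodMk
    (contDiffOn_const.prodMk (contDiff_normSq.comp contDiff_fst).contDiffOn))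

theorem CollisionChart.contDiffOn_lcEnergy (h : CollisionChart S V σ Z ε) :
    ContDiffOn ℝ ∞ (lcEnergy (leviCivita V σ Z)) (lcDomain ε) := by
  have h1 : ContDiffOn ℝ ∞ (fun z : LCSpace => leviCivita V σ Z z.1) (lcDomain ε) :=
    h.smooth.comp contDiffOn_fst fun z hz => hz
  have h2 : ContDiff ℝ ∞ (fun z : LCSpace => z.2.2.1 * Complex.normSq z.1) :=
    contDiff_snd.snd.fst.mul (contDiff_normSq.comp contDiff_fst)
  have h3 : ContDiff ℝ ∞ (fun z : LCSpace => Complex.normSq z.2.1 / 8) :=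
    (contDiff_normSq.comp contDiff_snd.fst).div_const 8
  exact (h3.contDiffOn.add h1).sub h2.contDiffOn

/-- At `Q = 0` the energy equation reads `|P|² = 8Z`. Attraction, `Z > 0`, is used here: it makes
every collision transversal. -/
theorem CollisionChart.ne_zero_of_lcEnergy (h : CollisionChart S V σ Z ε) {z : LCSpace}
    (hz : lcEnergy (leviCivita V σ Z) z = 0) (hQ : z.1 = 0) : z.2.1 ≠ 0 := by
  intro hP
  simp only [lcEnergy, hQ, hP, leviCivita_zero, map_zero] at hz
  linarith [h.Z_pos]

/-- Off the collision the regularized energy is `|Q|² (H - E)`, so its zero level identifies the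
coordinate `E` with the physical energy. -/
theorem lcDown_energy {z : LCSpace} (hz : lcEnergy (leviCivita V σ Z) z = 0) (hQ : z.1 ≠ 0) :
    hamiltonian V (lcDown σ z) = z.2.2.1 := by
  have h0 : Complex.normSq z.1 ≠ 0 := by simpa using hQ
  simp only [lcEnergy, leviCivita_of_ne V σ Z hQ] at hz
  simp only [hamiltonian, lcDown, map_div₀, map_mul, Complex.normSq_conj, Complex.normSq_ofNat]
  field_simp
  linarith

theorem CollisionChart.lcDown_mem (h : CollisionChart S V σ Z ε) {z : LCSpace}
    (hz : z ∈ lcDomain ε) (hQ : z.1 ≠ 0) : lcDown σ z ∈ cotangentBundle S :=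
  h.notMem z.1 hz hQ

/-- The gradient of the regularized potential away from the collision. -/
theorem CollisionChart.grad_leviCivita (hC : LocallyCoulomb S V) (h : CollisionChart S V σ Z ε)
    {Q : ℂ} (hQ : Q ∈ Metric.ball 0 ε) (hQ0 : Q ≠ 0) :
    grad (leviCivita V σ Z) Q = 2 * Complex.normSq Q * (starRingEnd ℂ) Q * grad V (σ + Q ^ 2) +
      2 * V (σ + Q ^ 2) * Q := by
  have h1 : leviCivita V σ Z =ᶠ[𝓝 Q] fun Q => V (σ + Q ^ 2) * Complex.normSq Q := by
    filter_upwards [isOpen_ne.mem_nhds hQ0] with u hu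
    exact leviCivita_of_ne V σ Z hu
  have hV : HasFDerivAt V (fderiv ℝ V (σ + Q ^ 2)) (σ + Q ^ 2) :=
    ((hC.smooth.contDiffAt (hC.isClosed.isOpen_compl.mem_nhds (h.notMem Q hQ hQ0))).differentiableAt
      (by simp)).hasFDerivAt
  have key : ∀ v : ℂ, fderiv ℝ (leviCivita V σ Z) Q v =
      fderiv ℝ V (σ + Q ^ 2) (2 * Q * v) * Complex.normSq Q +
        V (σ + Q ^ 2) * (2 * (Q.re * v.re + Q.im * v.im)) := by
    intro v
    have hline : HasDerivAt (fun t : ℝ => Q + t * v) v 0 := by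
      simpa using ((hasDerivAt_id (0 : ℝ)).ofReal_comp.mul_const v).const_add Q
    have hsq : HasDerivAt (fun t : ℝ => σ + (Q + t * v) ^ 2) (2 * Q * v) 0 := by
      simpa using (hline.pow 2).const_add σ
    have hl : HasFDerivAt (leviCivita V σ Z) (fderiv ℝ (leviCivita V σ Z) Q) (Q + (0 : ℝ) * v) := by
      rw [Complex.ofReal_zero, zero_mul, add_zero]
      exact ((h.smooth.contDiffAt (Metric.isOpen_ball.mem_nhds hQ)).differentiableAt
        (by simp)).hasFDerivAt
    have h2 := hl.comp_hasDerivAt (0 : ℝ) hline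
    have hV' : HasFDerivAt V (fderiv ℝ V (σ + Q ^ 2)) (σ + (Q + (0 : ℝ) * v) ^ 2) := by
      rwa [Complex.ofReal_zero, zero_mul, add_zero]
    have h3 := (hV'.comp_hasDerivAt (0 : ℝ) hsq).mul (hasDerivAt_normSq hline)
    have hlim : Tendsto (fun t : ℝ => Q + t * v) (𝓝 0) (𝓝 Q) := by
      simpa using hline.continuousAt.tendsto
    have h4 : (leviCivita V σ Z ∘ fun t : ℝ => Q + t * v) =ᶠ[𝓝 0]
        ((V ∘ fun t : ℝ => σ + (Q + t * v) ^ 2) * fun t : ℝ => Complex.normSq (Q + t * v)) :=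
      hlim.eventually h1
    have h5 := (h3.congr_of_eventuallyEq h4).unique h2
    simpa using h5.symm
  have k1 := key 1
  have k2 := key Complex.I
  rw [fderiv_eq_grad V] at k1 k2
  apply Complex.ext
  · show fderiv ℝ (leviCivita V σ Z) Q 1 = _
    rw [k1]
    simp
    ring
  · show fderiv ℝ (leviCivita V σ Z) Q Complex.I = _
    rw [k2]
    simp
    ring

/-- The regularized energy is conserved. -/
theorem CollisionChart.hasDerivAt_lcEnergy (h : CollisionChart S V σ Z ε) {ζ : ℝ → LCSpace} {s : ℝ}
    (hζ : HasDerivAt ζ (lcField (leviCivita V σ Z) (ζ s)) s) (hs : ζ s ∈ lcDomain ε) :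
    HasDerivAt (fun u => lcEnergy (leviCivita V σ Z) (ζ u)) 0 s := by
  have h1 : HasDerivAt (fun u => (ζ u).1) ((ζ s).2.1 / 4) s := hζ.fst
  have h2 : HasDerivAt (fun u => (ζ u).2.1)
    (-grad (leviCivita V σ Z) (ζ s).1 + 2 * (ζ s).2.2.1 * (ζ s).1) s := hζ.snd.fst
  have h3 : HasDerivAt (fun u => (ζ u).2.2.1) 0 s := hζ.snd.snd.fst
  have hf : HasFDerivAt (leviCivita V σ Z) (fderiv ℝ (leviCivita V σ Z) (ζ s).1) (ζ s).1 :=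
    ((h.smooth.contDiffAt (Metric.isOpen_ball.mem_nhds hs)).differentiableAt (by simp)).hasFDerivAt
  have h4 := ((hasDerivAt_normSq h2).div_const 8).add (hf.comp_hasDerivAt s h1)
  have h5 := h4.sub (h3.mul (hasDerivAt_normSq h1))
  refine (h5.congr_deriv ?_)
  rw [fderiv_eq_grad]
  simp
  ring

/-- In physical time, solutions of the Levi-Civita equations solve Newton's equation. -/
theorem CollisionChart.hasDerivAt_lcDown (hC : LocallyCoulomb S V) (h : CollisionChart S V σ Z ε)
    {ζ : ℝ → LCSpace} {s : ℝ} (hζ : HasDerivAt ζ (lcField (leviCivita V σ Z) (ζ s)) s)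
    (hs : ζ s ∈ lcDomain ε) (hK : lcEnergy (leviCivita V σ Z) (ζ s) = 0) (hQ : (ζ s).1 ≠ 0) :
    HasDerivAt (fun u => lcDown σ (ζ u))
      (Complex.normSq (ζ s).1 • newtonField V (lcDown σ (ζ s))) s := by
  have h1 : HasDerivAt (fun u => (ζ u).1) ((ζ s).2.1 / 4) s := hζ.fst
  have h2 : HasDerivAt (fun u => (ζ u).2.1)
    (-grad (leviCivita V σ Z) (ζ s).1 + 2 * (ζ s).2.2.1 * (ζ s).1) s := hζ.snd.fst
  have hcQ : (starRingEnd ℂ) (ζ s).1 ≠ 0 := by simpa using hQ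
  have h3 : HasDerivAt (fun u => (starRingEnd ℂ) (ζ u).1) ((starRingEnd ℂ) ((ζ s).2.1 / 4)) s :=
    (Complex.conjCLE : ℂ →L[ℝ] ℂ).hasFDerivAt.comp_hasDerivAt s h1
  have h4 := h2.div (h3.const_mul 2) (mul_ne_zero two_ne_zero hcQ)
  have h5 : HasDerivAt (fun u => σ + (ζ u).1 ^ 2) (2 * (ζ s).1 * ((ζ s).2.1 / 4)) s := by
    simpa using (h1.pow 2).const_add σ
  refine (h4.prodMk h5).congr_deriv ?_
  simp only [lcEnergy, leviCivita_of_ne V σ Z hQ] at hK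
  have hK' : ((ζ s).2.1 * (starRingEnd ℂ) (ζ s).2.1) / 8 +
      V (σ + (ζ s).1 ^ 2) * ((ζ s).1 * (starRingEnd ℂ) (ζ s).1) -
      (ζ s).2.2.1 * ((ζ s).1 * (starRingEnd ℂ) (ζ s).1) = 0 := by
    rw [Complex.mul_conj, Complex.mul_conj]
    exact_mod_cast hK
  refine Prod.ext ?_ ?_
  · simp only [Prod.smul_fst, newtonField, lcDown, h.grad_leviCivita hC hs hQ, Complex.real_smul,
      Complex.normSq_eq_conj_mul_self, map_div₀, map_ofNat]
    set Q := (ζ s).1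
    set P := (ζ s).2.1
    field_simp
    -- The momentum equation becomes Newton's only on the zero level: the energy relation eliminates
    -- `|P|²`, which arises from differentiating `1 / Q̄`.
    linear_combination (-8) * hK'
  · simp only [Prod.smul_snd, newtonField, lcDown, Complex.real_smul,
      Complex.normSq_eq_conj_mul_self]
    field_simp
    ring

end


/-! ### From solutions in Levi-Civita coordinates to curves in physical time -/

/-- A strictly increasing continuous function on an open set of reals is an open map. -/
theorem nhds_le_map_of_strictMonoOn {T : ℝ → ℝ} {J : Set ℝ} (hJ : IsOpen J)
    (hT : ContinuousOn T J) (hm : StrictMonoOn T J) {s : ℝ} (hs : s ∈ J) :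
    𝓝 (T s) ≤ map T (𝓝 s) := by
  intro A hA
  rw [mem_map] at hA
  obtain ⟨r, hr, hrA⟩ := Metric.mem_nhds_iff.1 (Filter.inter_mem hA (hJ.mem_nhds hs))
  have hsub : Icc (s - r / 2) (s + r / 2) ⊆ T ⁻¹' A ∩ J := fun u hu => hrA (by
    rw [Metric.mem_ball, Real.dist_eq]
    exact (abs_le.2 ⟨by linarith [hu.1], by linarith [hu.2]⟩ : |u - s| ≤ r / 2).trans_lt
      (by linarith))
  have hl : s - r / 2 ∈ J := (hsub ⟨le_rfl, by linarith⟩).2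
  have hu : s + r / 2 ∈ J := (hsub ⟨by linarith, le_rfl⟩).2
  refine mem_of_superset (Icc_mem_nhds (hm hl hs (by linarith)) (hm hs hu (by linarith))) ?_
  refine (intermediate_value_Icc (by linarith) (hT.mono fun u hu => (hsub hu).2)).trans ?_
  rintro _ ⟨u, hu, rfl⟩
  exact (hsub hu).1

section

variable {S : Set ℂ} {V : ℂ → ℝ} {σ : ℂ} {Z ε : ℝ}

/-- A solution of the regularized equations on the energy surface. -/
structure IsLCSolution (f : ℂ → ℝ) (ε : ℝ) (ζ : ℝ → LCSpace) (J : Set ℝ) : Prop where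
  hasDerivAt : ∀ s ∈ J, HasDerivAt ζ (lcField f (ζ s)) s
  mem : ∀ s ∈ J, ζ s ∈ lcDomain ε
  energy : ∀ s ∈ J, lcEnergy f (ζ s) = 0

/-- A zero of `Q` is simple, since `Q' = P / 4` and `P ≠ 0` there. -/
theorem CollisionChart.eventually_ne_zero (h : CollisionChart S V σ Z ε) {ζ : ℝ → LCSpace}
    {J : Set ℝ} (hζ : IsLCSolution (leviCivita V σ Z) ε ζ J) {s : ℝ} (hs : s ∈ J) :
    ∀ᶠ u in 𝓝[≠] s, (ζ u).1 ≠ 0 := by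
  have h1 : HasDerivAt (fun u => (ζ u).1) ((ζ s).2.1 / 4) s := (hζ.hasDerivAt s hs).fst
  by_cases h0 : (ζ s).1 = 0
  · exact h1.eventually_ne (div_ne_zero (h.ne_zero_of_lcEnergy (hζ.energy s hs) h0) (by norm_num))
  · exact nhdsWithin_le_nhds (h1.continuousAt.eventually (isOpen_ne.mem_nhds h0))

/-- Physical time has derivative `|Q|² ≥ 0`. If it were constant on an interval then `Q` would
vanish there, against the isolation of its zeros. -/
theorem CollisionChart.strictMonoOn_time (h : CollisionChart S V σ Z ε) {ζ : ℝ → LCSpace}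
    {a b : ℝ} (hζ : IsLCSolution (leviCivita V σ Z) ε ζ (Ioo a b)) :
    StrictMonoOn (fun s => (ζ s).2.2.2) (Ioo a b) := by
  have hd : ∀ s ∈ Ioo a b, HasDerivAt (fun s => (ζ s).2.2.2) (Complex.normSq (ζ s).1) s :=
    fun s hs => (hζ.hasDerivAt s hs).snd.snd.snd
  have hmono : MonotoneOn (fun s => (ζ s).2.2.2) (Ioo a b) := by
    refine monotoneOn_of_deriv_nonneg (convex_Ioo a b)
      (fun s hs => (hd s hs).continuousAt.continuousWithinAt) (fun s hs => ?_) (fun s hs => ?_)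
    · exact (hd s (interior_subset hs)).differentiableAt.differentiableWithinAt
    · rw [(hd s (interior_subset hs)).deriv]
      exact Complex.normSq_nonneg _
  intro x hx y hy hxy
  refine lt_of_le_of_ne (hmono hx hy hxy.le) fun heq => ?_
  obtain ⟨c, hc1, hc2⟩ := exists_between hxy
  have hcJ : c ∈ Ioo a b := ⟨hx.1.trans hc1, hc2.trans hy.2⟩
  have hconst : ∀ u ∈ Ioo x y, (ζ u).2.2.2 = (ζ x).2.2.2 := by
    intro u hu
    have huJ : u ∈ Ioo a b := ⟨hx.1.trans hu.1, hu.2.trans hy.2⟩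
    exact le_antisymm ((hmono huJ hy hu.2.le).trans heq.ge) (hmono hx huJ hu.1.le)
  have hzero : ∀ u ∈ Ioo x y, (ζ u).1 = 0 := by
    intro u hu
    have huJ : u ∈ Ioo a b := ⟨hx.1.trans hu.1, hu.2.trans hy.2⟩
    have h1 : (fun s => (ζ s).2.2.2) =ᶠ[𝓝 u] fun _ => (ζ x).2.2.2 :=
      eventually_of_mem (Ioo_mem_nhds hu.1 hu.2) hconst
    have h2 := ((hasDerivAt_const u (ζ x).2.2.2).congr_of_eventuallyEq h1).unique (hd u huJ)
    exact Complex.normSq_eq_zero.1 h2.symm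
  obtain ⟨u, hu1, hu2⟩ := ((h.eventually_ne_zero hζ hcJ).and
    (nhdsWithin_le_nhds (Ioo_mem_nhds hc1 hc2))).exists
  exact hu1 (hzero u hu2)

/-- Reversing `s`, negating `Q` and reflecting `T` about the collision time maps solutions to
solutions and fixes the data at `Q = 0`; local uniqueness gives the identity. -/
theorem CollisionChart.reflection (h : CollisionChart S V σ Z ε) {ζ : ℝ → LCSpace} {J : Set ℝ}
    (hJ : IsOpen J) (hζ : IsLCSolution (leviCivita V σ Z) ε ζ J) {s : ℝ} (hs : s ∈ J)
    (h0 : (ζ s).1 = 0) :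
    ∀ᶠ u in 𝓝 0, (ζ (s + u)).1 = -(ζ (s - u)).1 ∧
      (ζ (s + u)).2.2.2 = 2 * (ζ s).2.2.2 - (ζ (s - u)).2.2.2 := by
  have hp : Tendsto (fun u => s + u) (𝓝 0) (𝓝 s) :=
    (continuous_const.add continuous_id).tendsto' (0 : ℝ) s (by simp)
  have hm : Tendsto (fun u => s - u) (𝓝 0) (𝓝 s) :=
    (continuous_const.sub continuous_id).tendsto' (0 : ℝ) s (by simp)
  let α : ℝ → LCSpace := fun u => ζ (s + u)
  let β : ℝ → LCSpace := fun u =>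
    (-(ζ (s - u)).1, (ζ (s - u)).2.1, (ζ (s - u)).2.2.1, 2 * (ζ s).2.2.2 - (ζ (s - u)).2.2.2)
  have hα : ∀ᶠ u in 𝓝 0, HasDerivAt α (lcField (leviCivita V σ Z) (α u)) u := by
    filter_upwards [hp.eventually (hJ.mem_nhds hs)] with u hu
    exact (hζ.hasDerivAt _ hu).comp_const_add s u
  have hβ : ∀ᶠ u in 𝓝 0, HasDerivAt β (lcField (leviCivita V σ Z) (β u)) u := by
    filter_upwards [hm.eventually (hJ.mem_nhds hs)] with u hu
    have h1 := (hζ.hasDerivAt _ hu).scomp u ((hasDerivAt_id u).const_sub s)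
    have h2 : HasDerivAt (fun u => ζ (s - u)) (-lcField (leviCivita V σ Z) (ζ (s - u))) u := by
      rw [neg_one_smul] at h1
      exact h1
    have a1 : HasDerivAt (fun u => (ζ (s - u)).1) _ u := h2.fst
    have a2 : HasDerivAt (fun u => (ζ (s - u)).2.1) _ u := h2.snd.fst
    have a3 : HasDerivAt (fun u => (ζ (s - u)).2.2.1) _ u := h2.snd.snd.fst
    have a4 : HasDerivAt (fun u => (ζ (s - u)).2.2.2) _ u := h2.snd.snd.snd
    refine (a1.neg.prodMk (a2.prodMk (a3.prodMk (a4.const_sub _)))).congr_deriv ?_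
    simp [lcField, β, grad_leviCivita_neg, add_comm]
  have h2 : α 0 = β 0 := by
    simp only [α, β, add_zero, sub_zero, h0, neg_zero]
    refine Prod.ext h0 (Prod.ext rfl (Prod.ext rfl ?_))
    show (ζ s).2.2.2 = 2 * (ζ s).2.2.2 - (ζ s).2.2.2
    ring
  have h3 := eventuallyEq_of_hasDerivAt (isOpen_lcDomain ε) h.contDiffOn_lcField
    (show α 0 ∈ lcDomain ε by simpa [α] using hζ.mem s hs) hα hβ h2
  filter_upwards [h3] with u hu
  exact ⟨congrArg Prod.fst hu, congrArg (fun z : LCSpace => z.2.2.2) hu⟩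

/-- In physical time, a solution of the Levi-Civita equations is a regularized curve. -/
theorem CollisionChart.exists_regularized (hC : LocallyCoulomb S V)
    (h : CollisionChart S V σ Z ε) {ζ : ℝ → LCSpace} {a b : ℝ}
    (hζ : IsLCSolution (leviCivita V σ Z) ε ζ (Ioo a b)) :
    ∃ γ : ℝ → ℂ, ∀ s ∈ Ioo a b, γ (ζ s).2.2.2 = σ + (ζ s).1 ^ 2 ∧
      IsRegularizedAt S V γ (ζ s).2.2.2 ∧
      ((ζ s).1 ≠ 0 → state γ (ζ s).2.2.2 = lcDown σ (ζ s)) := by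
  set T : ℝ → ℝ := fun s => (ζ s).2.2.2 with hT
  have hd : ∀ s ∈ Ioo a b, HasDerivAt T (Complex.normSq (ζ s).1) s :=
    fun s hs => (hζ.hasDerivAt s hs).snd.snd.snd
  have hm : StrictMonoOn T (Ioo a b) := h.strictMonoOn_time hζ
  have hcont : ContinuousOn T (Ioo a b) := fun s hs => (hd s hs).continuousAt.continuousWithinAt
  -- `g` inverts physical time. It is continuous, but differentiable only where `Q ≠ 0`, so the
  -- Newton equation is checked off collisions and the reflection property is obtained separately at
  -- a collision.
  let g : ℝ → ℝ := Function.invFunOn T (Ioo a b)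
  have hg : ∀ s ∈ Ioo a b, g (T s) = s := fun s hs => hm.injOn.leftInvOn_invFunOn hs
  have hle : ∀ s ∈ Ioo a b, 𝓝 (T s) ≤ map T (𝓝 s) := fun s hs =>
    nhds_le_map_of_strictMonoOn isOpen_Ioo hcont hm hs
  have hev : ∀ s ∈ Ioo a b, ∀ p : ℝ → Prop, (∀ᶠ u in 𝓝 s, p (T u)) → ∀ᶠ t in 𝓝 (T s), p t :=
    fun s hs p hp => hle s hs hp
  have hJ : ∀ s ∈ Ioo a b, ∀ᶠ u in 𝓝 s, u ∈ Ioo a b := fun s hs => isOpen_Ioo.mem_nhds hs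
  have hgc : ∀ s ∈ Ioo a b, ContinuousAt g (T s) := by
    intro s hs
    show Tendsto g (𝓝 (T s)) (𝓝 (g (T s)))
    rw [hg s hs]
    refine Tendsto.mono_left ?_ (hle s hs)
    rw [tendsto_map'_iff]
    exact tendsto_id.congr' ((hJ s hs).mono fun u hu => (hg u hu).symm)
  have hgT : ∀ s ∈ Ioo a b, ∀ᶠ t in 𝓝 (T s), T (g t) = t := by
    intro s hs
    refine hev s hs _ ?_
    filter_upwards [hJ s hs] with u hu
    show T (g (T u)) = T u
    rw [hg u hu]
  have hζc : ∀ s ∈ Ioo a b, ContinuousAt (fun t => ζ (g t)) (T s) := by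
    intro s hs
    refine ContinuousAt.comp (g := ζ) ?_ (hgc s hs)
    rw [hg s hs]
    exact (hζ.hasDerivAt s hs).continuousAt
  let γ : ℝ → ℂ := fun t => σ + (ζ (g t)).1 ^ 2
  have hγ : ∀ s ∈ Ioo a b, γ (T s) = σ + (ζ s).1 ^ 2 := fun s hs => by
    show σ + (ζ (g (T s))).1 ^ 2 = _
    rw [hg s hs]
  have hγS : ∀ s ∈ Ioo a b, (γ (T s) ∈ S ↔ (ζ s).1 = 0) := by
    intro s hs
    rw [hγ s hs]
    constructor
    · intro h1
      by_contra h2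
      exact h.notMem _ (hζ.mem s hs) h2 h1
    · intro h1
      simpa [h1] using h.mem
  let α : ℝ → ℂ × ℂ := fun t => lcDown σ (ζ (g t))
  have hα : ∀ s ∈ Ioo a b, (ζ s).1 ≠ 0 →
      ∀ᶠ t in 𝓝 (T s), HasDerivAt α (newtonField V (α t)) t := by
    intro s hs h0
    refine hev s hs _ ?_
    filter_upwards [hJ s hs, (hζ.hasDerivAt s hs).continuousAt.fst.eventually
      (isOpen_ne.mem_nhds h0)] with u hu hu0
    have hn : Complex.normSq (ζ u).1 ≠ 0 := by simpa using hu0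
    have h1 : HasDerivAt T (Complex.normSq (ζ u).1) (g (T u)) := by
      rw [hg u hu]
      exact hd u hu
    have h2 : HasDerivAt g (Complex.normSq (ζ u).1)⁻¹ (T u) :=
      HasDerivAt.of_local_left_inverse (hgc u hu) h1 hn (hgT u hu)
    have h3 := h.hasDerivAt_lcDown hC (hζ.hasDerivAt u hu) (hζ.mem u hu) (hζ.energy u hu) hu0
    rw [← hg u hu] at h3
    have h4 := h3.scomp (T u) h2
    rw [hg u hu, smul_smul, inv_mul_cancel₀ hn, one_smul] at h4
    show HasDerivAt α (newtonField V (lcDown σ (ζ (g (T u))))) (T u)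
    rw [hg u hu]
    exact h4
  have hnewton : ∀ s ∈ Ioo a b, (ζ s).1 ≠ 0 → IsRegularizedAt S V γ (T s) ∧
      state γ =ᶠ[𝓝 (T s)] α := by
    intro s hs h0
    refine isRegularizedAt_of_hasDerivAt (hα s hs h0) ?_
    show σ + (ζ (g (T s))).1 ^ 2 ∉ S
    rw [hg s hs]
    exact h.notMem _ (hζ.mem s hs) h0
  refine ⟨γ, fun s hs => ⟨hγ s hs, ?_, fun h0 => ?_⟩⟩
  · by_cases h0 : (ζ s).1 = 0
    swap
    · exact (hnewton s hs h0).1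
    refine ⟨?_, fun h1 => absurd ((hγS s hs).2 h0) h1, fun _ => ?_, fun _ => ?_⟩
    · have h1 := hζc s hs
      exact continuousAt_const.add (h1.fst.pow 2)
    · have h1 : Tendsto (fun u => T s + u) (𝓝 0) (𝓝 (T s)) :=
        (continuous_const.add continuous_id).tendsto' (0 : ℝ) (T s) (add_zero _)
      have hp : Tendsto (fun u => s + u) (𝓝 0) (𝓝 s) :=
        (continuous_const.add continuous_id).tendsto' (0 : ℝ) s (by simp)
      have hmn : Tendsto (fun u => s - u) (𝓝 0) (𝓝 s) :=
        (continuous_const.sub continuous_id).tendsto' (0 : ℝ) s (by simp)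
      have h2 : ∀ᶠ t in 𝓝 (T s), γ t = γ (2 * T s - t) := by
        refine hev s hs _ ?_
        have h3 : Tendsto (fun u => u - s) (𝓝 s) (𝓝 0) :=
          (continuous_id.sub continuous_const).tendsto' s (0 : ℝ) (by simp)
        filter_upwards [h3.eventually ((h.reflection isOpen_Ioo hζ hs h0).and
          ((hp.eventually (hJ s hs)).and (hmn.eventually (hJ s hs))))] with u hu
        obtain ⟨⟨h4, h5⟩, h6, h7⟩ := hu
        rw [add_sub_cancel] at h4 h5 h6
        show γ (T u) = γ (2 * T s - T u)
        have h8 : 2 * T s - T u = T (s - (u - s)) := by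
          simp only [hT]
          rw [h5]
          ring
        rw [h8, hγ u h6, hγ _ h7, h4, neg_sq]
      refine (h1.eventually h2).mono fun u hu => ?_
      have h3 : 2 * T s - (T s + u) = T s - u := by ring
      rw [h3] at hu
      exact hu
    · rw [eventually_nhdsWithin_iff]
      refine hev s hs _ ?_
      have h1 := h.eventually_ne_zero hζ hs
      rw [eventually_nhdsWithin_iff] at h1
      filter_upwards [h1, hJ s hs] with u hu huJ hne
      rw [hγS u huJ]
      exact hu fun h2 => hne (congrArg T h2)
  · rw [(hnewton s hs h0).2.eq_of_nhds]
    show lcDown σ (ζ (g (T s))) = _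
    rw [hg s hs]

end


/-! ### Local existence of regularized curves, uniformly in energy -/

section

variable {S : Set ℂ} {V : ℂ → ℝ} {σ : ℂ} {Z ε : ℝ}

theorem CollisionChart.exists_flow (h : CollisionChart S V σ Z ε) {z₀ : LCSpace}
    (hz₀ : z₀ ∈ lcDomain ε) : ∃ w > 0, ∃ N : Set LCSpace, IsOpen N ∧ z₀ ∈ N ∧
      ∃ ψ : ℝ → LCSpace → LCSpace,
      ContDiffOn ℝ ∞ (fun y : ℝ × LCSpace => ψ y.1 y.2) (Ioo (-w) w ×ˢ N) ∧
      ∀ z ∈ N, ψ 0 z = z ∧ (lcEnergy (leviCivita V σ Z) z = 0 →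
        IsLCSolution (leviCivita V σ Z) ε (fun s => ψ s z) (Ioo (-w) w)) := by
  obtain ⟨w, hw, N, hN, hzN, ψ, hψ, hψ'⟩ := exists_smooth_flow (isOpen_lcDomain ε)
    h.contDiffOn_lcField hz₀
  refine ⟨w, hw, N, hN, hzN, ψ, hψ, fun z hz => ⟨(hψ' z hz).1, fun hK => ?_⟩⟩
  have hd : ∀ s ∈ Ioo (-w) w,
      HasDerivAt (fun s => lcEnergy (leviCivita V σ Z) (ψ s z)) 0 s := fun s hs =>
    h.hasDerivAt_lcEnergy ((hψ' z hz).2 s hs).2 ((hψ' z hz).2 s hs).1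
  refine ⟨fun s hs => ((hψ' z hz).2 s hs).2, fun s hs => ((hψ' z hz).2 s hs).1, fun s hs => ?_⟩
  have h1 := isOpen_Ioo.is_const_of_deriv_eq_zero isPreconnected_Ioo
    (fun s hs => (hd s hs).differentiableAt.differentiableWithinAt) (fun s hs => (hd s hs).deriv)
    hs (show (0 : ℝ) ∈ Ioo (-w) w from ⟨by linarith, hw⟩)
  rw [h1, (hψ' z hz).1, hK]

/-- A regularized curve that agrees once with a solution of the Levi-Civita equations does so
always. -/
theorem CollisionChart.eq_of_state_eq (hC : LocallyCoulomb S V) (h : CollisionChart S V σ Z ε)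
    {ζ : ℝ → LCSpace} {a b : ℝ} (hζ : IsLCSolution (leviCivita V σ Z) ε ζ (Ioo a b))
    {γ : ℝ → ℂ} {J : Set ℝ} (hJ : IsOpen J) (hJc : J.OrdConnected)
    (hγ : ∀ t ∈ J, IsRegularizedAt S V γ t) {s₁ : ℝ} (hs₁ : s₁ ∈ Ioo a b)
    (hs₁J : (ζ s₁).2.2.2 ∈ J)
    (h1 : (ζ s₁).1 ≠ 0) (h2 : state γ (ζ s₁).2.2.2 = lcDown σ (ζ s₁)) {s : ℝ} (hs : s ∈ Ioo a b)
    (hsJ : (ζ s).2.2.2 ∈ J) :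
    γ (ζ s).2.2.2 = σ + (ζ s).1 ^ 2 ∧
      ((ζ s).1 ≠ 0 → state γ (ζ s).2.2.2 = lcDown σ (ζ s)) := by
  obtain ⟨δ, hδ⟩ := h.exists_regularized hC hζ
  have hcont : ContinuousOn (fun s => (ζ s).2.2.2) (Ioo a b) := fun s hs =>
    (hζ.hasDerivAt s hs).continuousAt.snd.snd.snd.continuousWithinAt
  set I : Set ℝ := (fun s => (ζ s).2.2.2) '' Ioo a b with hI
  have hIc : IsPreconnected I := isPreconnected_Ioo.image _ hcont
  have hIo : IsOpen I := by
    rw [isOpen_iff_mem_nhds]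
    rintro _ ⟨u, hu, rfl⟩
    exact nhds_le_map_of_strictMonoOn isOpen_Ioo hcont (h.strictMonoOn_time hζ) hu
      (show (fun s => (ζ s).2.2.2) ⁻¹' _ ∈ 𝓝 u from
        mem_of_superset (isOpen_Ioo.mem_nhds hu) fun v hv => ⟨v, hv, rfl⟩)
  have hst : state δ (ζ s₁).2.2.2 = state γ (ζ s₁).2.2.2 := by rw [h2, (hδ s₁ hs₁).2.2 h1]
  have key := eventuallyEq_on_of_state_eq hC
    (isPreconnected_iff_ordConnected.2 (hIc.ordConnected.inter hJc)) (hIo.inter hJ)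
    (γ := δ) (δ := γ) (by rintro _ ⟨⟨u, hu, rfl⟩, -⟩; exact (hδ u hu).2.1) (fun t ht => hγ t ht.2)
    ⟨mem_image_of_mem _ hs₁, hs₁J⟩ (by
      rw [(hδ s₁ hs₁).1]
      exact h.notMem _ (hζ.mem s₁ hs₁) h1) hst (ζ s).2.2.2 ⟨mem_image_of_mem _ hs, hsJ⟩
  exact ⟨by rw [← key.eq_of_nhds, (hδ s hs).1], fun h0 => by
    rw [← state_congr key, (hδ s hs).2.2 h0]⟩

/-- There is a regularized curve on `(-δ, δ)` with initial state `x`. -/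
def HasCurve (S : Set ℂ) (V : ℂ → ℝ) (x : ℂ × ℂ) (δ : ℝ) : Prop :=
  ∃ γ : ℝ → ℂ, (∀ t ∈ Ioo (-δ) δ, IsRegularizedAt S V γ t) ∧ state γ 0 = x

theorem HasCurve.mono {x : ℂ × ℂ} {δ δ' : ℝ} (h : HasCurve S V x δ) (hδ : δ' ≤ δ) :
    HasCurve S V x δ' := by
  obtain ⟨γ, h1, h2⟩ := h
  exact ⟨γ, fun t ht => h1 t ⟨by linarith [ht.1], by linarith [ht.2]⟩, h2⟩

theorem LocallyCoulomb.eventually_hasCurve (hC : LocallyCoulomb S V) {x₀ : ℂ × ℂ}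
    (hx₀ : x₀ ∈ cotangentBundle S) : ∃ δ > 0, ∀ᶠ x in 𝓝 x₀, HasCurve S V x δ := by
  obtain ⟨w, hw, N, hN, hxN, ψ, -, hψ⟩ := exists_smooth_flow hC.isOpen_cotangentBundle
    hC.contDiffOn_newtonField hx₀
  refine ⟨w, hw, eventually_of_mem (hN.mem_nhds hxN) fun x hx => ?_⟩
  have key : ∀ t ∈ Ioo (-w) w, IsRegularizedAt S V (fun t => (ψ t x).2) t ∧
      state (fun t => (ψ t x).2) =ᶠ[𝓝 t] fun t => ψ t x := fun t ht =>
    isRegularizedAt_of_hasDerivAt (α := fun t => ψ t x)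
      (eventually_of_mem (isOpen_Ioo.mem_nhds ht) fun u hu => ((hψ x hx).2 u hu).2)
      ((hψ x hx).2 t ht).1
  refine ⟨fun t => (ψ t x).2, fun t ht => (key t ht).1, ?_⟩
  rw [(key 0 ⟨by linarith, hw⟩).2.eq_of_nhds, (hψ x hx).1]

/-- This gives a uniform lower bound for the lifetime near a collision: at `s = ±w/2` the physical
time is strictly positive and strictly negative for `z₀`, and stays beyond `±δ` for nearby initial
values. -/
theorem CollisionChart.eventually_hasCurve (hC : LocallyCoulomb S V)
    (h : CollisionChart S V σ Z ε) {z₀ : LCSpace} (hz₀ : z₀ ∈ lcDomain ε)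
    (hK : lcEnergy (leviCivita V σ Z) z₀ = 0) (hT : z₀.2.2.2 = 0) :
    ∃ δ > 0, ∀ᶠ z in 𝓝 z₀, lcEnergy (leviCivita V σ Z) z = 0 → z.2.2.2 = 0 → z.1 ≠ 0 →
      HasCurve S V (lcDown σ z) δ := by
  obtain ⟨w, hw, N, hN, hzN, ψ, hψ, hψ'⟩ := h.exists_flow hz₀
  have hsol := (hψ' z₀ hzN).2 hK
  have hmem : ∀ {s}, |s| ≤ w / 2 → s ∈ Ioo (-w) w := fun {s} hs => by
    obtain ⟨h1, h2⟩ := abs_le.1 hs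
    exact ⟨by linarith, by linarith⟩
  have h0 : (0 : ℝ) ∈ Ioo (-w) w := ⟨by linarith, hw⟩
  have hp : w / 2 ∈ Ioo (-w) w := ⟨by linarith, by linarith⟩
  have hm : -(w / 2) ∈ Ioo (-w) w := ⟨by linarith, by linarith⟩
  have hmono := h.strictMonoOn_time hsol
  have h1 : 0 < (ψ (w / 2) z₀).2.2.2 := by
    have := hmono h0 hp (by linarith)
    simpa only [(hψ' z₀ hzN).1, hT] using this
  have h2 : (ψ (-(w / 2)) z₀).2.2.2 < 0 := by
    have := hmono hm h0 (by linarith)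
    simpa only [(hψ' z₀ hzN).1, hT] using this
  obtain ⟨δ, hδ0, hδ⟩ := exists_between (lt_min h1 (neg_pos.2 h2))
  obtain ⟨hδ1, hδ2⟩ := lt_min_iff.1 hδ
  have hc : ∀ s ∈ Ioo (-w) w, ContinuousAt (fun z => (ψ s z).2.2.2) z₀ := by
    intro s hs
    have h3 : ContinuousAt (fun y : ℝ × LCSpace => ψ y.1 y.2) (s, z₀) :=
      hψ.continuousOn.continuousAt ((isOpen_Ioo.prod hN).mem_nhds ⟨hs, hzN⟩)
    exact (h3.comp (f := fun z => (s, z)) (by fun_prop)).snd.snd.snd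
  refine ⟨δ, hδ0, ?_⟩
  filter_upwards [hN.mem_nhds hzN, (hc _ hp).eventually (lt_mem_nhds hδ1),
    (hc _ hm).eventually (gt_mem_nhds (show _ < -δ by linarith))] with z hz h3 h4 hzK hzT hz0
  have hsolz := (hψ' z hz).2 hzK
  obtain ⟨γ, hγ⟩ := h.exists_regularized hC hsolz
  refine ⟨γ, fun t ht => ?_, ?_⟩
  · have hcont : ContinuousOn (fun s => (ψ s z).2.2.2) (Icc (-(w / 2)) (w / 2)) := fun s hs =>
      (hsolz.hasDerivAt s (hmem (abs_le.2 hs))).continuousAt.snd.snd.snd.continuousWithinAt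
    obtain ⟨s, hs, rfl⟩ := intermediate_value_Icc (by linarith) hcont
      ⟨(h4.trans ht.1).le, (ht.2.trans h3).le⟩
    exact (hγ s (hmem (abs_le.2 hs))).2.1
  · have h5 := (hγ 0 h0).2.2
    simp only [(hψ' z hz).1, hzT] at h5
    exact h5 hz0

/-- Levi-Civita coordinates of a point of phase space, from a square root of the position. -/
def lcLift (V : ℂ → ℝ) (Q : ℂ) (x : ℂ × ℂ) (t : ℝ) : LCSpace :=
  (Q, 2 * x.1 * (starRingEnd ℂ) Q, hamiltonian V x, t)

theorem lcEnergy_lcLift {Q : ℂ} {x : ℂ × ℂ} (hQ : Q ^ 2 = x.2 - σ) (hx : x.2 ≠ σ) (t : ℝ) :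
    lcEnergy (leviCivita V σ Z) (lcLift V Q x t) = 0 := by
  have hQ0 : Q ≠ 0 := by
    rintro rfl
    exact hx (sub_eq_zero.1 (by rw [← hQ]; simp))
  simp only [lcEnergy, lcLift, leviCivita_of_ne V σ Z hQ0, hQ, add_sub_cancel, hamiltonian, map_mul,
    Complex.normSq_conj, Complex.normSq_ofNat]
  ring

theorem lcDown_lcLift {Q : ℂ} {x : ℂ × ℂ} (hQ : Q ^ 2 = x.2 - σ) (hx : x.2 ≠ σ) (t : ℝ) :
    lcDown σ (lcLift V Q x t) = x := by
  have hQ0 : Q ≠ 0 := by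
    rintro rfl
    exact hx (sub_eq_zero.1 (by rw [← hQ]; simp))
  have hcQ : (starRingEnd ℂ) Q ≠ 0 := by simpa using hQ0
  refine Prod.ext ?_ ?_
  · simp only [lcDown, lcLift]
    field_simp
  · simp only [lcDown, lcLift, hQ, add_sub_cancel]

theorem exists_sqrt (q : ℂ) : ∃ Q : ℂ, Q ^ 2 = q :=
  ⟨q ^ ((2 : ℕ) : ℂ)⁻¹, Complex.cpow_nat_inv_pow q two_ne_zero⟩

/-- Points of the regularized energy surface that approach a nucleus with bounded energy have a
cluster point. -/
theorem CollisionChart.exists_mapClusterPt (h : CollisionChart S V σ Z ε) {ι : Type*}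
    {l : Filter ι} [NeBot l] {z : ι → LCSpace} {A t₀ : ℝ}
    (hK : ∀ᶠ i in l, lcEnergy (leviCivita V σ Z) (z i) = 0)
    (hQ : Tendsto (fun i => (z i).1) l (𝓝 0)) (hE : ∀ᶠ i in l, |(z i).2.2.1| ≤ A)
    (hT : Tendsto (fun i => (z i).2.2.2) l (𝓝 t₀)) :
    ∃ z₀ : LCSpace, MapClusterPt z₀ l z ∧ z₀.1 = 0 ∧
      lcEnergy (leviCivita V σ Z) z₀ = 0 ∧ z₀.2.2.2 = t₀ := by
  have hf : Tendsto (fun i => leviCivita V σ Z (z i).1) l (𝓝 (-Z)) := by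
    rw [← leviCivita_zero V σ Z]
    exact ((h.smooth.contDiffAt (Metric.isOpen_ball.mem_nhds
      (Metric.mem_ball_self h.ε_pos))).continuousAt.tendsto).comp hQ
  have hn : Tendsto (fun i => Complex.normSq (z i).1) l (𝓝 0) := by
    have h1 := (Complex.continuous_normSq.tendsto (0 : ℂ)).comp hQ
    rwa [map_zero] at h1
  have hbd : ∀ᶠ i in l, z i ∈ Metric.closedBall (0 : ℂ) 1 ×ˢ
      (Metric.closedBall (0 : ℂ) (8 * (A + Z + 1) + 1) ×ˢ
        (Metric.closedBall (0 : ℝ) A ×ˢ Metric.closedBall t₀ 1)) := by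
    filter_upwards [hK, hE, hT.eventually (Metric.closedBall_mem_nhds t₀ one_pos),
      hQ.eventually (Metric.closedBall_mem_nhds 0 one_pos),
      hf.eventually (lt_mem_nhds (show -Z - 1 < -Z by linarith)),
      hn.eventually (gt_mem_nhds one_pos)] with i h1 h2 h3 h4 h5 h6
    refine ⟨h4, ?_, ?_, h3⟩
    · rw [mem_closedBall_zero_iff]
      -- On the zero level `|P|² = 8 (E |Q|² - f(Q))`, and `f(Q)` tends to `-Z`. Thus bounded energy
      -- bounds `P`, although the physical momentum is unbounded.
      have h7 : Complex.normSq (z i).2.1 ≤ 8 * (A + Z + 1) := by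
        simp only [lcEnergy] at h1
        have h8 : (z i).2.2.1 * Complex.normSq (z i).1 ≤ A := by
          nlinarith [Complex.normSq_nonneg (z i).1, (abs_le.1 h2).2, abs_nonneg (z i).2.2.1]
        linarith
      rw [Complex.normSq_eq_norm_sq] at h7
      nlinarith [norm_nonneg (z i).2.1, sq_nonneg (‖(z i).2.1‖ - 1)]
    · rw [mem_closedBall_zero_iff]
      exact h2
  have hcpt := (isCompact_closedBall (0 : ℂ) 1).prod ((isCompact_closedBall (0 : ℂ)
    (8 * (A + Z + 1) + 1)).prod ((isCompact_closedBall (0 : ℝ) A).prod (isCompact_closedBall t₀ 1)))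
  obtain ⟨z₀, -, hz₀⟩ := hcpt.exists_mapClusterPt_of_frequently hbd.frequently
  have hlim : ∀ {Y : Type} [TopologicalSpace Y] [T2Space Y] {g : LCSpace → Y} {y : Y},
      ContinuousAt g z₀ → Tendsto (fun i => g (z i)) l (𝓝 y) → g z₀ = y := by
    intro Y _ _ g y hg hy
    have h1 : MapClusterPt (g z₀) l (g ∘ z) := hz₀.continuousAt_comp hg
    by_contra hne
    exact (h1.clusterPt.mono hy).ne
      (disjoint_iff.1 (disjoint_nhds_nhds.2 hne))
  have h0 : z₀.1 = 0 := hlim continuousAt_fst hQ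
  refine ⟨z₀, hz₀, h0, ?_, hlim (g := fun z => z.2.2.2) (by fun_prop) hT⟩
  refine hlim ?_ (tendsto_const_nhds.congr' (hK.mono fun i hi => hi.symm))
  have h1 : z₀ ∈ lcDomain ε := by
    show z₀.1 ∈ Metric.ball 0 ε
    rw [h0]
    exact Metric.mem_ball_self h.ε_pos
  exact h.contDiffOn_lcEnergy.continuousOn.continuousAt ((isOpen_lcDomain ε).mem_nhds h1)

theorem tendsto_zero_of_sq {ι : Type*} {l : Filter ι} {Q q : ι → ℂ}
    (h : ∀ i, Q i ^ 2 = q i) (hq : Tendsto q l (𝓝 0)) : Tendsto Q l (𝓝 0) := by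
  rw [tendsto_zero_iff_norm_tendsto_zero] at hq ⊢
  have h1 := (Real.continuous_sqrt.tendsto 0).comp hq
  rw [Real.sqrt_zero] at h1
  refine h1.congr fun i => ?_
  simp [← h i]

/-- Regularized curves exist for a time that is locally uniform in the position and the energy. -/
theorem LocallyCoulomb.exists_uniform_time (hC : LocallyCoulomb S V) (q₀ : ℂ) (A : ℝ) :
    ∃ r > 0, ∃ δ > 0, ∀ x ∈ cotangentBundle S, dist x.2 q₀ < r → |hamiltonian V x| ≤ A →
      HasCurve S V x δ := by
  by_contra hcon
  push Not at hcon
  have hpos : ∀ n : ℕ, (0 : ℝ) < 1 / ((n : ℝ) + 1) := fun n => by positivity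
  -- If the claim fails, there are states with positions tending to `q₀` and bounded energy whose
  -- curves do not live for time `1 / (n + 1)`. A cluster point has a neighbourhood with a uniform
  -- lifetime, which is a contradiction.
  choose x hxS hxq hxA hx using fun n : ℕ => hcon _ (hpos n) _ (hpos n)
  have hq : Tendsto (fun n => (x n).2) atTop (𝓝 q₀) := by
    rw [tendsto_iff_dist_tendsto_zero]
    exact squeeze_zero (fun n => dist_nonneg) (fun n => (hxq n).le)
      tendsto_one_div_add_atTop_nhds_zero_nat
  have hsmall : ∀ δ > 0, ∀ᶠ n in atTop, ¬HasCurve S V (x n) δ := by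
    intro δ hδ
    filter_upwards [tendsto_one_div_add_atTop_nhds_zero_nat.eventually (gt_mem_nhds hδ)] with n hn
    exact fun h => hx n (h.mono hn.le)
  by_cases hS : q₀ ∈ S
  · obtain ⟨Z, ε, h⟩ := hC.exists_collisionChart hS
    -- The square roots may be chosen without any continuity, since only a cluster point of the
    -- lifts is needed.
    choose Q hQ using fun n => exists_sqrt ((x n).2 - q₀)
    have hne : ∀ n, (x n).2 ≠ q₀ := fun n heq => hxS n (heq ▸ hS)
    have hQ0 : Tendsto Q atTop (𝓝 0) := by
      refine tendsto_zero_of_sq hQ ?_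
      simpa using hq.sub_const q₀
    obtain ⟨z₀, hz₀, h0, hK, hT⟩ := h.exists_mapClusterPt (l := atTop) (A := A) (t₀ := 0)
      (z := fun n => lcLift V (Q n) (x n) 0)
      (Eventually.of_forall fun n => lcEnergy_lcLift (hQ n) (hne n) 0) hQ0
      (Eventually.of_forall hxA) tendsto_const_nhds
    have hdom : z₀ ∈ lcDomain ε := by
      show z₀.1 ∈ Metric.ball 0 ε
      rw [h0]
      exact Metric.mem_ball_self h.ε_pos
    obtain ⟨δ, hδ, hev⟩ := h.eventually_hasCurve hC hdom hK hT
    obtain ⟨n, hn1, hn2⟩ := ((hz₀.frequently hev).and_eventually (hsmall δ hδ)).exists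
    refine hn2 ?_
    rw [← lcDown_lcLift (V := V) (hQ n) (hne n) 0]
    refine hn1 (lcEnergy_lcLift (hQ n) (hne n) 0) rfl fun h1 => hne n ?_
    have h2 : Q n = 0 := h1
    have h3 := hQ n
    rw [h2] at h3
    exact (sub_eq_zero.1 (by rw [← h3]; simp))
  · have hV : ContinuousAt V q₀ :=
      (hC.smooth.contDiffAt (hC.isClosed.isOpen_compl.mem_nhds hS)).continuousAt
    have hbd : ∀ᶠ n in atTop, x n ∈ Metric.closedBall (0 : ℂ) (2 * (A - V q₀ + 1) + 1) ×ˢ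
        Metric.closedBall q₀ 1 := by
      filter_upwards [hq.eventually (Metric.closedBall_mem_nhds q₀ one_pos),
        (hV.tendsto.comp hq).eventually (lt_mem_nhds (show V q₀ - 1 < V q₀ by linarith))]
        with n h1 h2
      refine ⟨?_, h1⟩
      have h3 := (abs_le.1 (hxA n)).2
      simp only [hamiltonian, Complex.normSq_eq_norm_sq] at h3
      simp only [Function.comp_apply] at h2
      rw [mem_closedBall_zero_iff]
      nlinarith [norm_nonneg (x n).1, sq_nonneg (‖(x n).1‖ - 1)]
    obtain ⟨x₀, -, hx₀⟩ := ((isCompact_closedBall (0 : ℂ) _).prod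
      (isCompact_closedBall q₀ 1)).exists_mapClusterPt_of_frequently hbd.frequently
    have hx₀q : x₀.2 = q₀ := by
      have h1 : MapClusterPt x₀.2 atTop (Prod.snd ∘ x) := hx₀.continuousAt_comp continuousAt_snd
      by_contra hne
      exact (h1.clusterPt.mono hq).ne (disjoint_iff.1 (disjoint_nhds_nhds.2 hne))
    obtain ⟨δ, hδ, hev⟩ := hC.eventually_hasCurve (x₀ := x₀) (by
      show x₀.2 ∉ S
      rwa [hx₀q])
    obtain ⟨n, hn1, hn2⟩ := ((hx₀.frequently hev).and_eventually (hsmall δ hδ)).exists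
    exact hn2 hn1

end


/-! ### Gluing of curves and existence for all times -/

section

variable {S : Set ℂ} {V : ℂ → ℝ}

/-- Equal states at one collision-free time force agreement near that time, so the switch from one
curve to the other is invisible to the local condition. -/
theorem isRegularizedAt_glue (hC : LocallyCoulomb S V) {γ δ : ℝ → ℂ} {a b c d t₁ : ℝ}
    (hγ : ∀ t ∈ Ioo a b, IsRegularizedAt S V γ t) (hδ : ∀ t ∈ Ioo c d, IsRegularizedAt S V δ t)
    (h₁ : t₁ ∈ Ioo a b) (h₂ : t₁ ∈ Ioo c d) (hS : γ t₁ ∉ S) (hst : state γ t₁ = state δ t₁) :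
    ∀ t ∈ Ioo a d, IsRegularizedAt S V (fun t => if t < t₁ then γ t else δ t) t := by
  intro t ht
  rcases lt_trichotomy t t₁ with h | rfl | h
  · refine (hγ t ⟨ht.1, h.trans h₁.2⟩).congr ?_
    filter_upwards [gt_mem_nhds h] with u hu
    exact (if_pos hu).symm
  · refine (hγ t h₁).congr ?_
    filter_upwards [eventuallyEq_of_state_eq hC (eventually_of_mem (isOpen_Ioo.mem_nhds h₁) hγ)
      (eventually_of_mem (isOpen_Ioo.mem_nhds h₂) hδ) hS hst] with u hu
    show γ u = if u < t then γ u else δ u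
    split_ifs
    exacts [rfl, hu]
  · refine (hδ t ⟨h₂.1.trans h, ht.2⟩).congr ?_
    filter_upwards [lt_mem_nhds h] with u hu
    exact (if_neg hu.le.not_gt).symm

theorem exists_notMem_of_regular (hC : LocallyCoulomb S V) {γ : ℝ → ℂ} {a b : ℝ} (hab : a < b)
    (hγ : ∀ t ∈ Ioo a b, IsRegularizedAt S V γ t) : ∃ t ∈ Ioo a b, γ t ∉ S := by
  obtain ⟨c, hc⟩ := exists_between hab
  exact ((eventually_of_mem (nhdsWithin_le_nhds (isOpen_Ioo.mem_nhds hc)) fun _ => id).and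
    ((hγ c hc).eventually_notMem hC)).exists

/-- The curve is restarted close to each end. Energy is conserved, so the lifetime `δ` available for
that energy applies again. -/
theorem HasCurve.extend (hC : LocallyCoulomb S V) {x : ℂ × ℂ} {δ τ : ℝ}
    (hx : x ∈ cotangentBundle S) (hδ : 0 < δ) (hτ : 0 < τ)
    (hex : ∀ y ∈ cotangentBundle S, hamiltonian V y = hamiltonian V x → HasCurve S V y δ)
    (h : HasCurve S V x τ) : HasCurve S V x (τ + δ / 2) := by
  obtain ⟨γ, hγ, h0⟩ := h
  have h0S : γ 0 ∉ S := by
    have : (state γ 0).2 ∉ S := by rw [h0]; exact hx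
    exact this
  have key : ∀ t₁ ∈ Ioo (-τ) τ, γ t₁ ∉ S → ∃ η : ℝ → ℂ,
      (∀ t ∈ Ioo (t₁ - δ) (t₁ + δ), IsRegularizedAt S V η t) ∧ state η t₁ = state γ t₁ := by
    intro t₁ ht₁ hS
    obtain ⟨η, hη, hη0⟩ := hex (state γ t₁) hS (by
      rw [← h0]
      exact hamiltonian_eq hC isPreconnected_Ioo isOpen_Ioo hγ ht₁ ⟨by linarith, hτ⟩ hS h0S)
    refine ⟨fun t => η (-t₁ + t), fun t ht => IsRegularizedAt.comp_add
      (hη _ ⟨by linarith [ht.1], by linarith [ht.2]⟩), ?_⟩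
    rw [state_comp_add, neg_add_cancel, hη0]
  -- The restart must avoid collisions and lie within `δ / 2` of the end, so that a curve of
  -- lifetime `δ` reaches beyond the end by `δ / 2`.
  obtain ⟨t₁, ht₁, ht₁S⟩ := exists_notMem_of_regular hC
    (show max 0 (τ - δ / 2) < τ from max_lt hτ (by linarith)) (γ := γ) (fun t ht => hγ t
      ⟨by linarith [ht.1, le_max_left 0 (τ - δ / 2)], ht.2⟩)
  have h3 := (le_max_left 0 (τ - δ / 2)).trans_lt ht₁.1
  have h4 := (le_max_right 0 (τ - δ / 2)).trans_lt ht₁.1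
  obtain ⟨η, hη, hη0⟩ := key t₁ ⟨by linarith, ht₁.2⟩ ht₁S
  have hr := isRegularizedAt_glue hC hγ hη ⟨by linarith, ht₁.2⟩ ⟨by linarith, by linarith⟩ ht₁S
    hη0.symm
  obtain ⟨t₂, ht₂, ht₂S⟩ := exists_notMem_of_regular hC
    (show -τ < min 0 (-τ + δ / 2) from lt_min (by linarith) (by linarith)) (γ := γ)
      (fun t ht => hγ t ⟨ht.1, by linarith [ht.2, min_le_left 0 (-τ + δ / 2)]⟩)
  have h5 := ht₂.2.trans_le (min_le_left 0 (-τ + δ / 2))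
  have h6 := ht₂.2.trans_le (min_le_right 0 (-τ + δ / 2))
  obtain ⟨ξ, hξ, hξ0⟩ := key t₂ ⟨ht₂.1, by linarith⟩ ht₂S
  set γ' : ℝ → ℂ := fun t => if t < t₁ then γ t else η t
  have he : ∀ t < t₁, γ' =ᶠ[𝓝 t] γ := fun t ht => by
    filter_upwards [gt_mem_nhds ht] with u hu
    exact if_pos hu
  have h7 : state γ' t₂ = state ξ t₂ := by rw [state_congr (he t₂ (by linarith)), hξ0]
  have h8 : ξ t₂ ∉ S := by
    have : (state ξ t₂).2 ∉ S := by rw [hξ0]; exact ht₂S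
    exact this
  have hl := isRegularizedAt_glue hC hξ hr ⟨by linarith, by linarith⟩
    ⟨ht₂.1, by linarith⟩ h8 h7.symm
  refine ⟨_, fun t ht => hl t ⟨by linarith [ht.1], by linarith [ht.2]⟩, ?_⟩
  rw [← h0, ← state_congr (he 0 h3)]
  refine state_congr ?_
  filter_upwards [lt_mem_nhds h5] with u hu
  exact if_neg hu.le.not_gt

/-- A Coulombic potential all of whose regularized trajectories are defined for all times. -/
class CompleteCoulomb (S : Set ℂ) (V : ℂ → ℝ) : Prop extends LocallyCoulomb S V where
  exists_curve : ∀ x ∈ cotangentBundle S,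
    ∃ γ : ℝ → ℂ, (∀ t, IsRegularizedAt S V γ t) ∧ state γ 0 = x

/-- Existence for a time that depends only on the energy implies completeness. -/
theorem LocallyCoulomb.completeCoulomb (hC : LocallyCoulomb S V)
    (h : ∀ A : ℝ, ∃ δ > 0, ∀ x ∈ cotangentBundle S, |hamiltonian V x| ≤ A → HasCurve S V x δ) :
    CompleteCoulomb S V where
  toLocallyCoulomb := hC
  exists_curve x hx := by
    obtain ⟨δ, hδ, hex⟩ := h |hamiltonian V x|
    have hn : ∀ n : ℕ, HasCurve S V x (δ + n * (δ / 2)) := by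
      intro n
      induction n with
      | zero => simpa using hex x hx le_rfl
      | succ n ih =>
        refine (ih.extend hC hx hδ (by positivity)
          (fun y hy hyx => hex y hy (by rw [hyx]))).mono (le_of_eq ?_)
        push_cast
        ring
    have hall : ∀ τ : ℝ, HasCurve S V x τ := by
      intro τ
      obtain ⟨n, hn'⟩ := exists_nat_ge (τ / (δ / 2))
      refine (hn n).mono ?_
      rw [div_le_iff₀ (by positivity)] at hn'
      linarith
    choose γ hγ h0 using hall
    have hag : ∀ a b : ℝ, a ≤ b → ∀ t ∈ Ioo (-a) a, γ a =ᶠ[𝓝 t] γ b := fun a b hab t ht =>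
      eventuallyEq_on_of_state_eq hC isPreconnected_Ioo isOpen_Ioo (hγ a)
        (fun u hu => hγ b u ⟨by linarith [hu.1], by linarith [hu.2]⟩)
        (show (0 : ℝ) ∈ Ioo (-a) a from ⟨by linarith [ht.1, ht.2], by linarith [ht.1, ht.2]⟩)
        (show (state (γ a) 0).2 ∉ S by rw [h0]; exact hx) (by rw [h0, h0]) t ht
    -- The global curve takes at time `u` the value of the curve defined on the interval of radius
    -- `|u| + 1`; near `t` this coincides with one fixed curve, so the local conditions are
    -- inherited.
    have heq : ∀ t, γ (|t| + 2) =ᶠ[𝓝 t] fun u => γ (|u| + 1) u := by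
      intro t
      filter_upwards [Metric.ball_mem_nhds t one_pos] with u hu
      rw [Metric.mem_ball, Real.dist_eq] at hu
      refine ((hag (|u| + 1) (|t| + 2) ?_ u ?_).eq_of_nhds).symm
      · linarith [abs_sub_abs_le_abs_sub u t]
      · exact abs_lt.1 (by linarith)
    refine ⟨fun t => γ (|t| + 1) t, fun t => (hγ (|t| + 2) t ?_).congr (heq t), ?_⟩
    · exact abs_lt.1 (by linarith)
    · rw [← state_congr (heq 0), h0]

end


/-! ### The space of complete trajectories and the regularized flow -/

/-- The regularized phase space, as the set of all complete regularized trajectories. -/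
@[ext] structure Phase (S : Set ℂ) (V : ℂ → ℝ) where
  /-- The position as a function of time. -/
  toFun : ℝ → ℂ
  regular : ∀ t, IsRegularizedAt S V toFun t

namespace Phase

variable {S : Set ℂ} {V : ℂ → ℝ}

instance : CoeFun (Phase S V) fun _ => ℝ → ℂ := ⟨toFun⟩

theorem continuous (γ : Phase S V) : Continuous γ :=
  continuous_iff_continuousAt.2 fun t => (γ.regular t).continuousAt

/-- The trajectory starting at time `a`. -/
def shift (a : ℝ) (γ : Phase S V) : Phase S V :=
  ⟨fun t => γ (a + t), fun t => (γ.regular (a + t)).comp_add⟩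

theorem shift_apply (a : ℝ) (γ : Phase S V) (t : ℝ) : γ.shift a t = γ (a + t) := rfl

theorem state_shift (a : ℝ) (γ : Phase S V) (t : ℝ) : state (γ.shift a) t = state γ (a + t) :=
  state_comp_add γ a t

theorem shift_shift (a b : ℝ) (γ : Phase S V) : (γ.shift a).shift b = γ.shift (a + b) :=
  Phase.ext (funext fun t => by simp only [shift_apply, add_assoc])

theorem shift_zero (γ : Phase S V) : γ.shift 0 = γ :=
  Phase.ext (funext fun t => by simp only [shift_apply, zero_add])

theorem shift_neg_shift (a : ℝ) (γ : Phase S V) : (γ.shift a).shift (-a) = γ := by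
  rw [shift_shift, add_neg_cancel, shift_zero]

variable [hC : CompleteCoulomb S V]

/-- Injectivity of the future charts: a trajectory is determined by its state at any collision-free
time. -/
theorem eq_of_state_eq {γ δ : Phase S V} {t : ℝ} (hS : γ t ∉ S) (h : state γ t = state δ t) :
    γ = δ :=
  Phase.ext (funext fun u => (eventuallyEq_on_of_state_eq hC.toLocallyCoulomb isPreconnected_univ
    isOpen_univ (fun t _ => γ.regular t) (fun t _ => δ.regular t) (mem_univ t) hS h u
    (mem_univ u)).eq_of_nhds)

theorem eventually_notMem (γ : Phase S V) (t : ℝ) : ∀ᶠ u in 𝓝[≠] t, γ u ∉ S :=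
  (γ.regular t).eventually_notMem hC.toLocallyCoulomb

theorem exists_notMem (γ : Phase S V) : ∃ t, γ t ∉ S := (γ.eventually_notMem 0).exists

/-- Nuclei are isolated, so some position is free of them and carries a trajectory. The choice
operator in `traj` requires this, as `traj` is also given a value at states over nuclei. -/
instance : Nonempty (Phase S V) := by
  obtain ⟨q, hq⟩ := (hC.isolated 0).exists
  obtain ⟨γ, hγ, -⟩ := hC.exists_curve (0, q) hq
  exact ⟨⟨γ, hγ⟩⟩

/-- The trajectory with initial momentum and position `x`. -/
def traj (S : Set ℂ) (V : ℂ → ℝ) [CompleteCoulomb S V] (x : ℂ × ℂ) : Phase S V :=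
  Classical.epsilon fun γ : Phase S V => state γ 0 = x

theorem state_traj {x : ℂ × ℂ} (hx : x ∈ cotangentBundle S) : state (traj S V x) 0 = x := by
  obtain ⟨γ, hγ, h0⟩ := hC.exists_curve x hx
  exact Classical.epsilon_spec (p := fun γ : Phase S V => state γ 0 = x) ⟨⟨γ, hγ⟩, h0⟩

theorem traj_zero {x : ℂ × ℂ} (hx : x ∈ cotangentBundle S) : traj S V x 0 = x.2 :=
  congrArg Prod.snd (state_traj hx)

theorem traj_state {γ : Phase S V} {t : ℝ} (h : γ t ∉ S) :
    traj S V (state γ t) = γ.shift t := by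
  have h1 : state γ t ∈ cotangentBundle S := h
  refine eq_of_state_eq (t := 0) ?_ ?_
  · rw [traj_zero h1]
    exact h
  · rw [state_traj h1, state_shift, add_zero]

/-- The Hamiltonian flow on pairs (momentum, position). -/
def flowMap (S : Set ℂ) (V : ℂ → ℝ) [CompleteCoulomb S V] (t : ℝ) (x : ℂ × ℂ) : ℂ × ℂ :=
  state (traj S V x) t

/-- The set of points whose trajectory is not at a nucleus at time `t`. -/
def flowDomain (S : Set ℂ) (V : ℂ → ℝ) [CompleteCoulomb S V] (t : ℝ) : Set (ℂ × ℂ) :=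
  {x | x ∈ cotangentBundle S ∧ traj S V x t ∉ S}

theorem flowMap_zero {x : ℂ × ℂ} (hx : x ∈ cotangentBundle S) : flowMap S V 0 x = x :=
  state_traj hx

theorem flowMap_mem {t : ℝ} {x : ℂ × ℂ} (hx : x ∈ flowDomain S V t) :
    flowMap S V t x ∈ cotangentBundle S := hx.2

theorem flowMap_state {γ : Phase S V} {u : ℝ} (h : γ u ∉ S) (t : ℝ) :
    flowMap S V t (state γ u) = state γ (u + t) := by
  rw [flowMap, traj_state h, state_shift]

theorem traj_flowMap {t : ℝ} {x : ℂ × ℂ} (hx : x ∈ flowDomain S V t) :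
    traj S V (flowMap S V t x) = (traj S V x).shift t := traj_state hx.2

theorem state_mem_flowDomain {γ : Phase S V} {u v : ℝ} (hu : γ u ∉ S) (hv : γ v ∉ S) :
    state γ u ∈ flowDomain S V (v - u) := by
  refine ⟨hu, ?_⟩
  rw [traj_state hu, shift_apply, add_sub_cancel]
  exact hv

theorem flowDomain_add {t u : ℝ} {x : ℂ × ℂ} (h1 : x ∈ flowDomain S V t)
    (h2 : flowMap S V t x ∈ flowDomain S V u) : x ∈ flowDomain S V (t + u) := by
  refine ⟨h1.1, ?_⟩
  have := h2.2
  rwa [traj_flowMap h1] at this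

theorem flowMap_add {t : ℝ} {x : ℂ × ℂ} (h1 : x ∈ flowDomain S V t) (u : ℝ) :
    flowMap S V u (flowMap S V t x) = flowMap S V (t + u) x := by
  rw [flowMap, traj_flowMap h1, state_shift, flowMap]

/-- The energy of a trajectory. -/
def energy (γ : Phase S V) : ℝ := hamiltonian V (state γ γ.exists_notMem.choose)

theorem hamiltonian_state {γ : Phase S V} {t : ℝ} (h : γ t ∉ S) :
    hamiltonian V (state γ t) = γ.energy :=
  hamiltonian_eq hC.toLocallyCoulomb isPreconnected_univ isOpen_univ (fun t _ => γ.regular t)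
    (mem_univ t) (mem_univ _) h γ.exists_notMem.choose_spec

theorem energy_shift (a : ℝ) (γ : Phase S V) : (γ.shift a).energy = γ.energy := by
  obtain ⟨t, ht⟩ := (γ.shift a).exists_notMem
  rw [← hamiltonian_state ht, state_shift]
  exact hamiltonian_state (γ := γ) ht

theorem energy_traj {x : ℂ × ℂ} (hx : x ∈ cotangentBundle S) :
    (traj S V x).energy = hamiltonian V x := by
  rw [← hamiltonian_state (t := 0) (by rw [traj_zero hx]; exact hx), state_traj hx]

/-- A curve that satisfies Newton's equation locally is part of a trajectory. -/
theorem eq_of_hasDerivAt {γ : Phase S V} {α : ℝ → ℂ × ℂ} {J : Set ℝ} (hJ : IsPreconnected J)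
    (hJo : IsOpen J) (hα : ∀ u ∈ J, HasDerivAt α (newtonField V (α u)) u)
    (hS : ∀ u ∈ J, (α u).2 ∉ S) {t : ℝ} (ht : t ∈ J) (h : state γ t = α t) :
    ∀ u ∈ J, state γ u = α u := by
  have h1 := fun u hu => isRegularizedAt_of_hasDerivAt
    (eventually_of_mem (hJo.mem_nhds hu) hα) (hS u hu)
  intro u hu
  have h2 := eventuallyEq_on_of_state_eq hC.toLocallyCoulomb hJ hJo (fun t _ => γ.regular t)
    (fun u hu => (h1 u hu).1) ht
    (by
      have : (state γ t).2 ∉ S := by rw [h]; exact hS t ht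
      exact this)
    (by rw [(h1 t ht).2.eq_of_nhds, h]) u hu
  rw [state_congr h2, (h1 u hu).2.eq_of_nhds]

/-- Near a point of the cotangent bundle, the flow is the smooth flow of Newton's equation. -/
theorem exists_newton_flow {x₀ : ℂ × ℂ} (hx₀ : x₀ ∈ cotangentBundle S) :
    ∃ w > 0, ∃ N : Set (ℂ × ℂ), IsOpen N ∧ x₀ ∈ N ∧
      (∀ t ∈ Ioo (-w) w, N ⊆ flowDomain S V t) ∧
      ContDiffOn ℝ ∞ (fun z : ℝ × ℂ × ℂ => flowMap S V z.1 z.2) (Ioo (-w) w ×ˢ N) ∧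
      ∀ t ∈ Ioo (-w) w, ∀ x ∈ N,
        HasDerivAt (fun s => flowMap S V s x) (newtonField V (flowMap S V t x)) t := by
  obtain ⟨w, hw, N, hN, hxN, ψ, hψ, hψ'⟩ := exists_smooth_flow hC.isOpen_cotangentBundle
    hC.contDiffOn_newtonField hx₀
  have h0 : (0 : ℝ) ∈ Ioo (-w) w := ⟨by linarith, hw⟩
  have hT : ∀ x ∈ N, x ∈ cotangentBundle S := fun x hx => by
    have := ((hψ' x hx).2 0 h0).1
    rwa [(hψ' x hx).1] at this
  have heq : ∀ x ∈ N, ∀ t ∈ Ioo (-w) w, flowMap S V t x = ψ t x := fun x hx =>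
    eq_of_hasDerivAt (α := fun t => ψ t x) isPreconnected_Ioo isOpen_Ioo
      (fun u hu => ((hψ' x hx).2 u hu).2) (fun u hu => ((hψ' x hx).2 u hu).1) h0
      (by rw [state_traj (hT x hx), (hψ' x hx).1])
  refine ⟨w, hw, N, hN, hxN, fun t ht x hx => ⟨hT x hx, ?_⟩, hψ.congr fun z hz =>
    heq z.2 hz.2 z.1 hz.1, fun t ht x hx => ?_⟩
  · have h1 := ((hψ' x hx).2 t ht).1
    rw [← heq x hx t ht] at h1
    exact h1
  · rw [heq x hx t ht]
    refine ((hψ' x hx).2 t ht).2.congr_of_eventuallyEq ?_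
    filter_upwards [isOpen_Ioo.mem_nhds ht] with s hs
    exact heq x hx s hs

end Phase


/-! ### Local flows in Levi-Civita coordinates and the trajectories that follow them -/

/-- The implicit function theorem for one scalar unknown. -/
theorem exists_smooth_implicit {E : Type*} [NormedAddCommGroup E] [NormedSpace ℝ E]
    [CompleteSpace E] {F : ℝ × E → ℝ} {U : Set (ℝ × E)} (hU : IsOpen U)
    (hF : ContDiffOn ℝ ∞ F U) {s₁ : ℝ} {z₁ : E} (hz : (s₁, z₁) ∈ U) {a : ℝ} (ha : a ≠ 0)
    (hd : HasDerivAt (fun s => F (s, z₁)) a s₁) :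
    ∃ τ : E → ℝ, ContDiffAt ℝ ∞ τ z₁ ∧ τ z₁ = s₁ ∧ ∀ᶠ z in 𝓝 z₁, F (τ z, z) = F (s₁, z₁) := by
  have hFd : HasFDerivAt F (fderiv ℝ F (s₁, z₁)) (s₁, z₁) :=
    ((hF.contDiffAt (hU.mem_nhds hz)).differentiableAt (by simp)).hasFDerivAt
  set L := fderiv ℝ F (s₁, z₁)
  have hL : ∀ s : ℝ, ∀ z : E, L (s, z) = s * a + L (0, z) := by
    intro s z
    have h1 : HasDerivAt (fun s : ℝ => (s, z₁)) ((1 : ℝ), (0 : E)) s₁ :=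
      (hasDerivAt_id s₁).prodMk (hasDerivAt_const s₁ z₁)
    have h2 : L ((1 : ℝ), (0 : E)) = a := (hFd.comp_hasDerivAt s₁ h1).unique hd
    have h3 : ((s, z) : ℝ × E) = s • ((1 : ℝ), (0 : E)) + (0, z) := by simp
    rw [h3, map_add, map_smul, h2, smul_eq_mul]
  -- The map `(s, z) ↦ (F (s, z), z)` has triangular derivative, invertible because `a ≠ 0`; the
  -- first component of its inverse is the implicit function.
  let A : (ℝ × E) ≃L[ℝ] (ℝ × E) := ContinuousLinearEquiv.equivOfInverse
    (L.prod (ContinuousLinearMap.snd ℝ ℝ E))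
    ((a⁻¹ • (ContinuousLinearMap.fst ℝ ℝ E - (L.comp (ContinuousLinearMap.inr ℝ ℝ E)).comp
      (ContinuousLinearMap.snd ℝ ℝ E))).prod (ContinuousLinearMap.snd ℝ ℝ E))
    (fun x => by
      refine Prod.ext ?_ rfl
      have h : L x = x.1 * a + L (0, x.2) := hL x.1 x.2
      show a⁻¹ * (L x - L (0, x.2)) = x.1
      rw [h]
      field_simp
      ring)
    (fun x => by
      refine Prod.ext ?_ rfl
      show L (a⁻¹ * (x.1 - L (0, x.2)), x.2) = x.1
      rw [hL]
      field_simp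
      ring)
  obtain ⟨e, he, -, hef, hes⟩ := exists_smooth_localInverse (f := fun y => (F y, y.2)) hU
    (hF.prodMk contDiffOn_snd) hz A (hFd.prodMk hasFDerivAt_snd)
  have he1 : e (s₁, z₁) = (F (s₁, z₁), z₁) := hef _
  have ht : (F (s₁, z₁), z₁) ∈ e.target := he1 ▸ e.map_source he
  have hc : ContDiff ℝ ∞ fun z : E => (F (s₁, z₁), z) := contDiff_const.prodMk contDiff_id
  refine ⟨fun z => (e.symm (F (s₁, z₁), z)).1, ?_, ?_, ?_⟩
  · exact ((hes.contDiffAt (e.open_target.mem_nhds ht)).comp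
      (f := fun z : E => (F (s₁, z₁), z)) z₁ hc.contDiffAt).fst
  · show (e.symm (F (s₁, z₁), z₁)).1 = s₁
    rw [← he1, e.left_inv he]
  · filter_upwards [hc.continuous.continuousAt.eventually (e.open_target.mem_nhds ht)] with z hz
    have h1 := e.right_inv hz
    rw [hef] at h1
    have h2 : (e.symm (F (s₁, z₁), z)).2 = z := congrArg Prod.snd h1
    have h3 : F (e.symm (F (s₁, z₁), z)) = F (s₁, z₁) := congrArg Prod.fst h1
    rwa [← Prod.mk.eta (p := e.symm (F (s₁, z₁), z)), h2] at h3

/-- Dividing by `Q²` first moves the base point to `1`, where the principal logarithm is smooth, so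
the same formula gives a branch near any nonzero point. -/
theorem exists_smooth_sqrt {Q : ℂ} (hQ : Q ≠ 0) : ∃ R : ℂ → ℂ, ContDiffAt ℝ ∞ R (Q ^ 2) ∧
    R (Q ^ 2) = Q ∧ ∀ᶠ y in 𝓝 (Q ^ 2), R y ^ 2 = y := by
  have hQ2 : Q ^ 2 ≠ 0 := pow_ne_zero 2 hQ
  refine ⟨fun y => Q * Complex.exp (Complex.log (y / Q ^ 2) / 2), ?_, ?_, ?_⟩
  · have h1 : ContDiffAt ℂ ∞ Complex.log (Q ^ 2 / Q ^ 2) := Complex.contDiffAt_log (by simp [hQ])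
    have h2 : ContDiffAt ℂ ∞ (fun y => Complex.log (y / Q ^ 2)) (Q ^ 2) :=
      h1.comp (f := fun y => y / Q ^ 2) _ (contDiffAt_id.div_const _)
    exact (contDiffAt_const.mul (Complex.contDiff_exp.contDiffAt.comp (Q ^ 2)
      (h2.div_const 2))).restrict_scalars ℝ
  · simp [hQ]
  · filter_upwards [isOpen_ne.mem_nhds hQ2] with y hy
    rw [mul_pow, ← Complex.exp_nat_mul]
    push_cast
    rw [mul_div_cancel₀ _ two_ne_zero, Complex.exp_log (div_ne_zero hy hQ2), mul_div_cancel₀ _ hQ2]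

theorem contDiffAt_lcDown {σ : ℂ} {z : LCSpace} (hQ : z.1 ≠ 0) :
    ContDiffAt ℝ ∞ (lcDown σ) z := by
  have h4 : ContDiff ℝ ∞ fun z : LCSpace => 2 * (starRingEnd ℂ) z.1 :=
    contDiff_const.mul ((Complex.conjCLE : ℂ →L[ℝ] ℂ).contDiff.comp contDiff_fst)
  have h5 : ContDiff ℝ ∞ fun z : LCSpace => z.2.1 := contDiff_snd.fst
  have h6 : ContDiff ℝ ∞ fun z : LCSpace => σ + z.1 ^ 2 := contDiff_const.add (contDiff_fst.pow 2)
  exact (h5.contDiffAt.mul (h4.contDiffAt.inv (by simpa using hQ))).prodMk h6.contDiffAt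

section

variable {S : Set ℂ} {V : ℂ → ℝ} {σ : ℂ} {Z ε w : ℝ} {N : Set LCSpace} {ψ : ℝ → LCSpace → LCSpace}

/-- A local flow of the regularized equations of motion. -/
structure LCFlow (S : Set ℂ) (V : ℂ → ℝ) (σ : ℂ) (Z ε w : ℝ) (N : Set LCSpace)
    (ψ : ℝ → LCSpace → LCSpace) : Prop where
  chart : CollisionChart S V σ Z ε
  pos : 0 < w
  isOpen : IsOpen N
  smooth : ContDiffOn ℝ ∞ (fun y : ℝ × LCSpace => ψ y.1 y.2) (Ioo (-w) w ×ˢ N)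
  zero : ∀ z ∈ N, ψ 0 z = z
  solution : ∀ z ∈ N, lcEnergy (leviCivita V σ Z) z = 0 →
    IsLCSolution (leviCivita V σ Z) ε (fun s => ψ s z) (Ioo (-w) w)

theorem CollisionChart.exists_lcFlow (h : CollisionChart S V σ Z ε) {z₀ : LCSpace}
    (hz₀ : z₀.1 = 0) : ∃ w N ψ, LCFlow S V σ Z ε w N ψ ∧ z₀ ∈ N := by
  have hd : z₀ ∈ lcDomain ε := by
    show z₀.1 ∈ Metric.ball 0 ε
    rw [hz₀]
    exact Metric.mem_ball_self h.ε_pos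
  obtain ⟨w, hw, N, hN, hzN, ψ, hψ, hψ'⟩ := h.exists_flow hd
  exact ⟨w, N, ψ, ⟨h, hw, hN, hψ, fun z hz => (hψ' z hz).1, fun z hz => (hψ' z hz).2⟩, hzN⟩

/-- The curve `γ` is the projection of the solution of the regularized equations through `z`. -/
def LCFollows (σ : ℂ) (w : ℝ) (ψ : ℝ → LCSpace → LCSpace) (γ : ℝ → ℂ) (z : LCSpace) : Prop :=
  ∀ s ∈ Ioo (-w) w, γ (ψ s z).2.2.2 = σ + (ψ s z).1 ^ 2 ∧
    ((ψ s z).1 ≠ 0 → state γ (ψ s z).2.2.2 = lcDown σ (ψ s z))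

namespace LCFlow

theorem zero_mem (F : LCFlow S V σ Z ε w N ψ) : (0 : ℝ) ∈ Ioo (-w) w :=
  ⟨by linarith [F.pos], F.pos⟩

theorem continuousAt (F : LCFlow S V σ Z ε w N ψ) {s : ℝ} {z : LCSpace} (hs : s ∈ Ioo (-w) w)
    (hz : z ∈ N) : ContinuousAt (fun y : ℝ × LCSpace => ψ y.1 y.2) (s, z) :=
  F.smooth.continuousOn.continuousAt ((isOpen_Ioo.prod F.isOpen).mem_nhds ⟨hs, hz⟩)

theorem continuousAt_left (F : LCFlow S V σ Z ε w N ψ) {s : ℝ} {z : LCSpace}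
    (hs : s ∈ Ioo (-w) w) (hz : z ∈ N) : ContinuousAt (fun s => ψ s z) s :=
  (F.continuousAt hs hz).comp (f := fun s => (s, z)) (by fun_prop)

theorem continuousAt_right (F : LCFlow S V σ Z ε w N ψ) {s : ℝ} {z : LCSpace}
    (hs : s ∈ Ioo (-w) w) (hz : z ∈ N) : ContinuousAt (ψ s) z :=
  (F.continuousAt hs hz).comp (f := fun z => (s, z)) (by fun_prop)

theorem notMem_iff (F : LCFlow S V σ Z ε w N ψ) {z : LCSpace} (hz : z ∈ N)
    (hK : lcEnergy (leviCivita V σ Z) z = 0) {γ : ℝ → ℂ} (hγ : LCFollows σ w ψ γ z) {s : ℝ}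
    (hs : s ∈ Ioo (-w) w) : γ (ψ s z).2.2.2 ∉ S ↔ (ψ s z).1 ≠ 0 := by
  rw [(hγ s hs).1]
  constructor
  · intro h h0
    rw [h0, zero_pow two_ne_zero, add_zero] at h
    exact h F.chart.mem
  · exact F.chart.notMem _ ((F.solution z hz hK).mem s hs)

/-- For nearby initial values, solutions of the regularized equations arrive smoothly at a fixed
physical time. -/
theorem exists_section (F : LCFlow S V σ Z ε w N ψ) {s₁ : ℝ} (hs₁ : s₁ ∈ Ioo (-w) w)
    {z₁ : LCSpace} (hz₁ : z₁ ∈ N) (hK : lcEnergy (leviCivita V σ Z) z₁ = 0)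
    (hQ : (ψ s₁ z₁).1 ≠ 0) :
    ∃ τ : LCSpace → ℝ, ContDiffAt ℝ ∞ (fun z => lcDown σ (ψ (τ z) z)) z₁ ∧ ContDiffAt ℝ ∞ τ z₁ ∧
      τ z₁ = s₁ ∧ ∀ᶠ z in 𝓝 z₁, z ∈ N ∧ τ z ∈ Ioo (-w) w ∧ (ψ (τ z) z).1 ≠ 0 ∧
        (ψ (τ z) z).2.2.2 = (ψ s₁ z₁).2.2.2 := by
  have hd : HasDerivAt (fun s => (ψ s z₁).2.2.2) (Complex.normSq (ψ s₁ z₁).1) s₁ :=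
    ((F.solution z₁ hz₁ hK).hasDerivAt s₁ hs₁).snd.snd.snd
  obtain ⟨τ, hτ, hτ₁, hev⟩ := exists_smooth_implicit (F := fun y => (ψ y.1 y.2).2.2.2)
    (isOpen_Ioo.prod F.isOpen) F.smooth.snd.snd.snd ⟨hs₁, hz₁⟩ (by simpa using hQ) hd
  have h1 : ContDiffAt ℝ ∞ (fun z => ψ (τ z) z) z₁ := by
    have h2 : ContDiffAt ℝ ∞ (fun y : ℝ × LCSpace => ψ y.1 y.2) (τ z₁, z₁) := by
      rw [hτ₁]
      exact F.smooth.contDiffAt ((isOpen_Ioo.prod F.isOpen).mem_nhds ⟨hs₁, hz₁⟩)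
    exact h2.comp (f := fun z => (τ z, z)) z₁ (hτ.prodMk contDiffAt_id)
  have h3 : ContDiffAt ℝ ∞ (lcDown σ) (ψ (τ z₁) z₁) := by
    rw [hτ₁]
    exact contDiffAt_lcDown hQ
  refine ⟨τ, h3.comp (f := fun z => ψ (τ z) z) z₁ h1, hτ, hτ₁, ?_⟩
  have h7 : ∀ᶠ z in 𝓝 z₁, (ψ (τ z) z).1 ≠ 0 :=
    h1.continuousAt.fst.eventually (isOpen_ne.mem_nhds (by
      show (ψ (τ z₁) z₁).1 ≠ 0
      rwa [hτ₁]))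
  filter_upwards [hev, h7, F.isOpen.mem_nhds hz₁, hτ.continuousAt.eventually
    (isOpen_Ioo.mem_nhds (hτ₁.symm ▸ hs₁))] with z h8 h9 h10 h11
  exact ⟨h10, h11, h9, h8⟩

/-- Solutions of the regularized equations that start near `z₀` reach all physical times near that
of `z₀`. -/
theorem exists_time (F : LCFlow S V σ Z ε w N ψ) {z₀ : LCSpace} (hz₀ : z₀ ∈ N)
    (hK : lcEnergy (leviCivita V σ Z) z₀ = 0) :
    ∃ δ > 0, ∀ᶠ z in 𝓝 z₀, z ∈ N ∧ (lcEnergy (leviCivita V σ Z) z = 0 → ∀ t,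
      |t - z₀.2.2.2| < δ → ∃ s ∈ Ioo (-w) w, (ψ s z).2.2.2 = t) := by
  have hw := F.pos
  have hmem : ∀ {s}, |s| ≤ w / 2 → s ∈ Ioo (-w) w := fun {s} hs => by
    obtain ⟨h1, h2⟩ := abs_le.1 hs
    exact ⟨by linarith, by linarith⟩
  have hp : w / 2 ∈ Ioo (-w) w := ⟨by linarith, by linarith⟩
  have hm : -(w / 2) ∈ Ioo (-w) w := ⟨by linarith, by linarith⟩
  have hmono := F.chart.strictMonoOn_time (F.solution z₀ hz₀ hK)
  have h1 : z₀.2.2.2 < (ψ (w / 2) z₀).2.2.2 := by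
    have := hmono F.zero_mem hp (by linarith)
    simpa only [F.zero z₀ hz₀] using this
  have h2 : (ψ (-(w / 2)) z₀).2.2.2 < z₀.2.2.2 := by
    have := hmono hm F.zero_mem (by linarith)
    simpa only [F.zero z₀ hz₀] using this
  obtain ⟨δ, hδ0, hδ⟩ := exists_between (lt_min (sub_pos.2 h1) (sub_pos.2 h2))
  obtain ⟨hδ1, hδ2⟩ := lt_min_iff.1 hδ
  refine ⟨δ, hδ0, ?_⟩
  filter_upwards [F.isOpen.mem_nhds hz₀,
    (F.continuousAt_right hp hz₀).snd.snd.snd.eventually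
      (lt_mem_nhds (show z₀.2.2.2 + δ < _ by linarith)),
    (F.continuousAt_right hm hz₀).snd.snd.snd.eventually
      (gt_mem_nhds (show _ < z₀.2.2.2 - δ by linarith))] with z hz h3 h4
  refine ⟨hz, fun hKz t ht => ?_⟩
  obtain ⟨ht1, ht2⟩ := abs_lt.1 ht
  have hcont : ContinuousOn (fun s => (ψ s z).2.2.2) (Icc (-(w / 2)) (w / 2)) := fun s hs =>
    (F.continuousAt_left (hmem (abs_le.2 hs)) hz).snd.snd.snd.continuousWithinAt
  obtain ⟨s, hs, hst⟩ := intermediate_value_Icc (by linarith) hcont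
    (show t ∈ Icc _ _ from ⟨by linarith, by linarith⟩)
  exact ⟨s, hmem (abs_le.2 hs), hst⟩

theorem exists_ne_zero (F : LCFlow S V σ Z ε w N ψ) {z : LCSpace} (hz : z ∈ N)
    (hK : lcEnergy (leviCivita V σ Z) z = 0) : ∃ s ∈ Ioo (-w) w, (ψ s z).1 ≠ 0 :=
  ((eventually_of_mem (nhdsWithin_le_nhds (isOpen_Ioo.mem_nhds F.zero_mem)) fun _ => id).and
    (F.chart.eventually_ne_zero (F.solution z hz hK) F.zero_mem)).exists

variable [hC : CompleteCoulomb S V]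

theorem follows (F : LCFlow S V σ Z ε w N ψ) {z : LCSpace} (hz : z ∈ N)
    (hK : lcEnergy (leviCivita V σ Z) z = 0) {γ : Phase S V} {s : ℝ} (hs : s ∈ Ioo (-w) w)
    (hQ : (ψ s z).1 ≠ 0) (h : state γ (ψ s z).2.2.2 = lcDown σ (ψ s z)) :
    LCFollows σ w ψ γ z := fun _ hs' =>
  F.chart.eq_of_state_eq hC.toLocallyCoulomb (F.solution z hz hK) isOpen_univ ordConnected_univ
    (fun t _ => γ.regular t) hs (mem_univ _) hQ h hs' (mem_univ _)

theorem follows_of_zero (F : LCFlow S V σ Z ε w N ψ) {z : LCSpace} (hz : z ∈ N)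
    (hK : lcEnergy (leviCivita V σ Z) z = 0) {γ : Phase S V}
    (hQ : z.1 ≠ 0) (h : state γ z.2.2.2 = lcDown σ z) : LCFollows σ w ψ γ z :=
  F.follows hz hK F.zero_mem (by rwa [F.zero z hz]) (by rw [F.zero z hz, h])

/-- The initial value itself may be a collision, which has no state. A nearby parameter with `Q ≠ 0`
supplies a state, and the trajectory through it is shifted back in time. -/
theorem exists_follows (F : LCFlow S V σ Z ε w N ψ) {z : LCSpace} (hz : z ∈ N)
    (hK : lcEnergy (leviCivita V σ Z) z = 0) : ∃ γ : Phase S V, LCFollows σ w ψ γ z := by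
  obtain ⟨s, hs, hQ⟩ := F.exists_ne_zero hz hK
  refine ⟨(Phase.traj S V (lcDown σ (ψ s z))).shift (-(ψ s z).2.2.2),
    F.follows hz hK hs hQ ?_⟩
  rw [Phase.state_shift, neg_add_cancel, Phase.state_traj]
  exact F.chart.lcDown_mem ((F.solution z hz hK).mem s hs) hQ

theorem follows_unique (F : LCFlow S V σ Z ε w N ψ) {z : LCSpace} (hz : z ∈ N)
    (hK : lcEnergy (leviCivita V σ Z) z = 0) {γ δ : Phase S V} (hγ : LCFollows σ w ψ γ z)
    (hδ : LCFollows σ w ψ δ z) : γ = δ := by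
  obtain ⟨s, hs, hQ⟩ := F.exists_ne_zero hz hK
  exact Phase.eq_of_state_eq ((F.notMem_iff hz hK hγ hs).2 hQ)
    (((hγ s hs).2 hQ).trans ((hδ s hs).2 hQ).symm)

/-- The coordinate `E` is constant along the regularized flow and equals the physical energy
wherever `Q ≠ 0`. -/
theorem energy_of_follows (F : LCFlow S V σ Z ε w N ψ) {z : LCSpace} (hz : z ∈ N)
    (hK : lcEnergy (leviCivita V σ Z) z = 0) {γ : Phase S V} (hγ : LCFollows σ w ψ γ z) :
    γ.energy = z.2.2.1 := by
  obtain ⟨s, hs, hQ⟩ := F.exists_ne_zero hz hK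
  have hsol := F.solution z hz hK
  rw [← Phase.hamiltonian_state ((F.notMem_iff hz hK hγ hs).2 hQ), (hγ s hs).2 hQ,
    lcDown_energy (hsol.energy s hs) hQ]
  have hd : ∀ s ∈ Ioo (-w) w, HasDerivAt (fun s => (ψ s z).2.2.1) 0 s := fun s hs =>
    (hsol.hasDerivAt s hs).snd.snd.fst
  have := isOpen_Ioo.is_const_of_deriv_eq_zero isPreconnected_Ioo
    (fun s hs => (hd s hs).differentiableAt.differentiableWithinAt) (fun s hs => (hd s hs).deriv)
    hs F.zero_mem
  rw [this, F.zero z hz]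

end LCFlow

/-- The lifts of collision-free states of `γ` follow `γ`, and the regularized flow is continuous in
its initial value, so the equation for positions passes to a cluster point. The momenta are then
recovered by comparison with the projected solution as a curve. -/
theorem Phase.follows_of_mapClusterPt [hC : CompleteCoulomb S V] (F : LCFlow S V σ Z ε w N ψ)
    {γ : Phase S V} {t : ℝ} {Q : ℝ → ℂ} (hQ : ∀ u, Q u ^ 2 = γ u - σ) {z₀ : LCSpace}
    (hz₀ : MapClusterPt z₀ (𝓝[≠] t) fun u => lcLift V (Q u) (state γ u) u) (hzN : z₀ ∈ N)
    (hK₀ : lcEnergy (leviCivita V σ Z) z₀ = 0) : LCFollows σ w ψ γ z₀ := by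
  obtain ⟨δ, hδ⟩ := F.chart.exists_regularized hC.toLocallyCoulomb (F.solution z₀ hzN hK₀)
  have key : ∀ s ∈ Ioo (-w) w, γ (ψ s z₀).2.2.2 = σ + (ψ s z₀).1 ^ 2 := by
    intro s hs
    have hc := F.continuousAt_right hs hzN
    have hc1 : ContinuousAt (fun z => γ (ψ s z).2.2.2) z₀ :=
      γ.continuous.continuousAt.comp (f := fun z => (ψ s z).2.2.2) hc.snd.snd.snd
    have hc2 : ContinuousAt (fun z => σ + (ψ s z).1 ^ 2) z₀ :=
      continuousAt_const.add (hc.fst.pow 2)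
    have hev : ∀ᶠ u in 𝓝[≠] t, lcLift V (Q u) (state γ u) u ∈ N →
        γ (ψ s (lcLift V (Q u) (state γ u) u)).2.2.2 =
          σ + (ψ s (lcLift V (Q u) (state γ u) u)).1 ^ 2 := by
      filter_upwards [γ.eventually_notMem t] with u huS hN
      have hu : γ u ≠ σ := fun heq => huS (heq ▸ F.chart.mem)
      have hQu : Q u ≠ 0 := by
        intro h1
        have h2 := hQ u
        rw [h1] at h2
        exact hu (sub_eq_zero.1 (by rw [← h2]; simp))
      exact (F.follows_of_zero hN (lcEnergy_lcLift (hQ u) hu u) hQu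
        (lcDown_lcLift (hQ u) hu u).symm s hs).1
    exact tendsto_nhds_unique_of_frequently_eq hc1 hc2 (by
      rw [frequently_iff]
      intro U hU
      obtain ⟨u, ⟨hu1, hu2⟩, hu3⟩ := ((hz₀.frequently
        (inter_mem hU (F.isOpen.mem_nhds hzN))).and_eventually hev).exists
      exact ⟨_, hu1, hu3 hu2⟩)
  intro s hs
  refine ⟨key s hs, fun hQs => ?_⟩
  have hcont : ContinuousOn (fun s => (ψ s z₀).2.2.2) (Ioo (-w) w) := fun s hs =>
    (F.continuousAt_left hs hzN).snd.snd.snd.continuousWithinAt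
  have hmap := nhds_le_map_of_strictMonoOn isOpen_Ioo hcont
    (F.chart.strictMonoOn_time (F.solution z₀ hzN hK₀)) hs
  have heq : δ =ᶠ[𝓝 (ψ s z₀).2.2.2] γ := hmap (show ∀ᶠ v in 𝓝 s, _ from by
    filter_upwards [isOpen_Ioo.mem_nhds hs] with v hv
    rw [key v hv, (hδ v hv).1])
  rw [← state_congr heq, (hδ s hs).2.2 hQs]

/-- Every collision is described by a solution of the regularized equations, whose initial
momentum is determined up to a sign. -/
theorem Phase.exists_collision [hC : CompleteCoulomb S V] (h : CollisionChart S V σ Z ε)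
    {γ : Phase S V} {t : ℝ} (ht : γ t = σ) :
    ∃ (P : ℂ) (E : ℝ), ∀ P', P' = P ∨ P' = -P →
      lcEnergy (leviCivita V σ Z) (0, P', E, t) = 0 ∧ ∀ {w N ψ}, LCFlow S V σ Z ε w N ψ →
        ((0, P', E, t) : LCSpace) ∈ N → LCFollows σ w ψ γ (0, P', E, t) := by
  choose Q hQ using fun u => exists_sqrt (γ u - σ)
  have hq : Tendsto (fun u => γ u - σ) (𝓝[≠] t) (𝓝 0) := by
    rw [← sub_self σ]
    refine Tendsto.sub_const ?_ σ
    rw [← ht]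
    exact (γ.continuous.tendsto t).mono_left nhdsWithin_le_nhds
  have hK : ∀ᶠ u in 𝓝[≠] t,
      lcEnergy (leviCivita V σ Z) (lcLift V (Q u) (state γ u) u) = 0 := by
    filter_upwards [γ.eventually_notMem t] with u hu
    have hne : γ u ≠ σ := fun heq => hu (heq ▸ h.mem)
    exact lcEnergy_lcLift (hQ u) hne u
  obtain ⟨⟨Q₀, P₀, E₀, T₀⟩, hz₀, h0, hK₀, hT⟩ := h.exists_mapClusterPt (l := 𝓝[≠] t)
    (A := |γ.energy|) (t₀ := t) (z := fun u => lcLift V (Q u) (state γ u) u) hK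
    (tendsto_zero_of_sq hQ hq)
    (by
      filter_upwards [γ.eventually_notMem t] with u hu
      exact (congrArg abs (hamiltonian_state hu)).le)
    (tendsto_id.mono_left nhdsWithin_le_nhds)
  simp only at h0 hT
  subst h0 hT
  refine ⟨P₀, E₀, ?_⟩
  rintro P' (rfl | rfl)
  · exact ⟨hK₀, fun F hN => follows_of_mapClusterPt F hQ hz₀ hN hK₀⟩
  -- Negating all square roots gives lifts of the same states, with cluster point `-P₀`. Both signs
  -- therefore describe the trajectory `γ`.
  · have hneg : MapClusterPt ((0, -P₀, E₀, T₀) : LCSpace) (𝓝[≠] T₀)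
        fun u => lcLift V (-Q u) (state γ u) u := by
      let g : LCSpace → LCSpace := fun z => (-z.1, -z.2.1, z.2.2.1, z.2.2.2)
      have h1 : MapClusterPt (g (0, P₀, E₀, T₀)) (𝓝[≠] T₀)
          (g ∘ fun u => lcLift V (Q u) (state γ u) u) :=
        hz₀.continuousAt_comp (by fun_prop)
      simpa only [g, neg_zero, Function.comp_def, lcLift, map_neg, mul_neg] using h1
    have hK' : lcEnergy (leviCivita V σ Z) (0, -P₀, E₀, T₀) = 0 := by
      simpa only [lcEnergy, Complex.normSq_neg] using hK₀
    exact ⟨hK', fun F hN => follows_of_mapClusterPt F (Q := fun u => -Q u)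
      (fun u => by rw [neg_sq, hQ]) hneg hN hK'⟩

theorem Phase.exists_lcFlow [hC : CompleteCoulomb S V] (h : CollisionChart S V σ Z ε)
    {γ : Phase S V} {t : ℝ} (ht : γ t = σ) :
    ∃ z₀ : LCSpace, z₀.1 = 0 ∧ lcEnergy (leviCivita V σ Z) z₀ = 0 ∧ z₀.2.2.2 = t ∧
      ∃ w N ψ, LCFlow S V σ Z ε w N ψ ∧ z₀ ∈ N ∧ LCFollows σ w ψ γ z₀ := by
  obtain ⟨P, E, hP⟩ := exists_collision h ht
  obtain ⟨hK, hfol⟩ := hP P (Or.inl rfl)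
  obtain ⟨w, N, ψ, F, hN⟩ := h.exists_lcFlow (z₀ := (0, P, E, t)) rfl
  exact ⟨(0, P, E, t), rfl, hK, rfl, w, N, ψ, F, hN, hfol F hN⟩

end


/-! ### Smoothness of the flow across collisions -/

section

variable {S : Set ℂ} {V : ℂ → ℝ} {σ : ℂ} {Z ε w : ℝ} {N : Set LCSpace} {ψ : ℝ → LCSpace → LCSpace}

theorem contDiffOn_hamiltonian (hC : LocallyCoulomb S V) :
    ContDiffOn ℝ ∞ (hamiltonian V) (cotangentBundle S) :=
  ((contDiff_normSq.comp contDiff_fst).div_const 2).contDiffOn.add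
    (hC.smooth.comp contDiffOn_snd fun _ hx => hx)

/-- Levi-Civita coordinates can be chosen to depend smoothly on the point of phase space. -/
theorem LocallyCoulomb.exists_smooth_lift (hC : LocallyCoulomb S V) {z : LCSpace} (hz : z.1 ≠ 0)
    (hK : lcEnergy (leviCivita V σ Z) z = 0) (hS : lcDown σ z ∈ cotangentBundle S) (hσ : σ ∈ S) :
    ∃ L : ℂ × ℂ → LCSpace, ContDiffAt ℝ ∞ L (lcDown σ z) ∧ L (lcDown σ z) = z ∧
      (∀ᶠ y in 𝓝 z, lcEnergy (leviCivita V σ Z) y = 0 → y.2.2.2 = z.2.2.2 →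
        L (lcDown σ y) = y) ∧ ∀ᶠ x in 𝓝 (lcDown σ z), lcEnergy (leviCivita V σ Z) (L x) = 0 ∧ lcDown σ (L x) = x ∧
        (L x).2.2.2 = z.2.2.2 ∧ (L x).1 ≠ 0 := by
  obtain ⟨R, hR, hR0, hRsq⟩ := exists_smooth_sqrt hz
  have h0 : (lcDown σ z).2 - σ = z.1 ^ 2 := by simp [lcDown]
  have hR' : ContDiffAt ℝ ∞ (fun x : ℂ × ℂ => R (x.2 - σ)) (lcDown σ z) := by
    refine ContDiffAt.comp (g := R) (f := fun x : ℂ × ℂ => x.2 - σ) _ ?_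
      (contDiff_snd.sub contDiff_const).contDiffAt
    rwa [h0]
  have hlift : ∀ y : LCSpace, y.1 ≠ 0 → lcEnergy (leviCivita V σ Z) y = 0 →
      y.2.2.2 = z.2.2.2 → R (y.1 ^ 2) = y.1 →
      lcLift V (R ((lcDown σ y).2 - σ)) (lcDown σ y) z.2.2.2 = y := by
    intro y hy hKy ht hRy
    have h1 : (lcDown σ y).2 - σ = y.1 ^ 2 := by simp [lcDown]
    have hcy : (starRingEnd ℂ) y.1 ≠ 0 := by simpa using hy
    simp only [lcLift, h1, hRy, lcDown_energy hKy hy, ← ht]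
    refine Prod.ext rfl (Prod.ext ?_ rfl)
    simp only [lcDown]
    field_simp
  refine ⟨fun x => lcLift V (R (x.2 - σ)) x z.2.2.2, ?_, hlift z hz hK rfl hR0, ?_, ?_⟩
  · refine hR'.prodMk (ContDiffAt.prodMk ?_ (ContDiffAt.prodMk ?_ contDiffAt_const))
    · exact (contDiffAt_const.mul contDiffAt_fst).mul
        ((Complex.conjCLE : ℂ →L[ℝ] ℂ).contDiff.contDiffAt.comp _ hR')
    · exact (contDiffOn_hamiltonian hC).contDiffAt (hC.isOpen_cotangentBundle.mem_nhds hS)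
  · have hc : ContinuousAt (fun y : LCSpace => y.1 ^ 2) z := by fun_prop
    have hc' : ContinuousAt (fun y : LCSpace => R (y.1 ^ 2) + y.1) z :=
      (ContinuousAt.comp (g := R) (f := fun y : LCSpace => y.1 ^ 2) hR.continuousAt hc).add
        continuousAt_fst
    -- The local square root of `y²` is `y` or `-y`; the second possibility would make this sum
    -- vanish, which continuity excludes near `z`.
    have hsum : R (z.1 ^ 2) + z.1 ≠ 0 := by
      rw [hR0, ← two_mul]
      exact mul_ne_zero two_ne_zero hz
    filter_upwards [hc.eventually hRsq, continuousAt_fst.eventually_ne hz, hc'.eventually_ne hsum] with y h1 h2 h3 hKy ht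
    refine hlift y h2 hKy ht ?_
    rcases sq_eq_sq_iff_eq_or_eq_neg.1 h1 with h4 | h4
    · exact h4
    · exact absurd (by rw [h4, neg_add_cancel]) h3
  · have h1 : ContinuousAt (fun x : ℂ × ℂ => x.2 - σ) (lcDown σ z) := by fun_prop
    have h2 := h1.eventually (p := fun y => R y ^ 2 = y) (by simpa only [h0] using hRsq)
    filter_upwards [h2, hC.isOpen_cotangentBundle.mem_nhds hS] with x h3 h4
    have h5 : x.2 ≠ σ := fun h => h4 (h ▸ hσ)
    refine ⟨lcEnergy_lcLift h3 h5 _, lcDown_lcLift h3 h5 _, rfl, fun h6 => h5 ?_⟩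
    have h7 : R (x.2 - σ) = 0 := h6
    rw [h7] at h3
    exact sub_eq_zero.1 (by rw [← h3]; simp)

theorem LCFlow.eventually_exists_time (F : LCFlow S V σ Z ε w N ψ) {z₀ : LCSpace} (hz₀ : z₀ ∈ N)
    (hK : lcEnergy (leviCivita V σ Z) z₀ = 0) {A : Set ℝ} (hA : A ∈ 𝓝 (0 : ℝ)) :
    ∀ᶠ t in 𝓝 z₀.2.2.2, ∃ s ∈ Ioo (-w) w, s ∈ A ∧ (ψ s z₀).2.2.2 = t := by
  have hcont : ContinuousOn (fun s => (ψ s z₀).2.2.2) (Ioo (-w) w) := fun s hs =>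
    (F.continuousAt_left hs hz₀).snd.snd.snd.continuousWithinAt
  have hmap := nhds_le_map_of_strictMonoOn isOpen_Ioo hcont
    (F.chart.strictMonoOn_time (F.solution z₀ hz₀ hK)) F.zero_mem
  simp only [F.zero z₀ hz₀] at hmap
  refine hmap (show ∀ᶠ s in 𝓝 (0 : ℝ), _ from ?_)
  filter_upwards [isOpen_Ioo.mem_nhds F.zero_mem, hA] with s h1 h2
  exact ⟨s, h1, h2, rfl⟩

variable [hC : CompleteCoulomb S V]

/-- Between two collision-free times on either side of a collision, the flow map is the smooth lift,
then the regularized flow with a smooth arrival parameter, then the projection. -/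
theorem LCFlow.contDiffAt_flowMap (F : LCFlow S V σ Z ε w N ψ) {z₀ : LCSpace} (hz₀ : z₀ ∈ N)
    (hK : lcEnergy (leviCivita V σ Z) z₀ = 0) {γ : Phase S V} (hγ : LCFollows σ w ψ γ z₀) :
    ∃ M ∈ 𝓝 z₀.2.2.2, ∀ u ∈ M, ∀ v ∈ M, γ u ∉ S → γ v ∉ S →
      Phase.flowDomain S V (v - u) ∈ 𝓝 (state γ u) ∧
        ContDiffAt ℝ ∞ (Phase.flowMap S V (v - u)) (state γ u) := by
  obtain ⟨δ, hδ, hev⟩ := F.exists_time hz₀ hK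
  have h0 : ContinuousAt (fun s => ψ s z₀) 0 := F.continuousAt_left F.zero_mem hz₀
  have hA := h0.eventually (p := fun z => z ∈ N ∧ (lcEnergy (leviCivita V σ Z) z = 0 → ∀ t,
      |t - z₀.2.2.2| < δ → ∃ s ∈ Ioo (-w) w, (ψ s z).2.2.2 = t)) (by simpa only [F.zero z₀ hz₀] using hev)
  refine ⟨_, inter_mem (F.eventually_exists_time hz₀ hK hA) (Metric.ball_mem_nhds _ hδ), ?_⟩
  rintro u ⟨⟨s, hs, ⟨hsN, hst⟩, rfl⟩, -⟩ v ⟨-, hv⟩ hu hvS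
  rw [Metric.mem_ball, Real.dist_eq] at hv
  -- The regularized flow is restarted at the parameter `s` belonging to the time `u`: here `Q ≠ 0`,
  -- so a smooth lift exists, which is not so at the collision value `z₀`.
  set z₁ := ψ s z₀
  have hsol := F.solution z₀ hz₀ hK
  have hK₁ : lcEnergy (leviCivita V σ Z) z₁ = 0 := hsol.energy s hs
  have hQ₁ : z₁.1 ≠ 0 := (F.notMem_iff hz₀ hK hγ hs).1 hu
  have hdown : state γ z₁.2.2.2 = lcDown σ z₁ := (hγ s hs).2 hQ₁
  have hfol := F.follows_of_zero hsN hK₁ hQ₁ hdown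
  obtain ⟨s₁, hs₁, rfl⟩ := hst hK₁ v hv
  have hQs := (F.notMem_iff hsN hK₁ hfol hs₁).1 hvS
  obtain ⟨τ, hτ, hτc, hτ₁, hτev⟩ := F.exists_section hs₁ hsN hK₁ hQs
  have hS₁ : lcDown σ z₁ ∈ cotangentBundle S := F.chart.lcDown_mem (hsol.mem s hs) hQ₁
  obtain ⟨L, hL, hL₁, -, hLev⟩ := hC.toLocallyCoulomb.exists_smooth_lift hQ₁ hK₁ hS₁ F.chart.mem
  rw [hdown]
  have hLc : Tendsto L (𝓝 (lcDown σ z₁)) (𝓝 z₁) := by simpa only [hL₁] using hL.continuousAt.tendsto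
  have key : ∀ᶠ x in 𝓝 (lcDown σ z₁),
      x ∈ Phase.flowDomain S V ((ψ s₁ z₁).2.2.2 - z₁.2.2.2) ∧
      Phase.flowMap S V ((ψ s₁ z₁).2.2.2 - z₁.2.2.2) x = lcDown σ (ψ (τ (L x)) (L x)) := by
    filter_upwards [hLev, hLc.eventually hτev, hC.isOpen_cotangentBundle.mem_nhds hS₁]
      with x ⟨h1, h2, h3, h4⟩ ⟨h5, h6, h7, h8⟩ hx
    have h9 : state ((Phase.traj S V x).shift (-z₁.2.2.2)) z₁.2.2.2 = x := by
      rw [Phase.state_shift, neg_add_cancel, Phase.state_traj hx]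
    have h10 := F.follows_of_zero (γ := (Phase.traj S V x).shift (-z₁.2.2.2)) h5 h1 h4
      (by rw [h3, h9, h2])
    have h11 := (h10 _ h6).2 h7
    have h12 := (F.notMem_iff h5 h1 h10 h6).2 h7
    rw [h8, Phase.state_shift, neg_add_eq_sub] at h11
    rw [h8, Phase.shift_apply, neg_add_eq_sub] at h12
    exact ⟨⟨hx, h12⟩, h11⟩
  refine ⟨key.mono fun x hx => hx.1, ContDiffAt.congr_of_eventuallyEq ?_
    (key.mono fun x hx => hx.2)⟩
  exact ContDiffAt.comp (g := fun z => lcDown σ (ψ (τ z) z)) _ (by rwa [hL₁]) hL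

namespace Phase

/-- Openness of the domain and smoothness of the map from time `u` to time `v` form a transitive
relation on the collision-free times. It therefore suffices to have them for times close to a given
one, by the Newton flow or by the Levi-Civita flow. -/
theorem contDiffAt_flowMap {t : ℝ} {x : ℂ × ℂ} (hx : x ∈ flowDomain S V t) :
    flowDomain S V t ∈ 𝓝 x ∧ ContDiffAt ℝ ∞ (flowMap S V t) x := by
  have key := relation_of_local (J := univ) (D := {t | traj S V x t ∉ S}) isPreconnected_univ
    isOpen_univ (fun t _ => (traj S V x).eventually_notMem t)
    (R := fun u v => flowDomain S V (v - u) ∈ 𝓝 (state (traj S V x) u) ∧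
      ContDiffAt ℝ ∞ (flowMap S V (v - u)) (state (traj S V x) u)) ?_ ?_
    (u := 0) (v := t) ⟨mem_univ _, by rw [mem_ofPred_eq, traj_zero hx.1]; exact hx.1⟩
    ⟨mem_univ _, hx.2⟩
  · rwa [sub_zero, state_traj hx.1] at key
  · intro u v w' hu hv hw ⟨h1, h2⟩ ⟨h3, h4⟩
    have h5 : flowMap S V (v - u) (state (traj S V x) u) = state (traj S V x) v := by
      rw [flowMap_state hu, add_sub_cancel]
    have h6 : Tendsto (flowMap S V (v - u)) (𝓝 (state (traj S V x) u))
        (𝓝 (state (traj S V x) v)) := by simpa only [h5] using h2.continuousAt.tendsto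
    have h7 : v - u + (w' - v) = w' - u := by ring
    refine ⟨?_, (ContDiffAt.comp (g := flowMap S V (w' - v)) _ (by rwa [h5]) h2).congr_of_eventuallyEq
      ?_⟩
    · filter_upwards [h1, h6.eventually h3] with y h8 h9
      rw [← h7]
      exact flowDomain_add h8 h9
    · filter_upwards [h1] with y h8
      rw [Function.comp_apply, flowMap_add h8, h7]
  · intro t _
    by_cases ht : traj S V x t ∈ S
    · obtain ⟨Z, ε, h⟩ := hC.exists_collisionChart ht
      obtain ⟨z₀, -, hK, hT, w, N, ψ, F, hzN, hγ⟩ := exists_lcFlow h (γ := traj S V x) rfl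
      obtain ⟨M, hM, hM'⟩ := F.contDiffAt_flowMap hzN hK hγ
      rw [hT] at hM
      exact ⟨M, hM, fun u hu v hv => hM' u hu.1 v hv.1 hu.2 hv.2⟩
    · obtain ⟨w, hw, N, hN, hxN, h1, h2, -⟩ := exists_newton_flow (S := S) (V := V)
        (x₀ := state (traj S V x) t) ht
      have h3 : ContinuousAt (state (traj S V x)) t :=
        (((traj S V x).regular t).newton ht).continuousAt
      refine ⟨state (traj S V x) ⁻¹' N ∩ Metric.ball t (w / 2),
        inter_mem (h3 (hN.mem_nhds hxN)) (Metric.ball_mem_nhds t (by linarith)), ?_⟩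
      rintro u ⟨⟨huN, hut⟩, hu⟩ v ⟨⟨hvN, hvt⟩, hv⟩
      have h4 : v - u ∈ Ioo (-w) w := by
        rw [Metric.mem_ball, Real.dist_eq, abs_lt] at hut hvt
        exact ⟨by linarith [hut.2, hvt.1], by linarith [hut.1, hvt.2]⟩
      refine ⟨mem_of_superset (hN.mem_nhds huN) (h1 _ h4), ?_⟩
      exact ContDiffAt.comp (g := fun z : ℝ × ℂ × ℂ => flowMap S V z.1 z.2)
        (f := fun x => (v - u, x)) _ (h2.contDiffAt ((isOpen_Ioo.prod hN).mem_nhds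
          (show (v - u, state (traj S V x) u) ∈ Ioo (-w) w ×ˢ N from ⟨h4, huN⟩)))
        (contDiffAt_const.prodMk contDiffAt_id)

theorem isOpen_flowDomain (t : ℝ) : IsOpen (flowDomain S V t) :=
  isOpen_iff_mem_nhds.2 fun _ hx => (contDiffAt_flowMap hx).1

theorem contDiffOn_flowMap (t : ℝ) : ContDiffOn ℝ ∞ (flowMap S V t) (flowDomain S V t) :=
  fun _ hx => (contDiffAt_flowMap hx).2.contDiffWithinAt

/-- The flow is smooth jointly in time and the initial value. -/
theorem contDiffAt_flowMap_prod {t : ℝ} {x : ℂ × ℂ} (hx : x ∈ flowDomain S V t) :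
    (∀ᶠ z : ℝ × ℂ × ℂ in 𝓝 (t, x), z.2 ∈ flowDomain S V z.1) ∧
      ContDiffAt ℝ ∞ (fun z : ℝ × ℂ × ℂ => flowMap S V z.1 z.2) (t, x) := by
  obtain ⟨h1, h2⟩ := contDiffAt_flowMap hx
  obtain ⟨w, hw, N, hN, hxN, h3, h4, -⟩ := exists_newton_flow (S := S) (V := V) (flowMap_mem hx)
  have h5 : ContDiffAt ℝ ∞ (fun z : ℝ × ℂ × ℂ => (z.1 - t, flowMap S V t z.2)) (t, x) :=
    (contDiffAt_fst.sub contDiffAt_const).prodMk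
      (ContDiffAt.comp (g := flowMap S V t) (t, x) h2 contDiffAt_snd)
  have h6 : (t - t, flowMap S V t x) ∈ Ioo (-w) w ×ˢ N := ⟨by simp [hw], hxN⟩
  have h7 : ∀ᶠ z : ℝ × ℂ × ℂ in 𝓝 (t, x), z.2 ∈ flowDomain S V t ∧
      (z.1 - t, flowMap S V t z.2) ∈ Ioo (-w) w ×ˢ N :=
    ((continuous_snd.tendsto (t, x)).eventually h1).and
      (h5.continuousAt.eventually ((isOpen_Ioo.prod hN).mem_nhds h6))
  refine ⟨h7.mono fun z hz => ?_, ?_⟩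
  · rw [← add_sub_cancel t z.1]
    exact flowDomain_add hz.1 (h3 _ hz.2.1 hz.2.2)
  · refine ContDiffAt.congr_of_eventuallyEq (f := fun z : ℝ × ℂ × ℂ =>
      flowMap S V (z.1 - t) (flowMap S V t z.2)) ?_ (h7.mono fun z hz => ?_)
    · exact ContDiffAt.comp (g := fun z : ℝ × ℂ × ℂ => flowMap S V z.1 z.2)
        (f := fun z : ℝ × ℂ × ℂ => (z.1 - t, flowMap S V t z.2)) (t, x)
        (h4.contDiffAt ((isOpen_Ioo.prod hN).mem_nhds h6)) h5
    · show flowMap S V z.1 z.2 = flowMap S V (z.1 - t) (flowMap S V t z.2)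
      rw [flowMap_add hz.1, add_sub_cancel]

end Phase

end


/-! ### Approximation of collision trajectories by collision-free ones -/

section

variable {S : Set ℂ} {V : ℂ → ℝ} {σ : ℂ} {Z ε w : ℝ} {N : Set LCSpace} {ψ : ℝ → LCSpace → LCSpace}

/-- The initial values of a collision solution are limits of initial values on the regularized
energy surface at which position and momentum are orthogonal, and different from zero. -/
theorem CollisionChart.exists_orthogonal (h : CollisionChart S V σ Z ε) {z₀ : LCSpace}
    (h0 : z₀.1 = 0) (hK : lcEnergy (leviCivita V σ Z) z₀ = 0) :
    ∃ z : ℝ → LCSpace, Tendsto z (𝓝[≠] 0) (𝓝 z₀) ∧ ∀ᶠ a in 𝓝[≠] (0 : ℝ),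
      lcEnergy (leviCivita V σ Z) (z a) = 0 ∧ (z a).1 ≠ 0 ∧
        (z a).1.re * (z a).2.1.re + (z a).1.im * (z a).2.1.im = 0 := by
  obtain ⟨Q₀, P₀, E₀, T₀⟩ := z₀
  simp only at h0
  subst h0
  have hP : P₀ ≠ 0 := h.ne_zero_of_lcEnergy hK rfl
  have hn : Complex.normSq P₀ ≠ 0 := by simpa using hP
  have hZ : Complex.normSq P₀ = 8 * Z := by
    simp only [lcEnergy, leviCivita_zero, map_zero] at hK
    linarith
  -- With `Q = i a P₀` orthogonal to `P = √g P₀`, the energy equation is solved for the squared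
  -- factor `g`. Its value at `a = 0` is `1` because `|P₀|² = 8Z`.
  set g : ℝ → ℝ := fun a => 8 * (E₀ * (a ^ 2 * Complex.normSq P₀) -
    leviCivita V σ Z (Complex.I * a * P₀)) / Complex.normSq P₀ with hg
  have hQc : Continuous fun a : ℝ => Complex.I * a * P₀ := by fun_prop
  have hf : ContinuousAt (fun a : ℝ => leviCivita V σ Z (Complex.I * a * P₀)) 0 := by
    refine ContinuousAt.comp (g := leviCivita V σ Z) ?_ hQc.continuousAt
    simpa using (h.smooth.contDiffAt (Metric.isOpen_ball.mem_nhds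
      (Metric.mem_ball_self h.ε_pos))).continuousAt
  have hgc : ContinuousAt g 0 := by
    refine ((continuousAt_const.mul (ContinuousAt.sub ?_ hf)).div_const _)
    fun_prop
  have hg0 : g 0 = 1 := by
    simp only [hg, Complex.ofReal_zero, mul_zero, zero_mul, leviCivita_zero, hZ]
    have := h.Z_pos
    field_simp
    ring
  have hzc : ContinuousAt (fun a : ℝ => ((Complex.I * a * P₀, Real.sqrt (g a) * P₀, E₀, T₀) :
      LCSpace)) 0 :=
    hQc.continuousAt.prodMk (((Complex.continuous_ofReal.continuousAt.comp
      (Real.continuous_sqrt.continuousAt.comp hgc)).mul continuousAt_const).prodMk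
        continuousAt_const)
  refine ⟨fun a => (Complex.I * a * P₀, Real.sqrt (g a) * P₀, E₀, T₀), ?_, ?_⟩
  · have := hzc.tendsto
    simp only [hg0, Real.sqrt_one, Complex.ofReal_zero, Complex.ofReal_one, mul_zero, zero_mul,
      one_mul] at this
    exact this.mono_left nhdsWithin_le_nhds
  · filter_upwards [self_mem_nhdsWithin, nhdsWithin_le_nhds (hgc.eventually
      (lt_mem_nhds (show (0 : ℝ) < g 0 by rw [hg0]; exact one_pos)))] with a ha hga
    refine ⟨?_, ?_, ?_⟩
    · simp only [lcEnergy, map_mul, Complex.normSq_ofReal, Complex.normSq_I,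
        Real.mul_self_sqrt hga.le]
      simp only [hg]
      field_simp
      ring
    · exact mul_ne_zero (mul_ne_zero Complex.I_ne_zero (Complex.ofReal_ne_zero.2 ha)) hP
    · simp
      ring

/-- Solutions with orthogonal initial values have no collision nearby. -/
theorem LCFlow.eventually_ne_zero (F : LCFlow S V σ Z ε w N ψ) {z₀ : LCSpace} (hz₀ : z₀ ∈ N)
    (h0 : z₀.1 = 0) (hK : lcEnergy (leviCivita V σ Z) z₀ = 0) :
    ∃ r > 0, Ioo (-r) r ⊆ Ioo (-w) w ∧ ∀ᶠ z in 𝓝 z₀, lcEnergy (leviCivita V σ Z) z = 0 →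
      z.1 ≠ 0 → z.1.re * z.2.1.re + z.1.im * z.2.1.im = 0 → ∀ s ∈ Ioo (-r) r, (ψ s z).1 ≠ 0 := by
  set f := leviCivita V σ Z
  -- `D` is the derivative of the inner product of `Q` and `P` along the flow. It is positive near a
  -- collision, so this product vanishes only at `s = 0` for orthogonal data; as every zero of `Q`
  -- is a zero of the product, `Q` does not vanish at all.
  let D : LCSpace → ℝ := fun z => Complex.normSq z.2.1 / 4 +
    (z.1.re * (lcField f z).2.1.re + z.1.im * (lcField f z).2.1.im)
  have hD0 : 0 < D z₀ := by
    have hP : 0 < Complex.normSq z₀.2.1 := by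
      simpa using F.chart.ne_zero_of_lcEnergy hK h0
    simp only [D, h0]
    simpa using hP
  have hdom : z₀ ∈ lcDomain ε := by
    have := (F.solution z₀ hz₀ hK).mem 0 F.zero_mem
    rwa [F.zero z₀ hz₀] at this
  have hfield : ContinuousAt (fun z => (lcField f z).2.1) z₀ :=
    (F.chart.contDiffOn_lcField.continuousOn.continuousAt
      ((isOpen_lcDomain ε).mem_nhds hdom)).snd.fst
  have hDc : ContinuousAt D z₀ := by
    refine ((Complex.continuous_normSq.continuousAt.comp
      continuousAt_snd.fst).div_const 4).add (ContinuousAt.add ?_ ?_)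
    · exact (Complex.continuous_re.continuousAt.comp continuousAt_fst).mul
        (Complex.continuous_re.continuousAt.comp hfield)
    · exact (Complex.continuous_im.continuousAt.comp continuousAt_fst).mul
        (Complex.continuous_im.continuousAt.comp hfield)
  have hDψ : ContinuousAt (fun y : ℝ × LCSpace => D (ψ y.1 y.2)) (0, z₀) := by
    refine ContinuousAt.comp (g := D) ?_ (F.continuousAt F.zero_mem hz₀)
    rwa [F.zero z₀ hz₀]
  have hev : ∀ᶠ y : ℝ × LCSpace in 𝓝 (0, z₀), 0 < D (ψ y.1 y.2) ∧ y ∈ Ioo (-w) w ×ˢ N :=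
    (hDψ.eventually (lt_mem_nhds (show 0 < D (ψ 0 z₀) by rwa [F.zero z₀ hz₀]))).and
      ((isOpen_Ioo.prod F.isOpen).mem_nhds ⟨F.zero_mem, hz₀⟩)
  rw [nhds_prod_eq] at hev
  obtain ⟨I, hI, M, hM, hIM⟩ := mem_prod_iff.1 hev
  obtain ⟨r, hr, hrI⟩ := Metric.mem_nhds_iff.1 hI
  rw [Real.ball_eq_Ioo, zero_sub, zero_add] at hrI
  refine ⟨r, hr, fun s hs => (hIM (mk_mem_prod (hrI hs) (mem_of_mem_nhds hM))).2.1, ?_⟩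
  filter_upwards [hM] with z hz hKz hQz hB s hs
  have h0r : (0 : ℝ) ∈ Ioo (-r) r := ⟨by linarith, hr⟩
  have hzN : z ∈ N := (hIM (mk_mem_prod (hrI h0r) hz)).2.2
  let B : ℝ → ℝ := fun s => (ψ s z).1.re * (ψ s z).2.1.re + (ψ s z).1.im * (ψ s z).2.1.im
  have hBd : ∀ s ∈ Ioo (-r) r, HasDerivAt B (D (ψ s z)) s := by
    intro s hs
    have hd := (F.solution z hzN hKz).hasDerivAt s (hIM (mk_mem_prod (hrI hs) hz)).2.1
    have h1 : HasDerivAt (fun s => (ψ s z).1) ((ψ s z).2.1 / 4) s := hd.fst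
    have h2 : HasDerivAt (fun s => (ψ s z).2.1) (lcField f (ψ s z)).2.1 s := hd.snd.fst
    have h3 : HasDerivAt (fun s => (ψ s z).1.re) _ s :=
      Complex.reCLM.hasFDerivAt.comp_hasDerivAt s h1
    have h4 : HasDerivAt (fun s => (ψ s z).1.im) _ s :=
      Complex.imCLM.hasFDerivAt.comp_hasDerivAt s h1
    have h5 : HasDerivAt (fun s => (ψ s z).2.1.re) _ s :=
      Complex.reCLM.hasFDerivAt.comp_hasDerivAt s h2
    have h6 : HasDerivAt (fun s => (ψ s z).2.1.im) _ s :=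
      Complex.imCLM.hasFDerivAt.comp_hasDerivAt s h2
    refine ((h3.mul h5).add (h4.mul h6)).congr_deriv ?_
    have h7 : ((ψ s z).2.1 / 4).re = (ψ s z).2.1.re / 4 := by simp
    have h8 : ((ψ s z).2.1 / 4).im = (ψ s z).2.1.im / 4 := by simp
    simp only [Complex.reCLM_apply, Complex.imCLM_apply, h7, h8, D, Complex.normSq_apply]
    ring
  have hmono : StrictMonoOn B (Ioo (-r) r) := by
    refine strictMonoOn_of_deriv_pos (convex_Ioo _ _)
      (fun s hs => (hBd s hs).continuousAt.continuousWithinAt) fun s hs => ?_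
    rw [interior_Ioo] at hs
    rw [(hBd s hs).deriv]
    exact (hIM (mk_mem_prod (hrI hs) hz)).1
  have hB0 : B 0 = 0 := by
    simp only [B, F.zero z hzN]
    exact hB
  intro hQ
  have hBs : B s = 0 := by simp [B, hQ]
  have hs0 : s = 0 := hmono.injOn hs h0r (hBs.trans hB0.symm)
  rw [hs0, F.zero z hzN] at hQ
  exact hQz hQ

variable [hC : CompleteCoulomb S V]

/-- Trajectories with a collision are limits of trajectories without. -/
theorem LCFlow.mem_closure (F : LCFlow S V σ Z ε w N ψ) {z₀ : LCSpace} (hz₀ : z₀ ∈ N)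
    (h0 : z₀.1 = 0) (hK : lcEnergy (leviCivita V σ Z) z₀ = 0) {γ : Phase S V}
    (hγ : LCFollows σ w ψ γ z₀) :
    ∃ M ∈ 𝓝 z₀.2.2.2, ∀ u ∈ M, ∀ v ∈ M, γ u ∉ S → γ v ∉ S → state γ u ∈
      closure {y | y ∈ cotangentBundle S ∧ ∀ t ∈ uIcc 0 (v - u), Phase.traj S V y t ∉ S} := by
  obtain ⟨r, hr, hrw, hev⟩ := F.eventually_ne_zero hz₀ h0 hK
  obtain ⟨z, hz, hzev⟩ := F.chart.exists_orthogonal h0 hK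
  have h0r : (0 : ℝ) ∈ Ioo (-r) r := ⟨by linarith, hr⟩
  refine ⟨_, F.eventually_exists_time hz₀ hK (isOpen_Ioo.mem_nhds h0r), ?_⟩
  rintro _ ⟨su, hsu, hsur, rfl⟩ _ ⟨sv, hsv, hsvr, rfl⟩ hu hv
  have hQu := (F.notMem_iff hz₀ hK hγ hsu).1 hu
  have hQv := (F.notMem_iff hz₀ hK hγ hsv).1 hv
  obtain ⟨τu, hτu, hτuc, hτu0, hτuev⟩ := F.exists_section hsu hz₀ hK hQu
  obtain ⟨τv, hτv, hτvc, hτv0, hτvev⟩ := F.exists_section hsv hz₀ hK hQv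
  have hlim := hτu.continuousAt.tendsto.comp hz
  rw [hτu0, ← (hγ su hsu).2 hQu] at hlim
  refine mem_closure_of_tendsto hlim ?_
  filter_upwards [hzev, hz.eventually hev, hz.eventually hτuev, hz.eventually hτvev,
    (hτuc.continuousAt.tendsto.comp hz).eventually (isOpen_Ioo.mem_nhds (hτu0.symm ▸ hsur)),
    (hτvc.continuousAt.tendsto.comp hz).eventually (isOpen_Ioo.mem_nhds (hτv0.symm ▸ hsvr))]
    with a ⟨h1, h2, h3⟩ h4 ⟨h5, h6, h7, h8⟩ ⟨_, h9, h10, h11⟩ h12 h13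
  have hne := h4 h1 h2 h3
  obtain ⟨γa, hγa⟩ := F.exists_follows h5 h1
  have hst := (hγa _ h6).2 h7
  have huS := (F.notMem_iff h5 h1 hγa h6).2 h7
  rw [h8] at hst huS
  refine ⟨F.chart.lcDown_mem ((F.solution _ h5 h1).mem _ h6) h7, fun t ht => ?_⟩
  rw [Function.comp_apply, ← hst, Phase.traj_state huS, Phase.shift_apply]
  -- The intermediate value theorem assigns to each physical time between the two states a parameter
  -- in `(-r, r)`, where `Q` has no zero.
  have hsub : uIcc (τu (z a)) (τv (z a)) ⊆ Ioo (-r) r := ordConnected_Ioo.uIcc_subset h12 h13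
  have hcont : ContinuousOn (fun s => (ψ s (z a)).2.2.2) (uIcc (τu (z a)) (τv (z a))) :=
    fun s hs => (F.continuousAt_left (hrw (hsub hs)) h5).snd.snd.snd.continuousWithinAt
  have hmem : (ψ su z₀).2.2.2 + t ∈
      uIcc (ψ (τu (z a)) (z a)).2.2.2 (ψ (τv (z a)) (z a)).2.2.2 := by
    rw [h8, h11]
    rw [mem_uIcc] at ht ⊢
    rcases ht with ht | ht
    · exact Or.inl ⟨by linarith, by linarith⟩
    · exact Or.inr ⟨by linarith, by linarith⟩
  obtain ⟨s, hs, hst⟩ := intermediate_value_uIcc hcont hmem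
  rw [← hst]
  exact (F.notMem_iff h5 h1 hγa (hrw (hsub hs))).2 (hne s (hsub hs))

/-- A property of the flow that holds for short times, and is preserved under composition and
under limits, always holds. -/
theorem Phase.flow_induction {R : ℝ → ℂ × ℂ → Prop}
    (hadd : ∀ t u x, x ∈ flowDomain S V t → flowMap S V t x ∈ flowDomain S V u → R t x →
      R u (flowMap S V t x) → R (t + u) x)
    (hloc : ∀ x₀ ∈ cotangentBundle S, ∃ w > 0, ∀ᶠ x in 𝓝 x₀, ∀ t ∈ Ioo (-w) w, R t x)
    (hclosed : ∀ t x, x ∈ flowDomain S V t → x ∈ closure {y | y ∈ flowDomain S V t ∧ R t y} →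
      R t x) {t : ℝ} {x : ℂ × ℂ} (hx : x ∈ flowDomain S V t) : R t x := by
  have htrans : ∀ (γ : Phase S V) (u v w : ℝ), γ u ∉ S → γ v ∉ S → γ w ∉ S →
      R (v - u) (state γ u) → R (w - v) (state γ v) → R (w - u) (state γ u) := by
    intro γ u v w hu hv hw h1 h2
    have h3 : flowMap S V (v - u) (state γ u) = state γ v := by
      rw [flowMap_state hu, add_sub_cancel]
    have h4 := hadd (v - u) (w - v) (state γ u) (state_mem_flowDomain hu hv)
      (by rw [h3]; exact state_mem_flowDomain hv hw) h1 (by rwa [h3])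
    rwa [sub_add_sub_cancel'] at h4
  have hnewton : ∀ (γ : Phase S V) (t : ℝ), γ t ∉ S → ∃ M ∈ 𝓝 t, ∀ u ∈ M, ∀ v ∈ M,
      R (v - u) (state γ u) := by
    intro γ t ht
    obtain ⟨w, hw, hev⟩ := hloc (state γ t) ht
    have h3 : ContinuousAt (state γ) t := ((γ.regular t).newton ht).continuousAt
    refine ⟨_, inter_mem (h3.eventually hev) (Metric.ball_mem_nhds t (show 0 < w / 2 by linarith)),
      ?_⟩
    rintro u ⟨hu, hut⟩ v ⟨-, hvt⟩
    rw [Metric.mem_ball, Real.dist_eq, abs_lt] at hut hvt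
    exact hu _ ⟨by linarith [hut.2, hvt.1], by linarith [hut.1, hvt.2]⟩
  -- Along a collision-free piece the time interval is a connected component of the collision-free
  -- times, so only local composition is used. This case feeds the closedness argument at
  -- collisions.
  have hreg : ∀ x ∈ cotangentBundle S, ∀ t, (∀ s ∈ uIcc 0 t, traj S V x s ∉ S) → R t x := by
    intro x hx t ht
    set D : Set ℝ := {s | traj S V x s ∉ S} with hD
    have hDo : IsOpen D := hC.isClosed.isOpen_compl.preimage (traj S V x).continuous
    have h0 : (0 : ℝ) ∈ D := ht 0 left_mem_uIcc
    have hsub : uIcc 0 t ⊆ connectedComponentIn D 0 :=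
      isPreconnected_uIcc.subset_connectedComponentIn left_mem_uIcc ht
    have hcD : connectedComponentIn D 0 ⊆ D := connectedComponentIn_subset D 0
    have key := relation_of_local (J := connectedComponentIn D 0) (D := D)
      isPreconnected_connectedComponentIn hDo.connectedComponentIn
      (fun s hs => (traj S V x).eventually_notMem s)
      (R := fun u v => R (v - u) (state (traj S V x) u)) (htrans _)
      (fun s hs => by
        obtain ⟨M, hM, hM'⟩ := hnewton _ s (hcD hs)
        exact ⟨M, hM, fun u hu v hv => hM' u hu.1 v hv.1⟩)
      ⟨hsub left_mem_uIcc, h0⟩ ⟨hsub right_mem_uIcc, ht t right_mem_uIcc⟩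
    rwa [sub_zero, state_traj hx] at key
  -- For a general trajectory, near a collision time the state is a limit of states with
  -- collision-free motion between the two times, where the property is already known.
  have key := relation_of_local (J := univ) (D := {t | traj S V x t ∉ S}) isPreconnected_univ
    isOpen_univ (fun t _ => (traj S V x).eventually_notMem t)
    (R := fun u v => R (v - u) (state (traj S V x) u)) (htrans _) (fun s _ => ?_)
    (u := 0) (v := t) ⟨mem_univ _, by rw [mem_ofPred_eq, traj_zero hx.1]; exact hx.1⟩
    ⟨mem_univ _, hx.2⟩
  · rwa [sub_zero, state_traj hx.1] at key
  · by_cases hs : traj S V x s ∈ S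
    · obtain ⟨Z, ε, h⟩ := hC.exists_collisionChart hs
      obtain ⟨z₀, h0, hK, hT, w, N, ψ, F, hzN, hγ⟩ := exists_lcFlow h (γ := traj S V x) rfl
      obtain ⟨M, hM, hM'⟩ := F.mem_closure hzN h0 hK hγ
      rw [hT] at hM
      refine ⟨M, hM, fun u hu v hv => hclosed _ _ (state_mem_flowDomain hu.2 hv.2)
        (closure_mono ?_ (hM' u hu.1 v hv.1 hu.2 hv.2))⟩
      exact fun y hy => ⟨⟨hy.1, hy.2 _ right_mem_uIcc⟩, hreg y hy.1 _ hy.2⟩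
    · obtain ⟨M, hM, hM'⟩ := hnewton _ s hs
      exact ⟨M, hM, fun u hu v hv => hM' u hu.1 v hv.1⟩

end


/-! ### Symplecticity of the flow across collisions -/

theorem continuous_canonicalForm :
    Continuous fun p : (ℂ × ℂ) × ℂ × ℂ => canonicalForm p.1 p.2 := by
  unfold canonicalForm
  fun_prop

/-- The flow preserves the canonical form. -/
theorem Phase.canonicalForm_fderiv_flowMap {S : Set ℂ} {V : ℂ → ℝ} [hC : CompleteCoulomb S V]
    {t : ℝ} {x : ℂ × ℂ} (hx : x ∈ flowDomain S V t) (v v' : ℂ × ℂ) :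
    canonicalForm (fderiv ℝ (flowMap S V t) x v) (fderiv ℝ (flowMap S V t) x v') =
      canonicalForm v v' := by
  refine flow_induction (R := fun t x => ∀ v v', canonicalForm (fderiv ℝ (flowMap S V t) x v)
    (fderiv ℝ (flowMap S V t) x v') = canonicalForm v v') ?_ ?_ ?_ hx v v'
  · intro t u x h1 h2 h3 h4 v v'
    have h5 : fderiv ℝ (flowMap S V (t + u)) x =
        (fderiv ℝ (flowMap S V u) (flowMap S V t x)).comp (fderiv ℝ (flowMap S V t) x) := by
      rw [← fderiv_comp x ((contDiffAt_flowMap h2).2.differentiableAt (by simp))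
        ((contDiffAt_flowMap h1).2.differentiableAt (by simp))]
      refine EventuallyEq.fderiv_eq ?_
      filter_upwards [(contDiffAt_flowMap h1).1] with y hy
      exact (flowMap_add hy u).symm
    rw [h5, ContinuousLinearMap.comp_apply, ContinuousLinearMap.comp_apply, h4, h3]
  · intro x₀ hx₀
    obtain ⟨w, hw, N, hN, hxN, h1, h2, h3⟩ := exists_newton_flow (S := S) (V := V) hx₀
    refine ⟨w, hw, eventually_of_mem (hN.mem_nhds hxN) fun x hx t ht v v' => ?_⟩
    exact canonicalForm_fderiv_flow hC.toLocallyCoulomb hN h2 (fun y hy =>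
      ⟨flowMap_zero (h1 0 ⟨by linarith, hw⟩ hy).1, fun s hs =>
        ⟨flowMap_mem (h1 s hs hy), h3 s hs y hy⟩⟩) ht hx v v'
  · intro t x hx hcl v v'
    have h1 : ContinuousAt (fderiv ℝ (flowMap S V t)) x :=
      ((contDiffAt_flowMap hx).2.fderiv_right (m := ∞) (by simp)).continuousAt
    have h2 : ContinuousAt (fun y => canonicalForm (fderiv ℝ (flowMap S V t) y v)
        (fderiv ℝ (flowMap S V t) y v')) x :=
      continuous_canonicalForm.continuousAt.comp
        (f := fun y => (fderiv ℝ (flowMap S V t) y v, fderiv ℝ (flowMap S V t) y v'))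
        ((h1.clm_apply continuousAt_const).prodMk (h1.clm_apply continuousAt_const))
    refine tendsto_nhds_unique_of_frequently_eq h2 continuousAt_const ?_
    exact (mem_closure_iff_frequently.1 hcl).mono fun y hy => hy.2 v v'


/-! ### The manifold structure on the space of trajectories -/

namespace Phase

variable {S : Set ℂ} {V : ℂ → ℝ} [hC : CompleteCoulomb S V]

/-- Momentum and position at time `t`, as coordinates on phase space. -/
def stateEquiv (S : Set ℂ) (V : ℂ → ℝ) [CompleteCoulomb S V] (t : ℝ) :
    PartialEquiv (Phase S V) (ℂ × ℂ) where
  toFun γ := state γ t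
  invFun x := (traj S V x).shift (-t)
  source := {γ | γ t ∉ S}
  target := cotangentBundle S
  map_source' _ h := h
  map_target' x hx := by
    rw [mem_ofPred_eq, shift_apply, neg_add_cancel, traj_zero hx]
    exact hx
  left_inv' γ h := by rw [traj_state h, shift_neg_shift]
  right_inv' x hx := by rw [state_shift, neg_add_cancel, state_traj hx]

theorem stateEquiv_trans_source (t u : ℝ) :
    ((stateEquiv S V t).symm.trans (stateEquiv S V u)).source = flowDomain S V (u - t) := by
  ext x
  rw [PartialEquiv.trans_source]
  show x ∈ cotangentBundle S ∧ traj S V x (-t + u) ∉ S ↔ _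
  rw [neg_add_eq_sub]
  rfl

theorem stateEquiv_trans_apply (t u : ℝ) (x : ℂ × ℂ) :
    (stateEquiv S V t).symm.trans (stateEquiv S V u) x = flowMap S V (u - t) x := by
  show state ((traj S V x).shift (-t)) u = _
  rw [state_shift, neg_add_eq_sub, flowMap]

/-- The atlas of phase space given by the states at all times. -/
def chartedSpaceCore (S : Set ℂ) (V : ℂ → ℝ) [CompleteCoulomb S V] :
    ChartedSpaceCore (ℂ × ℂ) (Phase S V) where
  atlas := range (stateEquiv S V)
  chartAt γ := stateEquiv S V γ.exists_notMem.choose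
  mem_chart_source γ := γ.exists_notMem.choose_spec
  chart_mem_atlas γ := mem_range_self _
  open_source := by
    rintro _ _ ⟨t, rfl⟩ ⟨u, rfl⟩
    rw [stateEquiv_trans_source]
    exact isOpen_flowDomain _
  continuousOn_toFun := by
    rintro _ _ ⟨t, rfl⟩ ⟨u, rfl⟩
    rw [stateEquiv_trans_source]
    exact (contDiffOn_flowMap (u - t)).continuousOn.congr fun x _ => stateEquiv_trans_apply t u x

instance : TopologicalSpace (Phase S V) := (chartedSpaceCore S V).toTopologicalSpace

instance : ChartedSpace (ℂ × ℂ) (Phase S V) := (chartedSpaceCore S V).toChartedSpace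

/-- The chart of phase space given by the state at time `t`. -/
def stateChart (S : Set ℂ) (V : ℂ → ℝ) [CompleteCoulomb S V] (t : ℝ) :
    OpenPartialHomeomorph (Phase S V) (ℂ × ℂ) :=
  (chartedSpaceCore S V).openPartialHomeomorph (stateEquiv S V t) (mem_range_self t)

theorem stateChart_apply (t : ℝ) (γ : Phase S V) : stateChart S V t γ = state γ t := rfl

theorem stateChart_symm_apply (t : ℝ) (x : ℂ × ℂ) :
    (stateChart S V t).symm x = (traj S V x).shift (-t) := rfl

theorem mem_stateChart_source {t : ℝ} {γ : Phase S V} :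
    γ ∈ (stateChart S V t).source ↔ γ t ∉ S := Iff.rfl

theorem stateChart_mem_atlas (t : ℝ) : stateChart S V t ∈ atlas (ℂ × ℂ) (Phase S V) :=
  mem_iUnion₂.2 ⟨stateEquiv S V t, mem_range_self t, rfl⟩

theorem exists_eq_stateChart {e : OpenPartialHomeomorph (Phase S V) (ℂ × ℂ)}
    (he : e ∈ atlas (ℂ × ℂ) (Phase S V)) : ∃ t, e = stateChart S V t := by
  obtain ⟨_, ⟨t, rfl⟩, h⟩ := mem_iUnion₂.1 he
  exact ⟨t, h⟩

/-- The transition from the state at time `t` to the state at time `u` is the flow map for time `u -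
t`. -/
instance : IsManifold I4 ∞ (Phase S V) := by
  refine isManifold_of_contDiffOn I4 ∞ (Phase S V) fun e e' he he' => ?_
  obtain ⟨t, rfl⟩ := exists_eq_stateChart he
  obtain ⟨u, rfl⟩ := exists_eq_stateChart he'
  have h1 : ((stateChart S V t).symm.trans (stateChart S V u)).source = flowDomain S V (u - t) :=
    stateEquiv_trans_source t u
  rw [h1]
  simp only [modelWithCornersSelf_coe, modelWithCornersSelf_coe_symm, preimage_id, range_id,
    inter_univ, Function.comp_id, Function.id_comp]
  exact (contDiffOn_flowMap (u - t)).congr fun x _ => stateEquiv_trans_apply t u x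

theorem stateChart_mem (t : ℝ) : stateChart S V t ∈ IsManifold.maximalAtlas I4 ∞ (Phase S V) :=
  IsManifold.subset_maximalAtlas (stateChart_mem_atlas t)

theorem exists_common_time (γ δ : Phase S V) : ∃ t, γ t ∉ S ∧ δ t ∉ S :=
  ((γ.eventually_notMem 0).and (δ.eventually_notMem 0)).exists

/-- Collision times are isolated for both trajectories, so two points always share a chart and are
separated there. -/
instance : T2Space (Phase S V) := by
  refine ⟨fun γ δ hne => ?_⟩
  obtain ⟨t, h1, h2⟩ := exists_common_time γ δ
  obtain ⟨u, v, hu, hv, h3, h4, h5⟩ := t2_separation (fun h => hne (eq_of_state_eq h1 h))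
  exact ⟨_, _, (stateChart S V t).isOpen_inter_preimage hu, (stateChart S V t).isOpen_inter_preimage hv,
    ⟨h1, h3⟩, ⟨h2, h4⟩, (h5.preimage (stateChart S V t)).mono inter_subset_right inter_subset_right⟩

theorem exists_rat_notMem (γ : Phase S V) : ∃ q : ℚ, γ q ∉ S :=
  Rat.denseRange_cast.exists_mem_open (hC.isClosed.isOpen_compl.preimage γ.continuous)
    γ.exists_notMem

/-- The collision-free times of a trajectory form a nonempty open set and so contain a rational;
countably many charts cover the space. -/
instance : SecondCountableTopology (Phase S V) := by
  have h : ∀ q : ℚ, SecondCountableTopology (stateChart S V q).source := fun q =>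
    (stateChart S V q).secondCountableTopology_source
  refine TopologicalSpace.secondCountableTopology_of_countable_cover
    (fun q : ℚ => (stateChart S V q).open_source) (iUnion_eq_univ_iff.2 fun γ => ?_)
  exact γ.exists_rat_notMem

/-- A map into phase space is smooth if it is so in a chart. -/
theorem contMDiffAt_of_state {M EM HM : Type*} [NormedAddCommGroup EM] [NormedSpace ℝ EM]
    [TopologicalSpace HM] {IM : ModelWithCorners ℝ EM HM} [TopologicalSpace M] [ChartedSpace HM M]
    {g : M → Phase S V} {G : M → ℂ × ℂ} {x : M} {t : ℝ} (hx : G x ∈ cotangentBundle S)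
    (hG : ContMDiffAt IM I4 ∞ G x)
    (hg : ∀ᶠ y in 𝓝 x, G y ∈ cotangentBundle S → state (g y) t = G y) :
    ContMDiffAt IM I4 ∞ g x := by
  have h1 : ContMDiffAt I4 I4 ∞ (stateChart S V t).symm (G x) :=
    (contMDiffOn_symm_of_mem_maximalAtlas (stateChart_mem t)).contMDiffAt
      ((stateChart S V t).open_target.mem_nhds hx)
  refine (h1.comp x hG).congr_of_eventuallyEq ?_
  filter_upwards [hg, hG.continuousAt.eventually (hC.isOpen_cotangentBundle.mem_nhds hx)]
    with y h2 h3
  have h4 := h2 h3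
  rw [Function.comp_apply, ← h4, ← stateChart_apply, (stateChart S V t).left_inv]
  rw [mem_stateChart_source]
  have : (state (g y) t).2 ∉ S := by rw [h4]; exact h3
  exact this

/-- The flow of time translations is smooth. -/
theorem contMDiff_shift :
    ContMDiff (𝓘(ℝ, ℝ).prod I4) I4 ∞ (fun z : ℝ × Phase S V => z.2.shift z.1) := by
  rintro ⟨t₀, γ₀⟩
  -- In the charts at collision-free times `a` of `γ₀` and `b` of its shift, the translation is the
  -- flow map for time `t + b - a`, smooth jointly with the state.
  obtain ⟨a, ha⟩ := γ₀.exists_notMem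
  obtain ⟨b, hb⟩ := (γ₀.shift t₀).exists_notMem
  have hchart : ContMDiffAt I4 I4 ∞ (stateChart S V a) γ₀ :=
    (contMDiffOn_of_mem_maximalAtlas (stateChart_mem a)).contMDiffAt
      ((stateChart S V a).open_source.mem_nhds ha)
  have hdom : state γ₀ a ∈ flowDomain S V (t₀ + b - a) := state_mem_flowDomain ha hb
  have hpair : ContMDiffAt (𝓘(ℝ, ℝ).prod I4) 𝓘(ℝ, ℝ × ℂ × ℂ) ∞
      (fun z : ℝ × Phase S V => (z.1 + b - a, stateChart S V a z.2)) (t₀, γ₀) := by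
    have h1 : ContMDiffAt 𝓘(ℝ, ℝ) 𝓘(ℝ, ℝ) ∞ (fun t : ℝ => t + b - a) t₀ :=
      ((contDiff_id.add contDiff_const).sub contDiff_const).contMDiff.contMDiffAt
    exact ContMDiffAt.prodMk_space
      (h1.comp (f := fun z : ℝ × Phase S V => z.1) (t₀, γ₀) contMDiffAt_fst)
      (hchart.comp (f := fun z : ℝ × Phase S V => z.2) (t₀, γ₀) contMDiffAt_snd)
  obtain ⟨-, hflow⟩ := contDiffAt_flowMap_prod hdom
  have hG : ContMDiffAt (𝓘(ℝ, ℝ).prod I4) I4 ∞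
      (fun z : ℝ × Phase S V => flowMap S V (z.1 + b - a) (stateChart S V a z.2)) (t₀, γ₀) :=
    ContMDiffAt.comp (g := fun z : ℝ × ℂ × ℂ => flowMap S V z.1 z.2)
      (f := fun z : ℝ × Phase S V => (z.1 + b - a, stateChart S V a z.2)) (t₀, γ₀)
      hflow.contMDiffAt hpair
  have hsrc : ∀ᶠ z : ℝ × Phase S V in 𝓝 (t₀, γ₀), z.2 ∈ (stateChart S V a).source :=
    (continuous_snd.tendsto (t₀, γ₀)).eventually ((stateChart S V a).open_source.mem_nhds ha)
  refine contMDiffAt_of_state (t := b) (flowMap_mem hdom) hG ?_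
  filter_upwards [hsrc] with z hz _
  rw [state_shift, stateChart_apply, flowMap_state hz, ← add_sub_assoc, add_sub_cancel_left]

theorem continuous_shift : Continuous (fun z : ℝ × Phase S V => z.2.shift z.1) :=
  contMDiff_shift.continuous

/-- A trajectory in collision at time `0` is the limit of its own small time translates, which are
not. -/
theorem dense_source : Dense (stateChart S V 0).source := by
  intro γ
  have h1 : Tendsto (fun a => γ.shift a) (𝓝[≠] 0) (𝓝 γ) := by
    have h2 : Continuous fun a : ℝ => γ.shift a :=
      continuous_shift.comp (continuous_id.prodMk continuous_const)
    simpa only [shift_zero] using (h2.tendsto 0).mono_left nhdsWithin_le_nhds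
  refine mem_closure_of_tendsto h1 ?_
  filter_upwards [γ.eventually_notMem 0] with a ha
  rw [mem_stateChart_source, shift_apply, add_zero]
  exact ha

theorem energy_eventuallyEq {γ : Phase S V} {t : ℝ} (h : γ t ∉ S) :
    (energy : Phase S V → ℝ) =ᶠ[𝓝 γ] fun δ => hamiltonian V (stateChart S V t δ) := by
  filter_upwards [(stateChart S V t).open_source.mem_nhds h] with δ hδ
  exact (hamiltonian_state hδ).symm

theorem contMDiff_energy : ContMDiff I4 𝓘(ℝ, ℝ) ∞ (energy : Phase S V → ℝ) := by
  intro γ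
  obtain ⟨t, ht⟩ := γ.exists_notMem
  have hchart : ContMDiffAt I4 I4 ∞ (stateChart S V t) γ :=
    (contMDiffOn_of_mem_maximalAtlas (stateChart_mem t)).contMDiffAt
      ((stateChart S V t).open_source.mem_nhds ht)
  have hH : ContMDiffAt I4 𝓘(ℝ, ℝ) ∞ (hamiltonian V) (stateChart S V t γ) :=
    ((contDiffOn_hamiltonian hC.toLocallyCoulomb).contDiffAt
      (hC.isOpen_cotangentBundle.mem_nhds ht)).contMDiffAt
  exact (hH.comp γ hchart).congr_of_eventuallyEq (energy_eventuallyEq ht)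

end Phase


/-! ### Two-forms and symplecticity in charts -/

section Forms

/-- The alternating form `(v, w) ↦ B v w - B w v`. -/
def skewForm : ((ℂ × ℂ) →L[ℝ] (ℂ × ℂ) →L[ℝ] ℝ) →L[ℝ] (ℂ × ℂ) [⋀^Fin 2]→L[ℝ] ℝ :=
  (ContinuousAlternatingMap.alternatizeUncurryFinCLM ℝ (ℂ × ℂ) ℝ).comp
    (ContinuousLinearMap.compL ℝ (ℂ × ℂ) ((ℂ × ℂ) →L[ℝ] ℝ) ((ℂ × ℂ) [⋀^Fin 1]→L[ℝ] ℝ)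
      ((ContinuousAlternatingMap.ofSubsingletonLIE (𝕜 := ℝ) (E := ℂ × ℂ) (F := ℝ)
        (0 : Fin 1)).toContinuousLinearEquiv :
        ((ℂ × ℂ) →L[ℝ] ℝ) →L[ℝ] (ℂ × ℂ) [⋀^Fin 1]→L[ℝ] ℝ))

theorem skewForm_apply (B : (ℂ × ℂ) →L[ℝ] (ℂ × ℂ) →L[ℝ] ℝ) (m : Fin 2 → ℂ × ℂ) :
    skewForm B m = B (m 0) (m 1) - B (m 1) (m 0) := by
  show ContinuousAlternatingMap.alternatizeUncurryFin _ m = _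
  rw [ContinuousAlternatingMap.alternatizeUncurryFin_apply]
  simp [Fin.sum_univ_two, Fin.removeNth, sub_eq_add_neg]

/-- The bilinear form `(v, w) ↦ v₂ · w₁`. -/
def positionMomentum : (ℂ × ℂ) →L[ℝ] (ℂ × ℂ) →L[ℝ] ℝ :=
  ((ContinuousLinearMap.mul ℝ ℝ).bilinearComp
    (Complex.reCLM.comp (ContinuousLinearMap.snd ℝ ℂ ℂ))
    (Complex.reCLM.comp (ContinuousLinearMap.fst ℝ ℂ ℂ))) +
  ((ContinuousLinearMap.mul ℝ ℝ).bilinearComp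
    (Complex.imCLM.comp (ContinuousLinearMap.snd ℝ ℂ ℂ))
    (Complex.imCLM.comp (ContinuousLinearMap.fst ℝ ℂ ℂ)))

/-- The canonical form as an alternating map. -/
def canonicalAlt : (ℂ × ℂ) [⋀^Fin 2]→L[ℝ] ℝ := skewForm positionMomentum

theorem canonicalAlt_apply (m : Fin 2 → ℂ × ℂ) :
    canonicalAlt m = canonicalForm (m 0) (m 1) := by
  rw [canonicalAlt, skewForm_apply]
  simp [positionMomentum, canonicalForm]
  ring

/-- This displays the pullback as a fixed linear map applied to compositions with `A`, from which
its smooth dependence on `A` is read off. -/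
theorem skewForm_comp (B : (ℂ × ℂ) →L[ℝ] (ℂ × ℂ) →L[ℝ] ℝ) (A : (ℂ × ℂ) →L[ℝ] ℂ × ℂ) :
    (skewForm B).compContinuousLinearMap A =
      skewForm (((ContinuousLinearMap.compL ℝ (ℂ × ℂ) (ℂ × ℂ) ℝ).flip A).comp (B.comp A)) := by
  ext m
  rw [ContinuousAlternatingMap.compContinuousLinearMap_apply, skewForm_apply, skewForm_apply]
  rfl

theorem contDiff_canonicalAlt_comp : ContDiff ℝ ∞ fun A : (ℂ × ℂ) →L[ℝ] ℂ × ℂ =>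
    canonicalAlt.compContinuousLinearMap A := by
  simp only [canonicalAlt, skewForm_comp]
  have h1 : ContDiff ℝ ∞ fun A : (ℂ × ℂ) →L[ℝ] ℂ × ℂ =>
      (ContinuousLinearMap.compL ℝ (ℂ × ℂ) (ℂ × ℂ) ℝ).flip A :=
    ContinuousLinearMap.contDiff _
  have h2 : ContDiff ℝ ∞ fun A : (ℂ × ℂ) →L[ℝ] ℂ × ℂ => positionMomentum.comp A :=
    ContDiff.clm_comp (g := fun _ => positionMomentum) (f := fun A => A) contDiff_const contDiff_id
  exact skewForm.contDiff.comp (h1.clm_comp h2)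

theorem canonicalForm_nondegenerate {v : ℂ × ℂ} (h : ∀ w, canonicalForm v w = 0) : v = 0 := by
  have h1 := h (1, 0)
  have h2 := h (Complex.I, 0)
  have h3 := h (0, 1)
  have h4 := h (0, Complex.I)
  simp [canonicalForm] at h1 h2 h3 h4
  exact Prod.ext (Complex.ext h3 h4) (Complex.ext h1 h2)

end Forms

section

variable {P : Type} [TopologicalSpace P] [ChartedSpace (ℂ × ℂ) P]

theorem mdifferentiable_of_mem_maximalAtlas {e : OpenPartialHomeomorph P (ℂ × ℂ)}
    (he : e ∈ IsManifold.maximalAtlas I4 ∞ P) : e.MDifferentiable I4 I4 :=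
  ⟨(contMDiffOn_of_mem_maximalAtlas he).mdifferentiableOn (by simp),
    (contMDiffOn_symm_of_mem_maximalAtlas he).mdifferentiableOn (by simp)⟩

theorem contDiffOn_transition {e e' : OpenPartialHomeomorph P (ℂ × ℂ)}
    (he : e ∈ IsManifold.maximalAtlas I4 ∞ P) (he' : e' ∈ IsManifold.maximalAtlas I4 ∞ P) :
    ContDiffOn ℝ ∞ (e' ∘ e.symm) (e.target ∩ e.symm ⁻¹' e'.source) := by
  rw [← contMDiffOn_iff_contDiffOn]
  exact (contMDiffOn_of_mem_maximalAtlas he').comp ((contMDiffOn_symm_of_mem_maximalAtlas he).mono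
    inter_subset_left) inter_subset_right

theorem contDiffAt_transition {e e' : OpenPartialHomeomorph P (ℂ × ℂ)}
    (he : e ∈ IsManifold.maximalAtlas I4 ∞ P) (he' : e' ∈ IsManifold.maximalAtlas I4 ∞ P)
    {y : ℂ × ℂ} (hy : y ∈ e.target) (hy' : e.symm y ∈ e'.source) :
    ContDiffAt ℝ ∞ (e' ∘ e.symm) y :=
  (contDiffOn_transition he he').contDiffAt
    ((e.symm.isOpen_inter_preimage e'.open_source).mem_nhds ⟨hy, hy'⟩)

/-- The value of a two-form, as a form on the model space. -/
def TwoForm.val (Ω : TwoForm P) (x : P) : (ℂ × ℂ) [⋀^Fin 2]→L[ℝ] ℝ := Ω x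

theorem TwoForm.inChart_apply (Ω : TwoForm P) (e : OpenPartialHomeomorph P (ℂ × ℂ)) (y v w : ℂ × ℂ) :
    Ω.inChart e y ![v, w] = Ω (e.symm y) ![mfderiv I4 I4 e.symm y v, mfderiv I4 I4 e.symm y w] := by
  exact congrArg (Ω.val (e.symm y)) (funext fun i => by fin_cases i <;> rfl)

/-- Change of coordinates for two-forms. -/
theorem TwoForm.inChart_eq (Ω : TwoForm P) {e e' : OpenPartialHomeomorph P (ℂ × ℂ)}
    (he : e ∈ IsManifold.maximalAtlas I4 ∞ P) (he' : e' ∈ IsManifold.maximalAtlas I4 ∞ P)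
    {y : ℂ × ℂ} (hy : y ∈ e.target) (hy' : e.symm y ∈ e'.source) :
    Ω.inChart e y = (Ω.inChart e' (e' (e.symm y))).compContinuousLinearMap
      (fderiv ℝ (e' ∘ e.symm) y) := by
  have h1 : (mfderiv I4 I4 e.symm y : (ℂ × ℂ) →L[ℝ] ℂ × ℂ) =
      ContinuousLinearMap.comp (mfderiv I4 I4 e'.symm (e' (e.symm y)) : (ℂ × ℂ) →L[ℝ] ℂ × ℂ)
        (fderiv ℝ (e' ∘ e.symm) y) := by
    have h3 : e.symm =ᶠ[𝓝 y] e'.symm ∘ (e' ∘ e.symm) := by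
      filter_upwards [(e.symm.isOpen_inter_preimage e'.open_source).mem_nhds ⟨hy, hy'⟩] with z hz
      exact (e'.left_inv hz.2).symm
    have h4 : MDifferentiableAt I4 I4 (e' ∘ e.symm) y :=
      ((contDiffAt_transition he he' hy hy').differentiableAt (by simp)).mdifferentiableAt
    have h5 : MDifferentiableAt I4 I4 e'.symm ((e' ∘ e.symm) y) :=
      (mdifferentiable_of_mem_maximalAtlas he').mdifferentiableAt_symm (e'.map_source hy')
    have h6 := h3.mfderiv_eq (I := I4) (I' := I4)
    rw [mfderiv_comp y h5 h4, mfderiv_eq_fderiv] at h6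
    exact h6
  have h2 : Ω.val (e.symm y) = Ω.val (e'.symm (e' (e.symm y))) :=
    congrArg Ω.val (e'.left_inv hy').symm
  show (Ω.val (e.symm y)).compContinuousLinearMap
    (mfderiv I4 I4 e.symm y : (ℂ × ℂ) →L[ℝ] ℂ × ℂ) = _
  rw [h1, h2]
  rfl

theorem TwoForm.apply_eq_inChart (Ω : TwoForm P) {e : OpenPartialHomeomorph P (ℂ × ℂ)}
    (he : e ∈ IsManifold.maximalAtlas I4 ∞ P) {x : P} (hx : x ∈ e.source)
    (v w : TangentSpace I4 x) :
    Ω x ![v, w] = Ω.inChart e (e x) ![mfderiv I4 I4 e x v, mfderiv I4 I4 e x w] := by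
  have h1 := (mdifferentiable_of_mem_maximalAtlas he).symm_comp_deriv hx
  have h2 : ∀ v : TangentSpace I4 x, (mfderiv I4 I4 e.symm (e x) (mfderiv I4 I4 e x v) : ℂ × ℂ) = v :=
    fun v => congrArg (fun A => A v) h1
  have h3 : Ω.val x = Ω.val (e.symm (e x)) := congrArg Ω.val (e.left_inv hx).symm
  refine Eq.trans ?_ (Ω.inChart_apply e (e x) _ _).symm
  show Ω.val x ![v, w] = Ω.val (e.symm (e x))
    ![(mfderiv I4 I4 e.symm (e x) (mfderiv I4 I4 e x v) : ℂ × ℂ),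
      (mfderiv I4 I4 e.symm (e x) (mfderiv I4 I4 e x w) : ℂ × ℂ)]
  rw [h2, h2, h3]

/-- A two-form that is given by the canonical form in suitable charts is symplectic. -/
theorem isSymplecticForm_of_inChart {Ω : TwoForm P}
    (h : ∀ x : P, ∃ e ∈ IsManifold.maximalAtlas I4 ∞ P, x ∈ e.source ∧
      ∀ y ∈ e.target, Ω.inChart e y = canonicalAlt) : IsSymplecticForm Ω := by
  have key : ∀ e ∈ IsManifold.maximalAtlas I4 ∞ P, ∀ y ∈ e.target, ∃ f : ℂ × ℂ → ℂ × ℂ,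
      ContDiffAt ℝ ∞ f y ∧
        Ω.inChart e =ᶠ[𝓝 y] fun z => canonicalAlt.compContinuousLinearMap (fderiv ℝ f z) := by
    intro e he y hy
    obtain ⟨e', he', hx, hcan⟩ := h (e.symm y)
    refine ⟨e' ∘ e.symm, contDiffAt_transition he he' hy hx, ?_⟩
    filter_upwards [(e.symm.isOpen_inter_preimage e'.open_source).mem_nhds ⟨hy, hx⟩] with z hz
    rw [Ω.inChart_eq he he' hz.1 hz.2, hcan _ (e'.map_source hz.2)]
  refine ⟨fun e he y hy => ?_, fun e he y hy => ?_, fun x v hv => ?_⟩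
  · obtain ⟨f, hf, heq⟩ := key e he y hy
    refine (ContDiffAt.congr_of_eventuallyEq ?_ heq).contDiffWithinAt
    exact contDiff_canonicalAlt_comp.contDiffAt.comp y (hf.fderiv_right (m := ∞) (by simp))
  · obtain ⟨f, hf, heq⟩ := key e he y hy
    have h1 : DifferentiableAt ℝ (fun _ : ℂ × ℂ => canonicalAlt) (f y) := differentiableAt_const _
    rw [heq.extDeriv_eq, extDeriv_pullback h1 hf (by simpa using two_le_infty)]
    ext m
    simp [extDeriv, ContinuousAlternatingMap.alternatizeUncurryFin_apply]
  · obtain ⟨e, he, hx, hcan⟩ := h x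
    have h1 := (mdifferentiable_of_mem_maximalAtlas he)
    have h2 : (mfderiv I4 I4 e x v : ℂ × ℂ) = 0 := by
      refine canonicalForm_nondegenerate fun w => ?_
      have h3 : Ω.inChart e (e x) ![(mfderiv I4 I4 e x v : ℂ × ℂ),
          (mfderiv I4 I4 e x (mfderiv I4 I4 e.symm (e x) w : ℂ × ℂ) : ℂ × ℂ)] = 0 :=
        (Ω.apply_eq_inChart he hx v _).symm.trans (hv (mfderiv I4 I4 e.symm (e x) w : ℂ × ℂ))
      have h4 : (mfderiv I4 I4 e x (mfderiv I4 I4 e.symm (e x) w : ℂ × ℂ) : ℂ × ℂ) = w := by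
        have h5 := h1.comp_symm_deriv (e.map_source hx)
        have h6 : (mfderiv I4 I4 e (e.symm (e x)) (mfderiv I4 I4 e.symm (e x) w) : ℂ × ℂ) = w :=
          congrArg (fun A => A w) h5
        rw [e.left_inv hx] at h6
        exact h6
      rw [h4, hcan _ (e.map_source hx)] at h3
      exact (canonicalAlt_apply _).symm.trans h3
    have h7 : (mfderiv I4 I4 e.symm (e x) (mfderiv I4 I4 e x v) : ℂ × ℂ) = v :=
      congrArg (fun A => A v) (h1.symm_comp_deriv hx)
    have h8 : mfderiv I4 I4 e.symm (e x) (mfderiv I4 I4 e x v) = 0 :=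
      (congrArg (mfderiv I4 I4 e.symm (e x)) h2).trans (map_zero _)
    exact h7.symm.trans h8

end


/-! ### The symplectic form, the energy and the complete flow on phase space -/

theorem fderiv_hamiltonian {S : Set ℂ} {V : ℂ → ℝ} (hC : LocallyCoulomb S V) {x : ℂ × ℂ}
    (hx : x ∈ cotangentBundle S) (w : ℂ × ℂ) :
    fderiv ℝ (hamiltonian V) x w = canonicalForm (newtonField V x) w := by
  have hV : HasFDerivAt V (fderiv ℝ V x.2) x.2 :=
    ((hC.smooth.contDiffAt (hC.isClosed.isOpen_compl.mem_nhds hx)).differentiableAt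
      (by simp)).hasFDerivAt
  have hH : HasFDerivAt (hamiltonian V) (fderiv ℝ (hamiltonian V) x) (x + (0 : ℝ) • w) := by
    rw [zero_smul, add_zero]
    exact (((contDiffOn_hamiltonian hC).contDiffAt
      (hC.isOpen_cotangentBundle.mem_nhds hx)).differentiableAt (by simp)).hasFDerivAt
  have hline : HasDerivAt (fun s : ℝ => x + s • w) w 0 := by
    simpa using ((hasDerivAt_id (0 : ℝ)).smul_const w).const_add x
  have h1 : HasDerivAt (fun s : ℝ => (x + s • w).1) w.1 0 := hline.fst
  have h2 : HasDerivAt (fun s : ℝ => (x + s • w).2) w.2 0 := hline.snd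
  have hV' : HasFDerivAt V (fderiv ℝ V x.2) (x + (0 : ℝ) • w).2 := by
    rwa [zero_smul, add_zero]
  have h3 : HasDerivAt (fun s : ℝ => hamiltonian V (x + s • w)) _ 0 :=
    ((hasDerivAt_normSq h1).div_const 2).add (hV'.comp_hasDerivAt (0 : ℝ) h2)
  have h4 := HasFDerivAt.comp_hasDerivAt (0 : ℝ) hH hline
  rw [h4.unique h3, fderiv_eq_grad]
  simp [canonicalForm, newtonField]
  ring

theorem canonicalAlt_comp {A : (ℂ × ℂ) →L[ℝ] ℂ × ℂ}
    (h : ∀ v w, canonicalForm (A v) (A w) = canonicalForm v w) :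
    canonicalAlt.compContinuousLinearMap A = canonicalAlt := by
  ext m
  rw [ContinuousAlternatingMap.compContinuousLinearMap_apply, canonicalAlt_apply,
    canonicalAlt_apply]
  exact h _ _

namespace Phase

variable {S : Set ℂ} {V : ℂ → ℝ} [hC : CompleteCoulomb S V]

/-- The symplectic form of phase space. -/
def symplecticForm (S : Set ℂ) (V : ℂ → ℝ) [CompleteCoulomb S V] : TwoForm (Phase S V) :=
  -- The tangent space at a trajectory is the model space read in its preferred chart, the state at
  -- a chosen collision-free time. The form is constant in these frames, although the chosen time
  -- may vary irregularly; symplecticity of the transitions makes the choice irrelevant.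
  fun _ => canonicalAlt

/-- Read in the preferred chart at the image point, the inverse of a chart is a transition map, that
is, a flow map. -/
theorem hasMFDerivAt_stateChart_symm (t : ℝ) {y : ℂ × ℂ} (hy : y ∈ cotangentBundle S) :
    HasMFDerivAt I4 I4 (stateChart S V t).symm y (fderiv ℝ (flowMap S V
      (((stateChart S V t).symm y).exists_notMem.choose - t)) y) := by
  refine ⟨(contMDiffAt_symm_of_mem_maximalAtlas (stateChart_mem t) hy).continuousAt, ?_⟩
  have h1 : writtenInExtChartAt I4 I4 y (stateChart S V t).symm = flowMap S V
      (((stateChart S V t).symm y).exists_notMem.choose - t) :=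
    funext fun x => stateEquiv_trans_apply t _ x
  rw [h1]
  have h2 : y ∈ flowDomain S V (((stateChart S V t).symm y).exists_notMem.choose - t) := by
    refine ⟨hy, ?_⟩
    have := ((stateChart S V t).symm y).exists_notMem.choose_spec
    rwa [stateChart_symm_apply, shift_apply, neg_add_eq_sub] at this
  exact ((contDiffAt_flowMap h2).2.differentiableAt (by simp)).hasFDerivAt.hasFDerivWithinAt

/-- Flow maps are symplectic, so the form chosen in preferred frames is canonical in every chart of
states and not only in the preferred one. -/
theorem inChart_stateChart (t : ℝ) {y : ℂ × ℂ} (hy : y ∈ cotangentBundle S) :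
    (symplecticForm S V).inChart (stateChart S V t) y = canonicalAlt := by
  have h1 := (hasMFDerivAt_stateChart_symm (V := V) t hy).mfderiv
  have h2 : y ∈ flowDomain S V (((stateChart S V t).symm y).exists_notMem.choose - t) := by
    refine ⟨hy, ?_⟩
    have := ((stateChart S V t).symm y).exists_notMem.choose_spec
    rwa [stateChart_symm_apply, shift_apply, neg_add_eq_sub] at this
  exact (congrArg (fun A : (ℂ × ℂ) →L[ℝ] ℂ × ℂ => canonicalAlt.compContinuousLinearMap A)
    h1).trans (canonicalAlt_comp (canonicalForm_fderiv_flowMap h2))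

theorem isSymplecticForm : IsSymplecticForm (symplecticForm S V) :=
  isSymplecticForm_of_inChart fun γ => by
    obtain ⟨t, ht⟩ := γ.exists_notMem
    exact ⟨stateChart S V t, stateChart_mem t, ht, fun y hy => inChart_stateChart t hy⟩

/-- The Hamiltonian vector field of the energy. -/
def hamiltonianField (S : Set ℂ) (V : ℂ → ℝ) [CompleteCoulomb S V] (γ : Phase S V) :
    TangentSpace I4 γ :=
  newtonField V (state γ γ.exists_notMem.choose)

theorem hasMFDerivAt_energy (γ : Phase S V) : HasMFDerivAt I4 𝓘(ℝ, ℝ) energy γ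
    (fderiv ℝ (hamiltonian V) (state γ γ.exists_notMem.choose)) := by
  refine ⟨contMDiff_energy.continuous.continuousAt, ?_⟩
  set t := γ.exists_notMem.choose
  have ht : γ t ∉ S := γ.exists_notMem.choose_spec
  have h1 : writtenInExtChartAt I4 𝓘(ℝ, ℝ) γ energy =ᶠ[𝓝 (state γ t)] hamiltonian V := by
    filter_upwards [hC.isOpen_cotangentBundle.mem_nhds (show state γ t ∈ cotangentBundle S from ht)]
      with x hx
    show energy ((traj S V x).shift (-t)) = _
    rw [energy_shift, energy_traj hx]
  have h2 : HasFDerivAt (hamiltonian V) (fderiv ℝ (hamiltonian V) (state γ t)) (state γ t) :=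
    (((contDiffOn_hamiltonian hC.toLocallyCoulomb).contDiffAt
      (hC.isOpen_cotangentBundle.mem_nhds ht)).differentiableAt (by simp)).hasFDerivAt
  exact (h2.congr_of_eventuallyEq h1).hasFDerivWithinAt

theorem isHamiltonianField :
    IsHamiltonianField (symplecticForm S V) energy (hamiltonianField S V) := by
  intro γ w
  have h1 := (hasMFDerivAt_energy γ).mfderiv
  have h2 := fderiv_hamiltonian hC.toLocallyCoulomb (x := state γ γ.exists_notMem.choose)
    γ.exists_notMem.choose_spec w
  exact (canonicalAlt_apply _).trans (h2.symm.trans (congrArg (fun A => A w) h1).symm)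

theorem isCompleteHamiltonianFlow :
    IsCompleteHamiltonianFlow (symplecticForm S V) energy (fun t γ => γ.shift t) where
  smooth := contMDiff_shift
  zero := shift_zero
  add t u γ := by rw [shift_shift, add_comm]
  generated := by
    refine ⟨hamiltonianField S V, isHamiltonianField, fun γ t => ?_⟩
    refine ⟨(continuous_shift.comp (continuous_id.prodMk continuous_const)).continuousAt, ?_⟩
    set u := (γ.shift t).exists_notMem.choose
    have hu : γ (t + u) ∉ S := (γ.shift t).exists_notMem.choose_spec
    have h1 : HasDerivAt (state γ) (newtonField V (state γ (t + u))) (t + u) :=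
      (γ.regular (t + u)).newton hu
    have h2 : HasDerivAt (fun s => state (γ.shift s) u) (newtonField V (state (γ.shift t) u)) t := by
      simp only [state_shift]
      exact h1.comp_add_const t u
    exact h2.hasFDerivAt.hasFDerivWithinAt

end Phase


/-! ### Collisions at time zero and their parametrization by energy and direction -/

section

variable {S : Set ℂ} {V : ℂ → ℝ} {σ : ℂ} {Z ε w : ℝ} {N : Set LCSpace} {ψ : ℝ → LCSpace → LCSpace}

theorem CollisionChart.norm_sq_eq (h : CollisionChart S V σ Z ε) {P : ℂ} {E t : ℝ}
    (hK : lcEnergy (leviCivita V σ Z) (0, P, E, t) = 0) : ‖P‖ ^ 2 = 8 * Z ∧ P ≠ 0 := by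
  refine ⟨?_, h.ne_zero_of_lcEnergy hK rfl⟩
  simp only [lcEnergy, leviCivita_zero, map_zero, Complex.normSq_eq_norm_sq] at hK
  linarith

/-- A collision has a direction. -/
theorem LCFlow.tendsto_direction (F : LCFlow S V σ Z ε w N ψ) {P : ℂ} {E t : ℝ}
    (hN : ((0, P, E, t) : LCSpace) ∈ N) (hK : lcEnergy (leviCivita V σ Z) (0, P, E, t) = 0)
    {γ : ℝ → ℂ} (hγ : LCFollows σ w ψ γ (0, P, E, t)) :
    Tendsto (fun u => (γ u - σ) / ‖γ u - σ‖) (𝓝[≠] t) (𝓝 (P ^ 2 / (8 * Z : ℝ))) := by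
  set z₀ : LCSpace := (0, P, E, t) with hz₀
  obtain ⟨hP, hP0⟩ := F.chart.norm_sq_eq hK
  have hsol := F.solution z₀ hN hK
  have hcont : ContinuousOn (fun s => (ψ s z₀).2.2.2) (Ioo (-w) w) := fun s hs =>
    (F.continuousAt_left hs hN).snd.snd.snd.continuousWithinAt
  have h0 : (ψ 0 z₀).2.2.2 = t := by rw [F.zero z₀ hN]
  have hmap : 𝓝[≠] t ≤ map (fun s => (ψ s z₀).2.2.2) (𝓝[≠] 0) := by
    intro A hA
    have hA' : ∀ᶠ s in 𝓝 (0 : ℝ), s ≠ 0 → (ψ s z₀).2.2.2 ∈ A := eventually_nhdsWithin_iff.1 hA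
    have h1 := nhds_le_map_of_strictMonoOn isOpen_Ioo hcont (F.chart.strictMonoOn_time hsol)
      F.zero_mem
    rw [h0] at h1
    refine eventually_nhdsWithin_iff.2 (h1 (show ∀ᶠ s in 𝓝 (0 : ℝ), _ from ?_))
    filter_upwards [hA'] with s hs hne
    refine hs ?_
    rintro rfl
    exact hne h0
  refine Tendsto.mono_left ?_ hmap
  rw [tendsto_map'_iff]
  have hd : HasDerivAt (fun s => (ψ s z₀).1) (P / 4) 0 := by
    have h1 : HasDerivAt (fun s => (ψ s z₀).1) ((ψ 0 z₀).2.1 / 4) 0 :=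
      (hsol.hasDerivAt 0 F.zero_mem).fst
    rwa [F.zero z₀ hN] at h1
  have hsl := hd.tendsto_slope
  have hnz : P / 4 ≠ 0 := div_ne_zero hP0 (by norm_num)
  -- The direction of `q - σ` is `Q² / |Q|²`, and `Q` is `sP / 4` to first order. The square removes
  -- the sign of `s`, so the limits before and after the collision agree.
  have hlim : Tendsto (fun s => slope (fun s => (ψ s z₀).1) 0 s ^ 2 /
      ((‖slope (fun s => (ψ s z₀).1) 0 s‖ ^ 2 : ℝ) : ℂ)) (𝓝[≠] 0)
      (𝓝 ((P / 4) ^ 2 / ((‖P / 4‖ ^ 2 : ℝ) : ℂ))) := by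
    refine (hsl.pow 2).div ((Complex.continuous_ofReal.tendsto _).comp (hsl.norm.pow 2)) ?_
    exact Complex.ofReal_ne_zero.2 (pow_ne_zero 2 (norm_ne_zero_iff.2 hnz))
  have hval : (P / 4) ^ 2 / ((‖P / 4‖ ^ 2 : ℝ) : ℂ) = P ^ 2 / (8 * Z : ℝ) := by
    have h4 : ‖P / 4‖ ^ 2 = 8 * Z / 16 := by
      rw [norm_div, div_pow, hP]
      norm_num
    have hZ : (Z : ℂ) ≠ 0 := Complex.ofReal_ne_zero.2 F.chart.Z_pos.ne'
    rw [h4]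
    push_cast
    field_simp
    norm_num
  rw [hval] at hlim
  refine hlim.congr' ?_
  filter_upwards [self_mem_nhdsWithin, nhdsWithin_le_nhds (isOpen_Ioo.mem_nhds F.zero_mem)]
    with s hs hsw
  have h2 : slope (fun s => (ψ s z₀).1) 0 s = (ψ s z₀).1 / s := by
    have h3 : (ψ 0 z₀).1 = 0 := by rw [F.zero z₀ hN]
    rw [slope_def_module, h3, sub_zero, sub_zero, Complex.real_smul, div_eq_inv_mul,
      Complex.ofReal_inv]
  have hs' : (s : ℂ) ≠ 0 := Complex.ofReal_ne_zero.2 hs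
  rw [Function.comp_apply, (hγ s hsw).1, add_sub_cancel_left, h2, norm_div, norm_pow,
    Complex.norm_real, Real.norm_eq_abs, div_pow, div_pow, sq_abs]
  push_cast
  by_cases hQ : (ψ s z₀).1 = 0
  · simp [hQ]
  · have : ((‖(ψ s z₀).1‖ : ℝ) : ℂ) ≠ 0 := Complex.ofReal_ne_zero.2 (norm_ne_zero_iff.2 hQ)
    field_simp

variable [hC : CompleteCoulomb S V]

/-- At time `0`, the trajectory `γ` with energy `E` collides with `σ` in the direction `c`. -/
structure IsCollision (σ : ℂ) (E : ℝ) (c : ℂ) (γ : Phase S V) : Prop where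
  position : γ 0 = σ
  energy : γ.energy = E
  direction : Tendsto (fun u => (γ u - σ) / ‖γ u - σ‖) (𝓝[≠] 0) (𝓝 c)

theorem LCFlow.isCollision (F : LCFlow S V σ Z ε w N ψ) {P : ℂ} {E : ℝ}
    (hN : ((0, P, E, 0) : LCSpace) ∈ N) (hK : lcEnergy (leviCivita V σ Z) (0, P, E, 0) = 0)
    {γ : Phase S V} (hγ : LCFollows σ w ψ γ (0, P, E, 0)) :
    IsCollision σ E (P ^ 2 / (8 * Z : ℝ)) γ where
  position := by
    have h := (hγ 0 F.zero_mem).1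
    rw [F.zero _ hN] at h
    simpa using h
  energy := F.energy_of_follows hN hK hγ
  direction := F.tendsto_direction hN hK hγ

/-- The regularized initial value with given energy and square root of the direction. -/
def collisionPoint (Z : ℝ) (E : ℝ) (r : ℂ) : LCSpace := (0, (√(8 * Z) : ℝ) * r, E, 0)

omit hC in
theorem CollisionChart.lcEnergy_collisionPoint (h : CollisionChart S V σ Z ε) (E : ℝ) {r : ℂ}
    (hr : ‖r‖ = 1) : lcEnergy (leviCivita V σ Z) (collisionPoint Z E r) = 0 := by
  have h8 : (0 : ℝ) ≤ 8 * Z := by linarith [h.Z_pos]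
  simp only [lcEnergy, collisionPoint, leviCivita_zero, map_zero, Complex.normSq_eq_norm_sq,
    norm_mul, hr, mul_one, Complex.norm_real, Real.norm_eq_abs, sq_abs, Real.sq_sqrt h8]
  ring

omit hC in
theorem CollisionChart.direction_eq (h : CollisionChart S V σ Z ε) (r : ℂ) :
    (((√(8 * Z) : ℝ) : ℂ) * r) ^ 2 / (8 * Z : ℝ) = r ^ 2 := by
  have h8 : (0 : ℝ) < 8 * Z := by linarith [h.Z_pos]
  rw [mul_pow, ← Complex.ofReal_pow, Real.sq_sqrt h8.le,
    mul_div_cancel_left₀ _ (Complex.ofReal_ne_zero.2 h8.ne')]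

theorem norm_eq_one_of_sq {r : ℂ} {c : Circle} (h : r ^ 2 = c) : ‖r‖ = 1 := by
  have h1 : ‖r‖ ^ 2 = 1 := by rw [← norm_pow, h, Circle.norm_coe]
  exact (pow_eq_one_iff_of_nonneg (norm_nonneg r) two_ne_zero).1 h1

/-- The direction determines `P²`, hence `P` up to sign, and both signs start solutions that follow
the same trajectory. -/
theorem IsCollision.unique (hσ : σ ∈ S) {E : ℝ} {c : ℂ} {γ δ : Phase S V}
    (hγ : IsCollision σ E c γ) (hδ : IsCollision σ E c δ) : γ = δ := by
  obtain ⟨Z, ε, h⟩ := hC.exists_collisionChart hσ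
  obtain ⟨P₁, E₁, h1⟩ := Phase.exists_collision h hγ.position
  obtain ⟨P₂, E₂, h2⟩ := Phase.exists_collision h hδ.position
  obtain ⟨hK₁, hf₁⟩ := h1 P₁ (Or.inl rfl)
  obtain ⟨hK₂, hf₂⟩ := h2 P₂ (Or.inl rfl)
  obtain ⟨w₁, N₁, ψ₁, F₁, hN₁⟩ := h.exists_lcFlow (z₀ := (0, P₁, E₁, 0)) rfl
  obtain ⟨w₂, N₂, ψ₂, F₂, hN₂⟩ := h.exists_lcFlow (z₀ := (0, P₂, E₂, 0)) rfl
  have hc₁ := F₁.isCollision hN₁ hK₁ (hf₁ F₁ hN₁)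
  have hc₂ := F₂.isCollision hN₂ hK₂ (hf₂ F₂ hN₂)
  have hE : E₁ = E₂ := by rw [← hc₁.energy, ← hc₂.energy, hγ.energy, hδ.energy]
  have h8 : ((8 * Z : ℝ) : ℂ) ≠ 0 := Complex.ofReal_ne_zero.2 (by linarith [h.Z_pos])
  have hP : P₁ ^ 2 = P₂ ^ 2 := by
    have h3 := (tendsto_nhds_unique hc₁.direction hγ.direction).trans
      (tendsto_nhds_unique hc₂.direction hδ.direction).symm
    exact (div_left_inj' h8).1 h3
  have h4 := (h2 P₁ (sq_eq_sq_iff_eq_or_eq_neg.1 hP)).2 F₁ (hE ▸ hN₁)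
  subst hE
  exact F₁.follows_unique hN₁ hK₁ (hf₁ F₁ hN₁) h4

/-- Any unit direction has a square root `r`; multiplying it by `√(8Z)` puts the initial value on
the zero energy level for the prescribed `E`. -/
theorem exists_isCollision (hσ : σ ∈ S) (E : ℝ) (c : Circle) :
    ∃ γ : Phase S V, IsCollision σ E c γ := by
  obtain ⟨Z, ε, h⟩ := hC.exists_collisionChart hσ
  obtain ⟨r, hr⟩ := exists_sqrt (c : ℂ)
  have hK := h.lcEnergy_collisionPoint E (norm_eq_one_of_sq hr)
  obtain ⟨w, N, ψ, F, hN⟩ := h.exists_lcFlow (z₀ := collisionPoint Z E r) rfl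
  obtain ⟨γ, hγ⟩ := F.exists_follows hN hK
  refine ⟨γ, ?_⟩
  rw [← hr, ← h.direction_eq r]
  exact F.isCollision hN hK hγ

theorem IsCollision.exists_direction {γ : Phase S V} (h : γ 0 ∈ S) :
    ∃ c : Circle, IsCollision (γ 0) γ.energy c γ := by
  obtain ⟨Z, ε, hch⟩ := hC.exists_collisionChart h
  obtain ⟨P, E, hP⟩ := Phase.exists_collision hch (γ := γ) (t := 0) rfl
  obtain ⟨hK, hf⟩ := hP P (Or.inl rfl)
  obtain ⟨w, N, ψ, F, hN⟩ := hch.exists_lcFlow (z₀ := (0, P, E, 0)) rfl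
  have hc := F.isCollision hN hK (hf F hN)
  have h8 : (0 : ℝ) < 8 * Z := by linarith [hch.Z_pos]
  have hn : ‖P ^ 2 / ((8 * Z : ℝ) : ℂ)‖ = 1 := by
    rw [norm_div, norm_pow, (hch.norm_sq_eq hK).1, Complex.norm_real, Real.norm_of_nonneg h8.le,
      div_self h8.ne']
  exact ⟨⟨_, mem_sphere_zero_iff_norm.2 hn⟩, hc.energy ▸ hc⟩

namespace Phase

/-- The trajectory that collides with `σ` at time `0` with given energy and direction. -/
def collision (S : Set ℂ) (V : ℂ → ℝ) [CompleteCoulomb S V] (σ : S) (z : ℝ × Circle) : Phase S V :=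
  (exists_isCollision σ.2 z.1 z.2).choose

theorem isCollision_collision (σ : S) (z : ℝ × Circle) :
    IsCollision (σ : ℂ) z.1 z.2 (collision S V σ z) :=
  (exists_isCollision σ.2 z.1 z.2).choose_spec

theorem collision_injective (σ : S) : Function.Injective (collision S V σ) := by
  intro z z' h
  have h1 := isCollision_collision (V := V) σ z
  have h2 := isCollision_collision (V := V) σ z'
  rw [h] at h1
  exact Prod.ext (h1.energy.symm.trans h2.energy)
    (Subtype.ext (tendsto_nhds_unique h1.direction h2.direction))

theorem exists_collision_eq {γ : Phase S V} (h : γ 0 ∈ S) : ∃ σ z, collision S V σ z = γ := by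
  obtain ⟨c, hc⟩ := IsCollision.exists_direction h
  exact ⟨⟨γ 0, h⟩, (γ.energy, c), (isCollision_collision ⟨γ 0, h⟩ (γ.energy, c)).unique h hc⟩

/-- The position at time `0` depends continuously on the trajectory, also at collisions. -/
theorem continuous_position : Continuous fun γ : Phase S V => γ 0 := by
  rw [continuous_iff_continuousAt]
  intro γ₀
  by_cases h0 : γ₀ 0 ∈ S
  swap
  · exact ((stateChart S V 0).continuousAt (x := γ₀) h0).snd
  obtain ⟨Z, ε, h⟩ := hC.exists_collisionChart h0
  obtain ⟨z₀, hQ₀, hK₀, hT₀, w, N, ψ, F, hzN, hγ⟩ := exists_lcFlow h (γ := γ₀) rfl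
  obtain ⟨δ, hδ, hev⟩ := F.exists_time hzN hK₀
  have hsol := F.solution z₀ hzN hK₀
  have hc0 : ContinuousAt (fun s => ψ s z₀) 0 := F.continuousAt_left F.zero_mem hzN
  have hA := hc0.eventually (p := fun z => z ∈ N ∧ (lcEnergy (leviCivita V (γ₀ 0) Z) z = 0 → ∀ t,
      |t - z₀.2.2.2| < δ → ∃ s ∈ Ioo (-w) w, (ψ s z).2.2.2 = t))
      (by simpa only [F.zero z₀ hzN] using hev)
  obtain ⟨s, ⟨⟨hsN, hst⟩, hs⟩, hQ₁⟩ := (((hA.and (eventually_of_mem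
    (isOpen_Ioo.mem_nhds F.zero_mem) fun _ h => h)).filter_mono nhdsWithin_le_nhds).and
    (h.eventually_ne_zero hsol F.zero_mem)).exists
  set z₁ := ψ s z₀
  have hK₁ : lcEnergy (leviCivita V (γ₀ 0) Z) z₁ = 0 := hsol.energy s hs
  have hdown : state γ₀ z₁.2.2.2 = lcDown (γ₀ 0) z₁ := (hγ s hs).2 hQ₁
  have hfol := F.follows_of_zero hsN hK₁ hQ₁ hdown
  obtain ⟨s₁, hs₁, hT₁⟩ := hst hK₁ 0 (by rw [hT₀]; simpa using hδ)
  have hγ0 : γ₀ 0 + (ψ s₁ z₁).1 ^ 2 = γ₀ 0 := by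
    rw [← (hfol s₁ hs₁).1, hT₁]
  have hS₁ : lcDown (γ₀ 0) z₁ ∈ cotangentBundle S := h.lcDown_mem (hsol.mem s hs) hQ₁
  obtain ⟨L, hL, hL₁, -, hLev⟩ := hC.toLocallyCoulomb.exists_smooth_lift hQ₁ hK₁ hS₁ h0
  intro W hW
  have hg : ContinuousAt (fun y : ℝ × LCSpace => γ₀ 0 + (ψ y.1 y.2).1 ^ 2) (s₁, z₁) :=
    continuousAt_const.add ((F.continuousAt hs₁ hsN).fst.pow 2)
  have hgW : ∀ᶠ y : ℝ × LCSpace in 𝓝 (s₁, z₁), γ₀ 0 + (ψ y.1 y.2).1 ^ 2 ∈ W :=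
    hg.eventually (eventually_mem_set.2 (by simpa only [hγ0] using hW))
  rw [nhds_prod_eq] at hgW
  obtain ⟨A, hA, B, hB, hAB⟩ := mem_prod_iff.1 hgW
  obtain ⟨r, hr, hrA⟩ := Metric.mem_nhds_iff.1 (inter_mem hA (isOpen_Ioo.mem_nhds hs₁))
  have hball : ∀ v, |v - s₁| ≤ r / 2 → v ∈ A ∩ Ioo (-w) w := fun v hv => hrA (by
    rw [Metric.mem_ball, Real.dist_eq]
    linarith)
  have hm := (hball (s₁ - r / 2) (abs_le.2 ⟨by linarith, by linarith⟩)).2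
  have hp := (hball (s₁ + r / 2) (abs_le.2 ⟨by linarith, by linarith⟩)).2
  -- Time zero is crossed strictly between `s₁ - r / 2` and `s₁ + r / 2`, and this persists for
  -- nearby trajectories. Their position at time zero is hence `γ₀ 0 + Q²` for a parameter close to
  -- `s₁` and an initial value close to `z₁`.
  have hmono := h.strictMonoOn_time (F.solution z₁ hsN hK₁)
  have hlt1 : (ψ (s₁ - r / 2) z₁).2.2.2 < 0 := by
    rw [← hT₁]
    exact hmono hm hs₁ (by linarith)
  have hlt2 : 0 < (ψ (s₁ + r / 2) z₁).2.2.2 := by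
    rw [← hT₁]
    exact hmono hs₁ hp (by linarith)
  have hLt : Tendsto (fun γ : Phase S V => L (state γ z₁.2.2.2)) (𝓝 γ₀) (𝓝 z₁) := by
    have h1 : Tendsto (stateChart S V z₁.2.2.2) (𝓝 γ₀) (𝓝 (lcDown (γ₀ 0) z₁)) := by
      rw [← hdown]
      refine (stateChart S V z₁.2.2.2).continuousAt ?_
      have : (state γ₀ z₁.2.2.2).2 ∉ S := by rw [hdown]; exact hS₁
      exact this
    have h2 := hL.continuousAt.tendsto.comp h1
    rw [hL₁] at h2
    exact h2
  have hst : Tendsto (fun γ : Phase S V => state γ z₁.2.2.2) (𝓝 γ₀) (𝓝 (lcDown (γ₀ 0) z₁)) := by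
    rw [← hdown]
    refine (stateChart S V z₁.2.2.2).continuousAt ?_
    have : (state γ₀ z₁.2.2.2).2 ∉ S := by rw [hdown]; exact hS₁
    exact this
  refine (?_ : ∀ᶠ γ : Phase S V in 𝓝 γ₀, γ 0 ∈ W)
  filter_upwards [hLt.eventually (eventually_mem_set.2 hB), hLt.eventually (eventually_mem_set.2 (F.isOpen.mem_nhds hsN)), hst.eventually hLev,
    hLt.eventually ((F.continuousAt_right hm hsN).snd.snd.snd.eventually (gt_mem_nhds hlt1)),
    hLt.eventually ((F.continuousAt_right hp hsN).snd.snd.snd.eventually (lt_mem_nhds hlt2))]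
    with γ h1 h2 ⟨h3, h4, h5, h6⟩ h7 h8
  have hfolγ := F.follows_of_zero (γ := γ) h2 h3 h6 (by rw [h5, h4])
  have hmem : ∀ v ∈ Icc (s₁ - r / 2) (s₁ + r / 2), v ∈ A ∩ Ioo (-w) w := fun v hv =>
    hball v (abs_le.2 ⟨by linarith [hv.1], by linarith [hv.2]⟩)
  have hcont : ContinuousOn (fun s => (ψ s (L (state γ z₁.2.2.2))).2.2.2)
      (Icc (s₁ - r / 2) (s₁ + r / 2)) := fun v hv =>
    (F.continuousAt_left (hmem v hv).2 h2).snd.snd.snd.continuousWithinAt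
  obtain ⟨v, hv, hv0⟩ := intermediate_value_Icc (by linarith) hcont
    (show (0 : ℝ) ∈ Icc _ _ from ⟨h7.le, h8.le⟩)
  have h9 := (hfolγ v (hmem v hv).2).1
  simp only at hv0
  rw [hv0] at h9
  show γ 0 ∈ W
  rw [h9]
  exact hAB (mk_mem_prod (hmem v hv).1 h1)

end Phase

/-- The regularized phase space as an extension of the cotangent bundle. -/
def phaseExtension (S : Set ℂ) (V : ℂ → ℝ) [CompleteCoulomb S V] : Extension S V where
  P := Phase S V
  coord := Phase.stateChart S V 0
  coord_mem := Phase.stateChart_mem 0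
  coord_target := rfl
  dense_source := Phase.dense_source
  proj γ := γ 0
  proj_continuous := Phase.continuous_position
  proj_coord _ _ := rfl
  cyl := Phase.collision S V
  cyl_injective := Phase.collision_injective
  proj_cyl σ z := (Phase.isCollision_collision σ z).position
  cyl_cover γ h := Phase.exists_collision_eq (not_not.1 h)
  Ω := Phase.symplecticForm S V
  symplectic := Phase.isSymplecticForm
  form_coord y hy v w := by
    rw [Phase.inChart_stateChart 0 hy, canonicalAlt_apply]
    rfl
  H := Phase.energy
  H_smooth := Phase.contMDiff_energy
  H_coord y hy := by
    rw [Phase.stateChart_symm_apply, Phase.energy_shift, Phase.energy_traj hy]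

end


/-! ### Regular level sets and energy shells -/

/-- Composing a chart of a manifold with a local diffeomorphism of the model gives a chart. -/
theorem trans_mem_maximalAtlas {E : Type*} [NormedAddCommGroup E] [NormedSpace ℝ E] {P : Type*}
    [TopologicalSpace P] [ChartedSpace E P] [IsManifold 𝓘(ℝ, E) ∞ P] {e : OpenPartialHomeomorph P E}
    (he : e ∈ IsManifold.maximalAtlas 𝓘(ℝ, E) ∞ P) {g : OpenPartialHomeomorph E E}
    (hg : ContDiffOn ℝ ∞ g g.source) (hg' : ContDiffOn ℝ ∞ g.symm g.target) :
    e.trans g ∈ IsManifold.maximalAtlas 𝓘(ℝ, E) ∞ P := by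
  refine OpenPartialHomeomorph.mem_maximalAtlas_of_contMDiffOn _ ?_ ?_
  · exact hg.contMDiffOn.comp ((contMDiffOn_of_mem_maximalAtlas he).mono fun x hx => hx.1)
      fun x hx => hx.2
  · exact (contMDiffOn_symm_of_mem_maximalAtlas he).comp (hg'.contMDiffOn.mono fun x hx => hx.1)
      fun x hx => hx.2

/-- A regular level set of a function on a vector space is locally flat. -/
theorem exists_straightening {h : ℂ × ℂ → ℝ} {U : Set (ℂ × ℂ)} (hU : IsOpen U)
    (hh : ContDiffOn ℝ ∞ h U) {y₀ : ℂ × ℂ} (hy₀ : y₀ ∈ U) (hd : fderiv ℝ h y₀ ≠ 0) :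
    ∃ g : OpenPartialHomeomorph (ℂ × ℂ) (ℂ × ℂ), y₀ ∈ g.source ∧ g.source ⊆ U ∧
      ContDiffOn ℝ ∞ g g.source ∧ ContDiffOn ℝ ∞ g.symm g.target ∧
      ∃ W : Submodule ℝ (ℂ × ℂ), Module.finrank ℝ W = 3 ∧ ∀ y, g y ∈ W ↔ h y = h y₀ := by
  set L : (ℂ × ℂ) →L[ℝ] ℝ := fderiv ℝ h y₀ with hL
  obtain ⟨v₀, hv₀⟩ : ∃ v, L v ≠ 0 := by
    by_contra! hcon
    exact hd (ContinuousLinearMap.ext hcon)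
  obtain ⟨v, hv⟩ : ∃ v, L v = 1 := ⟨(L v₀)⁻¹ • v₀, by simp [hv₀]⟩
  -- The derivative of this map at `y₀` is the identity, and `L v = 1` makes `L` of its value equal
  -- to `h y - h y₀`: the level set becomes the kernel of `L`.
  have hsmooth : ContDiffOn ℝ ∞ (fun y => y - y₀ + (h y - h y₀ - L (y - y₀)) • v) U :=
    (contDiffOn_id.sub contDiffOn_const).add (((hh.sub contDiffOn_const).sub
      (L.contDiff.comp_contDiffOn (contDiffOn_id.sub contDiffOn_const))).smul contDiffOn_const)
  have hder : HasFDerivAt (fun y => y - y₀ + (h y - h y₀ - L (y - y₀)) • v)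
      (ContinuousLinearEquiv.refl ℝ (ℂ × ℂ) : (ℂ × ℂ) →L[ℝ] ℂ × ℂ) y₀ := by
    have h1 : HasFDerivAt h L y₀ :=
      ((hh.contDiffAt (hU.mem_nhds hy₀)).differentiableAt (by simp)).hasFDerivAt
    have h2 : HasFDerivAt (fun y : ℂ × ℂ => y - y₀) (.id ℝ (ℂ × ℂ)) y₀ :=
      (hasFDerivAt_id y₀).sub_const y₀
    have h3 := h2.add (((h1.sub_const (h y₀)).sub (L.hasFDerivAt.comp y₀ h2)).smul_const v)
    refine h3.congr_fderiv ?_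
    ext w <;> simp
  obtain ⟨g, hg1, hg2, hg3, hg4⟩ := exists_smooth_localInverse hU hsmooth hy₀ _ hder
  refine ⟨g, hg1, hg2, (hsmooth.mono hg2).congr fun y _ => hg3 y, hg4, LinearMap.ker (L : (ℂ × ℂ) →ₗ[ℝ] ℝ), ?_,
    fun y => ?_⟩
  · have h1 := Module.Dual.finrank_ker_add_one_of_ne_zero (f := (L : (ℂ × ℂ) →ₗ[ℝ] ℝ))
      (fun h0 => hv₀ (by rw [← ContinuousLinearMap.coe_coe, h0]; rfl))
    have h2 : Module.finrank ℝ (ℂ × ℂ) = 4 := by simp [Module.finrank_prod]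
    omega
  · rw [LinearMap.mem_ker, hg3 y, ContinuousLinearMap.coe_coe, map_add, map_smul, hv]
    simp [sub_eq_zero]

/-- A critical point of the Hamiltonian has zero momentum and lies over a critical point of `V` of
the same value. -/
theorem fderiv_hamiltonian_ne_zero {S : Set ℂ} {V : ℂ → ℝ} (hC : LocallyCoulomb S V)
    {x : ℂ × ℂ} (hx : x ∈ cotangentBundle S) (hV : IsRegularValue S V (hamiltonian V x)) :
    fderiv ℝ (hamiltonian V) x ≠ 0 := by
  intro h0
  have h1 : newtonField V x = 0 := canonicalForm_nondegenerate fun w => by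
    rw [← fderiv_hamiltonian hC hx, h0]
    rfl
  have h2 : x.1 = 0 := congrArg Prod.snd h1
  have h3 : -grad V x.2 = 0 := congrArg Prod.fst h1
  have h4 : V x.2 = hamiltonian V x := by simp [hamiltonian, h2]
  obtain ⟨v, hv⟩ := hV x.2 hx h4 1
  rw [fderiv_eq_grad, neg_eq_zero.1 h3] at hv
  simp at hv

namespace Phase

variable {S : Set ℂ} {V : ℂ → ℝ} [hC : CompleteCoulomb S V]

/-- Collision points need no separate treatment: a chart at a collision-free time presents the shell
as a regular level set of the Hamiltonian on the cotangent bundle. -/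
theorem isEmbeddedSubmanifold_energyShell {E : ℝ} (hE : IsRegularValue S V E) :
    IsEmbeddedSubmanifold 3 ((phaseExtension S V).energyShell E) := by
  intro γ hγ
  replace hγ : energy (γ : Phase S V) = E := hγ
  obtain ⟨t, ht⟩ := exists_notMem (V := V) γ
  have hst : hamiltonian V (state (Phase.toFun γ) t) = E := (hamiltonian_state ht).trans hγ
  obtain ⟨g, hg1, hg2, hg3, hg4, W, hW, hgW⟩ := exists_straightening hC.isOpen_cotangentBundle
    (contDiffOn_hamiltonian hC.toLocallyCoulomb) (y₀ := state (Phase.toFun γ) t) ht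
    (fderiv_hamiltonian_ne_zero hC.toLocallyCoulomb ht (hst ▸ hE))
  refine ⟨(stateChart S V t).trans g, trans_mem_maximalAtlas (stateChart_mem t) hg3 hg4, ⟨ht, hg1⟩,
    W, hW, ?_⟩
  have himg : ((stateChart S V t).trans g).IsImage
      ((phaseExtension S V).energyShell E) W := by
    intro δ hδ
    refine (hgW (state (Phase.toFun δ) t)).trans ?_
    rw [hst, hamiltonian_state hδ.1]
    rfl
  exact himg.image_eq

end Phase


/-! ### Immersions of surfaces from injective derivatives -/

/-- An injective linear map into `ℂ × ℂ` from a plane extends to a linear equivalence. -/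
theorem exists_linearEquiv_coprod {E : Type*} [NormedAddCommGroup E] [NormedSpace ℝ E]
    [FiniteDimensional ℝ E] (hE : Module.finrank ℝ E = 2) {A : E →L[ℝ] ℂ × ℂ}
    (hA : Function.Injective A) :
    ∃ (B : ℂ →L[ℝ] ℂ × ℂ) (C : (E × ℂ) ≃L[ℝ] ℂ × ℂ), ∀ x y, C (x, y) = A x + B y := by
  obtain ⟨W, hW⟩ := Submodule.exists_isCompl (LinearMap.range (A : E →ₗ[ℝ] ℂ × ℂ))
  have h1 : Module.finrank ℝ (LinearMap.range (A : E →ₗ[ℝ] ℂ × ℂ)) = 2 := by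
    rw [LinearMap.finrank_range_of_inj hA, hE]
  have h2 := Submodule.finrank_add_eq_of_isCompl hW
  have h4 : Module.finrank ℝ (ℂ × ℂ) = 4 := by simp [Module.finrank_prod]
  have h3 : Module.finrank ℝ ℂ = Module.finrank ℝ W := by
    rw [Complex.finrank_real_complex]
    omega
  let β : ℂ ≃ₗ[ℝ] W := LinearEquiv.ofFinrankEq ℂ W h3
  let B : ℂ →L[ℝ] ℂ × ℂ := LinearMap.toContinuousLinearMap (W.subtype ∘ₗ (β : ℂ →ₗ[ℝ] W))
  have hinj : Function.Injective ((A.coprod B : (E × ℂ) →L[ℝ] ℂ × ℂ) : (E × ℂ) →ₗ[ℝ] ℂ × ℂ) := by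
    refine (injective_iff_map_eq_zero _).2 ?_
    rintro ⟨x, y⟩ hxy
    have h5 : A x + (β y : ℂ × ℂ) = 0 := hxy
    have h6 : A x ∈ LinearMap.range (A : E →ₗ[ℝ] ℂ × ℂ) ⊓ W :=
      ⟨⟨x, rfl⟩, by rw [eq_neg_of_add_eq_zero_left h5]; exact W.neg_mem (β y).2⟩
    rw [hW.inf_eq_bot, Submodule.mem_bot] at h6
    rw [h6, zero_add] at h5
    have h7 : x = 0 := hA (h6.trans (map_zero A).symm)
    have h8 : y = 0 := β.injective ((Subtype.ext h5).trans (map_zero β).symm)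
    rw [h7, h8]
    rfl
  have hdim : Module.finrank ℝ (E × ℂ) = Module.finrank ℝ (ℂ × ℂ) := by
    rw [Module.finrank_prod, hE, h4, Complex.finrank_real_complex]
  exact ⟨B, (LinearEquiv.ofInjectiveOfFinrankEq _ hinj hdim).toContinuousLinearEquiv,
    fun x y => rfl⟩

/-- A smooth map from a surface to a four-dimensional manifold whose derivative is injective is
an immersion. -/
theorem isImmersionAtOfComplement_of_injective {E H : Type*} [NormedAddCommGroup E]
    [NormedSpace ℝ E] [FiniteDimensional ℝ E] [TopologicalSpace H] {I : ModelWithCorners ℝ E H}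
    [I.Boundaryless] (hE : Module.finrank ℝ E = 2) {M : Type*} [TopologicalSpace M]
    [ChartedSpace H M] [IsManifold I ∞ M] {P : Type*} [TopologicalSpace P]
    [ChartedSpace (ℂ × ℂ) P] [IsManifold I4 ∞ P] {f : M → P} (hf : ContMDiff I I4 ∞ f) (x : M)
    (hinj : Function.Injective (mfderiv I I4 f x)) : IsImmersionAtOfComplement ℂ I I4 ∞ f x := by
  set d := chartAt H x
  set e := chartAt (ℂ × ℂ) (f x)
  set g : E → ℂ × ℂ := writtenInExtChartAt I I4 x f with hg
  set x₀ : E := extChartAt I x x with hx₀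
  set U : Set E := (extChartAt I x).target ∩ (extChartAt I x).symm ⁻¹' (f ⁻¹' e.source) with hUdef
  have hU : IsOpen U := (continuousOn_extChartAt_symm x).isOpen_inter_preimage
    (isOpen_extChartAt_target x) (e.open_source.preimage hf.continuous)
  have hx₀U : x₀ ∈ U := by
    refine ⟨mem_extChartAt_target x, ?_⟩
    rw [mem_preimage, hx₀, extChartAt_to_inv]
    exact mem_chart_source _ _
  have hgU : ContDiffOn ℝ ∞ g U := by
    have h1 := ((contMDiff_iff.1 hf).2 x (f x))
    refine h1.mono fun y hy => ⟨hy.1, ?_⟩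
    rw [mem_preimage, mem_preimage, extChartAt_source]
    exact hy.2
  have hder : mfderiv I I4 f x = fderiv ℝ g x₀ := by
    rw [(hf.mdifferentiable (by simp) x).mfderiv, I.range_eq_univ, fderivWithin_univ]
  obtain ⟨B, C, hC⟩ := exists_linearEquiv_coprod hE (A := fderiv ℝ g x₀) (hder ▸ hinj)
  have hG : ContDiffOn ℝ ∞ (fun z : E × ℂ => g z.1 + B z.2) (U ×ˢ univ) :=
    (hgU.comp contDiffOn_fst fun z hz => hz.1).add (B.contDiff.comp contDiff_snd).contDiffOn
  have hG' : HasFDerivAt (fun z : E × ℂ => g z.1 + B z.2) (C : (E × ℂ) →L[ℝ] ℂ × ℂ) (x₀, 0) := by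
    have h1 : HasFDerivAt g (fderiv ℝ g x₀) ((x₀, (0 : ℂ)) : E × ℂ).1 :=
      ((hgU.contDiffAt (hU.mem_nhds hx₀U)).differentiableAt (by simp)).hasFDerivAt
    have h2 := (h1.comp ((x₀, (0 : ℂ)) : E × ℂ) hasFDerivAt_fst).add
      (B.hasFDerivAt.comp ((x₀, (0 : ℂ)) : E × ℂ) hasFDerivAt_snd)
    refine h2.congr_fderiv (ContinuousLinearMap.ext fun z => ?_)
    exact (hC z.1 z.2).symm
  obtain ⟨k, hk1, hk2, hk3, hk4⟩ := exists_smooth_localInverse (hU.prod isOpen_univ) hG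
    (x := (x₀, 0)) ⟨hx₀U, mem_univ _⟩ C hG'
  -- `k` extends the surface to a local diffeomorphism by adding complementary directions. Undoing
  -- `k` and applying `C` presents the surface as `u ↦ C (u, 0)`, the normal form of an immersion.
  let k' : OpenPartialHomeomorph (ℂ × ℂ) (ℂ × ℂ) :=
    k.symm.trans C.toHomeomorph.toOpenPartialHomeomorph
  have hk's : k'.source = k.target := by simp [k']
  have hgx : ∀ y ∈ U, e.symm (g y) = f ((extChartAt I x).symm y) := fun y hy => by
    have : g y = e (f ((extChartAt I x).symm y)) := by
      rw [hg, writtenInExtChartAt]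
      simp [e]
    rw [this]
    exact e.left_inv hy.2
  have hk'1 : ContDiffOn ℝ ∞ k' k'.source := by
    rw [hk's]
    exact C.contDiff.comp_contDiffOn hk4
  have hk'2 : ContDiffOn ℝ ∞ k'.symm k'.target := by
    have h1 : ContDiffOn ℝ ∞ k k.source := (hG.mono hk2).congr fun z _ => hk3 z
    refine h1.comp C.symm.contDiff.contDiffOn fun z hz => ?_
    exact hz.2
  set W : Set M := {y | (extChartAt I x y, (0 : ℂ)) ∈ k.source} ∩ d.source with hW
  have hWo : IsOpen W := by
    rw [hW, inter_comm]
    have h1 : ContinuousOn (fun y => (extChartAt I x y, (0 : ℂ))) d.source := by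
      have h2 := continuousOn_extChartAt (I := I) x
      rw [extChartAt_source] at h2
      exact h2.prodMk continuousOn_const
    exact h1.isOpen_inter_preimage d.open_source k.open_source
  have hmem : ∀ y ∈ W, g (extChartAt I x y) = e (f y) ∧ f y ∈ e.source ∧
      k.symm (e (f y)) = (extChartAt I x y, 0) ∧ e (f y) ∈ k.target := by
    intro y hy
    have hyd : y ∈ (extChartAt I x).source := by rw [extChartAt_source]; exact hy.2
    have h1 : extChartAt I x y ∈ U := (hk2 hy.1).1
    have h2 : g (extChartAt I x y) = e (f y) := by
      have h3 : g (extChartAt I x y) = e (f ((extChartAt I x).symm (extChartAt I x y))) := by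
        rw [hg, writtenInExtChartAt]
        simp [e]
      rwa [(extChartAt I x).left_inv hyd] at h3
    have h3 : k (extChartAt I x y, 0) = e (f y) := by
      rw [hk3, map_zero, add_zero, h2]
    have h4 : f y ∈ e.source := by
      have := h1.2
      rwa [mem_preimage, mem_preimage, (extChartAt I x).left_inv hyd] at this
    exact ⟨h2, h4, by rw [← h3, k.left_inv hy.1], by rw [← h3]; exact k.map_source hy.1⟩
  have hxW : x ∈ W := ⟨hk1, mem_chart_source _ _⟩
  refine IsImmersionAtOfComplement.mk_of_continuousAt hf.continuous.continuousAt C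
    (d.restrOpen W hWo) (e.trans k') ⟨mem_chart_source _ _, hxW⟩ ⟨(hmem x hxW).2.1, ?_⟩ ?_ ?_ ?_
  · rw [mem_preimage, hk's]
    exact (hmem x hxW).2.2.2
  · have h1 := restr_mem_maximalAtlas (contDiffGroupoid ∞ I)
      (IsManifold.chart_mem_maximalAtlas (I := I) (n := ∞) x) hWo
    have h2 : d.restr W = d.restrOpen W hWo := by
      simp only [OpenPartialHomeomorph.restr, hWo.interior_eq]
    rwa [h2] at h1
  · exact trans_mem_maximalAtlas (IsManifold.chart_mem_maximalAtlas (f x)) hk'1 hk'2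
  · intro z hz
    obtain ⟨y, hy, rfl⟩ : ∃ y ∈ ((d.restrOpen W hWo).extend I).source,
        (d.restrOpen W hWo).extend I y = z :=
      ⟨_, ((d.restrOpen W hWo).extend I).map_target hz, ((d.restrOpen W hWo).extend I).right_inv hz⟩
    have hyW : y ∈ W := by
      rw [OpenPartialHomeomorph.extend_source] at hy
      exact hy.2
    have h2 := hmem y hyW
    simp only [Function.comp_apply]
    rw [((d.restrOpen W hWo).extend I).left_inv hy]
    show C (k.symm (e (f y))) = C (extChartAt I x y, 0)
    rw [h2.2.2.1]

/-- Operators close to an injective one are injective. -/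
theorem eventually_injective {E F : Type*} [NormedAddCommGroup E] [NormedSpace ℝ E]
    [FiniteDimensional ℝ E] [NormedAddCommGroup F] [NormedSpace ℝ F] [FiniteDimensional ℝ F]
    {A : E →L[ℝ] F} (hA : Function.Injective A) : ∀ᶠ B : E →L[ℝ] F in 𝓝 A, Function.Injective B := by
  obtain ⟨L, hL⟩ := LinearMap.exists_leftInverse_of_injective (A : E →ₗ[ℝ] F)
    (LinearMap.ker_eq_bot.2 hA)
  let L' : F →L[ℝ] E := LinearMap.toContinuousLinearMap L
  have h1 : L' ∘L A = (1 : E →L[ℝ] E) := ContinuousLinearMap.ext fun x => LinearMap.congr_fun hL x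
  have h2 : Continuous fun B : E →L[ℝ] F => L' ∘L B := continuous_const.clm_comp continuous_id
  have h3 : ∀ᶠ T : E →L[ℝ] E in 𝓝 (L' ∘L A), IsUnit T := by
    rw [h1]
    exact Units.isOpen.mem_nhds isUnit_one
  filter_upwards [h2.continuousAt.eventually h3] with B hB x y hxy
  obtain ⟨T, hT⟩ := hB
  have h4 : ∀ z, (↑T⁻¹ : E →L[ℝ] E) (L' (B z)) = z := fun z => by
    have h5 : (↑T⁻¹ : E →L[ℝ] E) * (L' ∘L B) = 1 := by rw [← hT, Units.inv_mul]
    exact congrArg (fun A : E →L[ℝ] E => A z) h5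
  rw [← h4 x, hxy, h4]


/-! ### Regular parametrization of collisions in Levi-Civita coordinates -/

section

variable {S : Set ℂ} {V : ℂ → ℝ} {σ : ℂ} {Z ε w : ℝ} {N : Set LCSpace} {ψ : ℝ → LCSpace → LCSpace}

/-- The Levi-Civita flow moves an injectively parametrized family of collisions to an injectively
parametrized family of points. -/
theorem LCFlow.eventually_injective (F : LCFlow S V σ Z ε w N ψ) {z₁ : LCSpace} (hz₁ : z₁ ∈ N)
    (h0 : z₁.1 = 0) (hK : lcEnergy (leviCivita V σ Z) z₁ = 0) {E : Type*} [NormedAddCommGroup E]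
    [NormedSpace ℝ E] [FiniteDimensional ℝ E] {k : E →L[ℝ] LCSpace} (hk : Function.Injective k)
    (hk0 : ∀ v, (k v).1 = 0) :
    ∀ᶠ s in 𝓝 (0 : ℝ), Function.Injective ((fderiv ℝ (fun y : ℝ × LCSpace => ψ y.1 y.2) (s, z₁)).comp
      ((ContinuousLinearMap.fst ℝ ℝ E).prod (k.comp (ContinuousLinearMap.snd ℝ ℝ E)))) := by
  set D := fderiv ℝ (fun y : ℝ × LCSpace => ψ y.1 y.2)
  have hO : IsOpen (Ioo (-w) w ×ˢ N) := isOpen_Ioo.prod F.isOpen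
  have hmem : ((0 : ℝ), z₁) ∈ Ioo (-w) w ×ˢ N := ⟨F.zero_mem, hz₁⟩
  have hD : HasFDerivAt (fun y : ℝ × LCSpace => ψ y.1 y.2) (D (0, z₁)) (0, z₁) :=
    ((F.smooth.contDiffAt (hO.mem_nhds hmem)).differentiableAt (by simp)).hasFDerivAt
  have hX : D (0, z₁) (1, 0) = lcField (leviCivita V σ Z) z₁ := by
    have h1 : HasDerivAt (fun s : ℝ => (s, z₁)) ((1 : ℝ), (0 : LCSpace)) 0 :=
      (hasDerivAt_id (0 : ℝ)).prodMk (hasDerivAt_const (0 : ℝ) z₁)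
    have h2 := HasFDerivAt.comp_hasDerivAt (0 : ℝ) hD h1
    have h3 := (F.solution z₁ hz₁ hK).hasDerivAt 0 F.zero_mem
    rw [F.zero z₁ hz₁] at h3
    exact h2.unique h3
  have hI : ∀ v : LCSpace, D (0, z₁) (0, v) = v := by
    intro v
    have h1 : HasFDerivAt (fun z : LCSpace => ((0 : ℝ), z))
        ((0 : LCSpace →L[ℝ] ℝ).prod (.id ℝ LCSpace)) z₁ :=
      (hasFDerivAt_const (0 : ℝ) z₁).prodMk (hasFDerivAt_id z₁)
    have h2 := hD.comp z₁ h1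
    have h3 : HasFDerivAt (fun z : LCSpace => ψ 0 z) (.id ℝ LCSpace) z₁ :=
      (hasFDerivAt_id z₁).congr_of_eventuallyEq
        (eventually_of_mem (F.isOpen.mem_nhds hz₁) fun z hz => F.zero z hz)
    exact congrArg (fun A : LCSpace →L[ℝ] LCSpace => A v) (h2.unique h3)
  have hcont : ContinuousAt (fun s : ℝ => (D (s, z₁)).comp
      ((ContinuousLinearMap.fst ℝ ℝ E).prod (k.comp (ContinuousLinearMap.snd ℝ ℝ E)))) 0 := by
    have h1 : ContinuousAt D (0, z₁) :=
      (F.smooth.continuousOn_fderiv_of_isOpen hO (by simp)).continuousAt (hO.mem_nhds hmem)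
    have h2 : ContinuousAt (fun s : ℝ => D (s, z₁)) 0 :=
      ContinuousAt.comp (f := fun s : ℝ => (s, z₁)) h1 (by fun_prop)
    exact h2.clm_comp continuousAt_const
  -- At `s = 0` the derivative in `s` has `Q`-component `P / 4 ≠ 0`, while that in the initial value
  -- is the identity on vectors with zero `Q`-component. The map is thus injective there, and
  -- injectivity is an open condition.
  refine hcont.eventually (CoulombRegularization.eventually_injective ?_)
  refine (injective_iff_map_eq_zero _).2 ?_
  rintro ⟨a, v⟩ hav
  have h1 : D (0, z₁) (a, k v) = 0 := hav
  have h2 : ((a, k v) : ℝ × LCSpace) = a • ((1 : ℝ), (0 : LCSpace)) + (0, k v) := by simp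
  rw [h2, map_add, map_smul, hX, hI] at h1
  have h3 : a • (z₁.2.1 / 4) + (k v).1 = 0 := congrArg Prod.fst h1
  rw [hk0, add_zero] at h3
  have h4 : a = 0 := (smul_eq_zero.1 h3).resolve_right
    (div_ne_zero (F.chart.ne_zero_of_lcEnergy hK h0) (by norm_num))
  rw [h4, zero_smul, zero_add] at h1
  rw [h4, hk (h1.trans (map_zero k).symm)]
  rfl

/-- The regularized initial values of collisions, as a function of energy and direction. -/
theorem CollisionChart.exists_initial (h : CollisionChart S V σ Z ε) (E₀ : ℝ) (c₀ : Circle) :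
    ∃ (K : ℝ × ℂ → LCSpace) (r : ℂ), ContDiffAt ℝ ∞ K (E₀, (c₀ : ℂ)) ∧
      K (E₀, (c₀ : ℂ)) = collisionPoint Z E₀ r ∧ r ^ 2 = c₀ ∧
      Function.Injective (fderiv ℝ K (E₀, (c₀ : ℂ))) ∧
      (∀ v, (fderiv ℝ K (E₀, (c₀ : ℂ)) v).1 = 0) ∧
      ∀ᶠ y in 𝓝 ((E₀, (c₀ : ℂ)) : ℝ × ℂ), ∃ r', K y = collisionPoint Z y.1 r' ∧ r' ^ 2 = y.2 := by
  obtain ⟨r, hr⟩ := exists_sqrt (c₀ : ℂ)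
  have hr0 : r ≠ 0 := norm_ne_zero_iff.1 (by rw [norm_eq_one_of_sq hr]; exact one_ne_zero)
  obtain ⟨R, hR, hR0, hRsq⟩ := exists_smooth_sqrt hr0
  rw [hr] at hR hR0 hRsq
  set y₀ : ℝ × ℂ := (E₀, (c₀ : ℂ)) with hy₀
  have hR' : ContDiffAt ℝ ∞ (fun y : ℝ × ℂ => R y.2) y₀ :=
    ContDiffAt.comp (g := R) (f := fun y : ℝ × ℂ => y.2) y₀ hR contDiffAt_snd
  have hK : ContDiffAt ℝ ∞ (fun y : ℝ × ℂ => collisionPoint Z y.1 (R y.2)) y₀ :=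
    contDiffAt_const.prodMk ((contDiffAt_const.mul hR').prodMk
      (contDiffAt_fst.prodMk contDiffAt_const))
  have hK' := (hK.differentiableAt (by simp)).hasFDerivAt
  have hev : ∀ᶠ y in 𝓝 y₀, R y.2 ^ 2 = y.2 :=
    (continuous_snd.tendsto y₀).eventually hRsq
  refine ⟨_, r, hK, ?_, hr, ?_, ?_, ?_⟩
  · simp only [hy₀, hR0]
  -- Energy and `P² / (8Z)` recover the parameters, so `κ` is a local left inverse of the initial
  -- value map and the derivative of that map is injective.
  · set κ : LCSpace → ℝ × ℂ := fun z => (z.2.2.1, z.2.1 ^ 2 / (8 * Z : ℝ))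
    have hκ : ContDiff ℝ ∞ κ :=
      contDiff_snd.snd.fst.prodMk ((contDiff_snd.fst.pow 2).div_const _)
    have h1 : κ ∘ (fun y : ℝ × ℂ => collisionPoint Z y.1 (R y.2)) =ᶠ[𝓝 y₀] id := by
      filter_upwards [hev] with y hy
      refine Prod.ext rfl ?_
      show (((√(8 * Z) : ℝ) : ℂ) * R y.2) ^ 2 / (8 * Z : ℝ) = y.2
      rw [h.direction_eq, hy]
    have h2 := ((hκ.differentiable (by simp)) _).hasFDerivAt.comp y₀ hK'
    have h3 := h2.unique ((hasFDerivAt_id y₀).congr_of_eventuallyEq h1)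
    intro v v' hvv
    have h4 := fun u => congrArg (fun A : (ℝ × ℂ) →L[ℝ] ℝ × ℂ => A u) h3
    simp only [ContinuousLinearMap.comp_apply, ContinuousLinearMap.id_apply] at h4
    rw [← h4 v, hvv, h4 v']
  · intro v
    have h1 : HasFDerivAt (fun y : ℝ × ℂ => (collisionPoint Z y.1 (R y.2)).1) _ y₀ := hK'.fst
    have h2 : HasFDerivAt (fun y : ℝ × ℂ => (collisionPoint Z y.1 (R y.2)).1)
      (0 : (ℝ × ℂ) →L[ℝ] ℂ) y₀ := hasFDerivAt_const (0 : ℂ) y₀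
    exact congrArg (fun A : (ℝ × ℂ) →L[ℝ] ℂ => A v) (h1.unique h2)
  · filter_upwards [hev] with y hy
    exact ⟨R y.2, rfl, hy⟩

variable [hC : CompleteCoulomb S V]

/-- Near a collision, the states of the neighbouring collisions at a common time, in Levi-Civita
coordinates, depend smoothly and regularly on energy and direction. -/
theorem Phase.exists_collision_coordinates (σ : S) (z₀ : ℝ × Circle) :
    ∃ (Z ε : ℝ) (Y : ℝ × ℂ → LCSpace) (t : ℝ), CollisionChart S V σ Z ε ∧
      ContDiffAt ℝ ∞ Y (z₀.1, (z₀.2 : ℂ)) ∧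
      Function.Injective (fderiv ℝ Y (z₀.1, (z₀.2 : ℂ))) ∧
      ∀ᶠ z : ℝ × Circle in 𝓝 z₀, lcEnergy (leviCivita V σ Z) (Y (z.1, (z.2 : ℂ))) = 0 ∧
        (Y (z.1, (z.2 : ℂ))).1 ≠ 0 ∧ (Y (z.1, (z.2 : ℂ))).2.2.2 = t ∧
        lcDown σ (Y (z.1, (z.2 : ℂ))) ∈ cotangentBundle S ∧
        state (collision S V σ z) t = lcDown σ (Y (z.1, (z.2 : ℂ))) := by
  obtain ⟨Z, ε, h⟩ := hC.exists_collisionChart σ.2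
  obtain ⟨K, r, hK, hK0, hr, hKinj, hKfst, hKev⟩ := h.exists_initial z₀.1 z₀.2
  set y₀ : ℝ × ℂ := (z₀.1, (z₀.2 : ℂ)) with hy₀
  obtain ⟨w, N, ψ, F, hN⟩ := h.exists_lcFlow (z₀ := K y₀) (by rw [hK0]; rfl)
  have hEn : lcEnergy (leviCivita V σ Z) (K y₀) = 0 := by
    rw [hK0]
    exact h.lcEnergy_collisionPoint _ (norm_eq_one_of_sq hr)
  have hinj := F.eventually_injective hN (by rw [hK0]; rfl) hEn hKinj hKfst
  have hne := h.eventually_ne_zero (F.solution _ hN hEn) F.zero_mem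
  -- The parameter is taken small enough for injectivity to persist and different from `0`, where
  -- `Q` does not vanish and a state exists.
  obtain ⟨s₁, ⟨hs₁, hs₁w⟩, hQ⟩ := (((hinj.and (eventually_of_mem
    (isOpen_Ioo.mem_nhds F.zero_mem) fun _ h => h)).filter_mono nhdsWithin_le_nhds).and hne).exists
  obtain ⟨τ, -, hτ, hτ₁, hτev⟩ := F.exists_section hs₁w hN hEn hQ
  have hO : IsOpen (Ioo (-w) w ×ˢ N) := isOpen_Ioo.prod F.isOpen
  have hψ : ContDiffAt ℝ ∞ (fun y : ℝ × LCSpace => ψ y.1 y.2) (s₁, K y₀) :=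
    F.smooth.contDiffAt (hO.mem_nhds ⟨hs₁w, hN⟩)
  have hτK : ContDiffAt ℝ ∞ (fun y => τ (K y)) y₀ := ContDiffAt.comp (g := τ) y₀ hτ hK
  have hm : ContDiffAt ℝ ∞ (fun y => (τ (K y), K y)) y₀ := hτK.prodMk hK
  have hψ' : ContDiffAt ℝ ∞ (fun y : ℝ × LCSpace => ψ y.1 y.2) (τ (K y₀), K y₀) := by rwa [hτ₁]
  have hY : ContDiffAt ℝ ∞ (fun y => ψ (τ (K y)) (K y)) y₀ :=
    ContDiffAt.comp (g := fun y : ℝ × LCSpace => ψ y.1 y.2) (f := fun y => (τ (K y), K y)) y₀ hψ' hm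
  refine ⟨Z, ε, fun y => ψ (τ (K y)) (K y), (ψ s₁ (K y₀)).2.2.2, h, hY, ?_, ?_⟩
  · have h1 : HasFDerivAt (fun y => ψ (τ (K y)) (K y)) _ y₀ :=
      HasFDerivAt.comp (g := fun y : ℝ × LCSpace => ψ y.1 y.2) (f := fun y => (τ (K y), K y)) y₀
        (hψ'.differentiableAt (by simp)).hasFDerivAt
        ((hτK.differentiableAt (by simp)).hasFDerivAt.prodMk
          (hK.differentiableAt (by simp)).hasFDerivAt)
    rw [h1.fderiv, hτ₁]
    intro v v' hvv
    -- Stopping at a common physical time adds a multiple of the flow direction. Injectivity holds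
    -- jointly with that direction, so it survives the correction by `τ`.
    have h2 : ((fderiv ℝ (fun y => τ (K y)) y₀ v, v) : ℝ × ℝ × ℂ) =
        (fderiv ℝ (fun y => τ (K y)) y₀ v', v') := hs₁ hvv
    exact congrArg Prod.snd h2
  · have hι : Tendsto (fun z : ℝ × Circle => (z.1, (z.2 : ℂ))) (𝓝 z₀) (𝓝 y₀) :=
      (continuous_fst.prodMk (continuous_subtype_val.comp continuous_snd)).tendsto z₀
    filter_upwards [hι.eventually hKev, hι.eventually (hK.continuousAt.eventually hτev)]
      with z ⟨r', hr', hr'2⟩ ⟨h1, h2, h3, h4⟩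
    have hEz : lcEnergy (leviCivita V σ Z) (K (z.1, (z.2 : ℂ))) = 0 := by
      rw [hr']
      exact h.lcEnergy_collisionPoint _ (norm_eq_one_of_sq hr'2)
    have hsol := F.solution _ h1 hEz
    refine ⟨hsol.energy _ h2, h3, h4, h.lcDown_mem (hsol.mem _ h2) h3, ?_⟩
    obtain ⟨γ, hγ⟩ := F.exists_follows h1 hEz
    have h5 := hγ
    have h1' := h1
    have hEz' := hEz
    rw [hr'] at h5 h1' hEz'
    have h6 := F.isCollision h1' hEz' h5
    have h7 : IsCollision (σ : ℂ) z.1 z.2 γ := by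
      have h8 := h.direction_eq r'
      rw [hr'2] at h8
      rwa [h8] at h6
    rw [(isCollision_collision σ z).unique σ.2 h7, ← h4]
    exact (hγ _ h2).2 h3

end


/-! ### The collision cylinders are smoothly embedded -/

/-- The cylinder as a subset of `ℝ × ℂ`. -/
def cylinderInclusion (z : ℝ × Circle) : ℝ × ℂ := (z.1, (z.2 : ℂ))

theorem contMDiff_coe_circle : ContMDiff (𝓡 1) 𝓘(ℝ, ℂ) ∞ (fun c : Circle => (c : ℂ)) :=
  have : Fact (Module.finrank ℝ ℂ = 1 + 1) := ⟨Complex.finrank_real_complex⟩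
  contMDiff_coe_sphere (E := ℂ) (n := 1)

theorem injective_mfderiv_coe_circle (c : Circle) :
    Function.Injective (mfderiv (𝓡 1) 𝓘(ℝ, ℂ) (fun c : Circle => (c : ℂ)) c) := by
  have : Fact (Module.finrank ℝ ℂ = 1 + 1) := ⟨Complex.finrank_real_complex⟩
  exact injective_mvfderiv_subtypeVal_sphere (E := ℂ) (n := 1) c

theorem contMDiff_cylinderInclusion :
    ContMDiff (𝓘(ℝ, ℝ).prod (𝓡 1)) 𝓘(ℝ, ℝ × ℂ) ∞ cylinderInclusion :=
  contMDiff_fst.prodMk_space (contMDiff_coe_circle.comp contMDiff_snd)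

theorem injective_mfderiv_cylinderInclusion (z : ℝ × Circle) : Function.Injective
    (mfderiv (𝓘(ℝ, ℝ).prod (𝓡 1)) 𝓘(ℝ, ℝ × ℂ) cylinderInclusion z) := by
  have h1 : MDifferentiableAt (𝓡 1) 𝓘(ℝ, ℂ) (fun c : Circle => (c : ℂ)) z.2 :=
    contMDiff_coe_circle.mdifferentiable (by simp) z.2
  have h := (contMDiff_cylinderInclusion.mdifferentiable (by simp) z).hasMFDerivAt
  have h2 := hasMFDerivAt_unique
    (HasMFDerivAt.comp z (ContinuousLinearMap.fst ℝ ℝ ℂ).hasMFDerivAt h) (hasMFDerivAt_fst z)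
  have h3 := hasMFDerivAt_unique
    (HasMFDerivAt.comp z (ContinuousLinearMap.snd ℝ ℝ ℂ).hasMFDerivAt h)
    (HasMFDerivAt.comp (g := fun c : Circle => (c : ℂ)) (f := fun z : ℝ × Circle => z.2) z
      h1.hasMFDerivAt (hasMFDerivAt_snd z))
  have h4 := fun u => DFunLike.congr_fun h2 u
  have h5 := fun u => DFunLike.congr_fun h3 u
  intro v v' hvv
  refine Prod.ext ?_ (injective_mfderiv_coe_circle z.2 ?_)
  · exact (h4 v).symm.trans (Eq.trans (congrArg Prod.fst hvv) (h4 v'))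
  · exact (h5 v).symm.trans (Eq.trans (congrArg Prod.snd hvv) (h5 v'))

namespace Phase

variable {S : Set ℂ} {V : ℂ → ℝ} [hC : CompleteCoulomb S V]

/-- The collision point at time zero has no state, so smoothness is tested in a chart at a common
later or earlier time, where the states are the projections of smooth Levi-Civita coordinates. -/
theorem contMDiff_collision (σ : S) :
    ContMDiff (𝓘(ℝ, ℝ).prod (𝓡 1)) I4 ∞ (collision S V σ) := by
  intro z₀
  obtain ⟨Z, ε, Y, t, h, hY, -, hev⟩ := exists_collision_coordinates (V := V) σ z₀
  have hY' : ContMDiffAt (𝓘(ℝ, ℝ).prod (𝓡 1)) 𝓘(ℝ, LCSpace) ∞ (fun z => Y (cylinderInclusion z)) z₀ :=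
    ContMDiffAt.comp (g := Y) (f := cylinderInclusion) z₀ hY.contMDiffAt
      contMDiff_cylinderInclusion.contMDiffAt
  have h0 := hev.self_of_nhds
  have hG : ContMDiffAt (𝓘(ℝ, ℝ).prod (𝓡 1)) I4 ∞
      (fun z => lcDown (σ : ℂ) (Y (cylinderInclusion z))) z₀ :=
    ContMDiffAt.comp (g := lcDown (σ : ℂ)) (f := fun z => Y (cylinderInclusion z)) z₀
      (contDiffAt_lcDown h0.2.1).contMDiffAt hY'
  refine contMDiffAt_of_state (t := t) h0.2.2.2.1 hG ?_
  filter_upwards [hev] with z hz _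
  exact hz.2.2.2.2

/-- Lifting the states at the common time back to Levi-Civita coordinates gives the map `Y` on the
cylinder, whose derivative is injective; so the derivative of the first factor is too. -/
theorem injective_mfderiv_collision (σ : S) (z₀ : ℝ × Circle) : Function.Injective
    (mfderiv (𝓘(ℝ, ℝ).prod (𝓡 1)) I4 (collision S V σ) z₀) := by
  obtain ⟨Z, ε, Y, t, h, hY, hinj, hev⟩ := exists_collision_coordinates (V := V) σ z₀
  obtain ⟨h1, h2, h3, h4, h5⟩ := hev.self_of_nhds
  obtain ⟨L, hL, hL₁, hLY, -⟩ := hC.toLocallyCoulomb.exists_smooth_lift h2 h1 h4 σ.2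
  have hf : MDifferentiableAt (𝓘(ℝ, ℝ).prod (𝓡 1)) I4 (collision S V σ) z₀ :=
    (contMDiff_collision σ).mdifferentiable (by simp) z₀
  have hmem : collision S V σ z₀ ∈ (stateChart S V t).source := by
    have : (state (collision S V σ z₀) t).2 ∉ S := by rw [h5]; exact h4
    exact this
  have hc : ContMDiffAt I4 I4 ∞ (stateChart S V t) (collision S V σ z₀) :=
    contMDiffAt_of_mem_maximalAtlas (stateChart_mem t) hmem
  have hK : ContMDiffAt I4 𝓘(ℝ, LCSpace) ∞ (fun γ => L (stateChart S V t γ)) (collision S V σ z₀) := by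
    refine ContMDiffAt.comp (g := L) (f := stateChart S V t) _ ?_ hc
    have : ContDiffAt ℝ ∞ L (stateChart S V t (collision S V σ z₀)) := by
      rw [stateChart_apply, h5]
      exact hL
    exact this.contMDiffAt
  have hι := contMDiff_cylinderInclusion.mdifferentiable (by simp) z₀
  have hYd : MDifferentiableAt 𝓘(ℝ, ℝ × ℂ) 𝓘(ℝ, LCSpace) Y (cylinderInclusion z₀) :=
    hY.contMDiffAt.mdifferentiableAt (by simp)
  have hYc : ContinuousAt (fun z : ℝ × Circle => Y (cylinderInclusion z)) z₀ :=
    ContinuousAt.comp (g := Y) (f := cylinderInclusion) hY.continuousAt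
      contMDiff_cylinderInclusion.continuous.continuousAt
  have heq : (fun γ => L (stateChart S V t γ)) ∘ collision S V σ =ᶠ[𝓝 z₀] Y ∘ cylinderInclusion := by
    filter_upwards [hev, hYc.eventually hLY] with z hz hz'
    rw [Function.comp_apply, stateChart_apply, hz.2.2.2.2]
    exact hz' hz.1 (hz.2.2.1.trans h3.symm)
  have h6 := ((hK.mdifferentiableAt (by simp)).hasMFDerivAt.comp z₀ hf.hasMFDerivAt)
  have h7 := (hYd.hasMFDerivAt.comp z₀ hι.hasMFDerivAt).congr_of_eventuallyEq heq
  have h8 := hasMFDerivAt_unique h6 h7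
  have h9 : Function.Injective (mfderiv 𝓘(ℝ, ℝ × ℂ) 𝓘(ℝ, LCSpace) Y (cylinderInclusion z₀)) := by
    rw [mfderiv_eq_fderiv]
    exact hinj
  intro v v' hvv
  refine injective_mfderiv_cylinderInclusion z₀ (h9 ?_)
  have h10 := fun u => DFunLike.congr_fun h8 u
  refine (h10 v).symm.trans (Eq.trans ?_ (h10 v'))
  exact congrArg (mfderiv I4 𝓘(ℝ, LCSpace) (fun γ => L (stateChart S V t γ))
    (collision S V σ z₀)) hvv

/-- Composed with the energy the map is the projection of the cylinder to its line, which is proper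
because the circle is compact. Hence the map itself is proper, and a closed embedding. -/
theorem isEmbedding_collision (σ : S) : IsEmbedding (collision S V σ) := by
  have hc : Continuous (collision S V σ) := (contMDiff_collision σ).continuous
  have h1 : (energy : Phase S V → ℝ) ∘ collision S V σ = Prod.fst :=
    funext fun z => (isCollision_collision σ z).energy
  have h2 : IsProperMap (collision S V σ) :=
    isProperMap_of_comp_of_t2 hc contMDiff_energy.continuous (h1 ▸ isProperMap_fst_of_compactSpace)
  exact (IsClosedEmbedding.of_continuous_injective_isClosedMap hc (collision_injective σ)
    h2.isClosedMap).isEmbedding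

theorem isSmoothEmbedding_collision (σ : S) :
    IsSmoothEmbedding (𝓘(ℝ, ℝ).prod (𝓡 1)) I4 ∞ (collision S V σ) where
  isImmersion := by
    refine IsImmersionOfComplement.isImmersion (F := ℂ) fun z => ?_
    exact isImmersionAtOfComplement_of_injective (by simp [Module.finrank_prod])
      (contMDiff_collision σ) z (injective_mfderiv_collision σ z)
  isEmbedding := isEmbedding_collision σ

end Phase


/-! ### The flow of an arbitrary complete extension -/

namespace Extension

variable {S : Set ℂ} {V : ℂ → ℝ}

theorem symm_mem_source (Y : Extension S V) {y : ℂ × ℂ} (hy : y ∈ cotangentBundle S) :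
    Y.coord.symm y ∈ Y.coord.source :=
  Y.coord.map_target (by rwa [Y.coord_target])

theorem coord_mem_cotangentBundle (Y : Extension S V) {p : Y.P} (hp : p ∈ Y.coord.source) :
    Y.coord p ∈ cotangentBundle S := by
  rw [← Y.coord_target]
  exact Y.coord.map_source hp

theorem coord_symm_apply (Y : Extension S V) {y : ℂ × ℂ} (hy : y ∈ cotangentBundle S) :
    Y.coord (Y.coord.symm y) = y :=
  Y.coord.right_inv (by rwa [Y.coord_target])

theorem contMDiffAt_coord_symm (Y : Extension S V) {y : ℂ × ℂ} (hy : y ∈ cotangentBundle S) :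
    ContMDiffAt I4 I4 ∞ Y.coord.symm y :=
  contMDiffAt_symm_of_mem_maximalAtlas Y.coord_mem (by rwa [Y.coord_target])

/-- In the coordinates `(p, q)`, the Hamiltonian vector field is that of Newton's equation. -/
theorem hamiltonianField_coord (hC : LocallyCoulomb S V) (Y : Extension S V)
    {X : ∀ p : Y.P, TangentSpace I4 p} (hX : IsHamiltonianField Y.Ω Y.H X) {p : Y.P}
    (hp : p ∈ Y.coord.source) :
    (mfderiv I4 I4 Y.coord p (X p) : ℂ × ℂ) = newtonField V (Y.coord p) := by
  have hy := Y.coord_mem_cotangentBundle hp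
  have hmd := mdifferentiable_of_mem_maximalAtlas Y.coord_mem
  set ξ : ℂ × ℂ := mfderiv I4 I4 Y.coord p (X p) with hξ
  refine sub_eq_zero.1 (canonicalForm_nondegenerate (v := ξ - newtonField V (Y.coord p))
    fun w => ?_)
  have h1 : (mfderiv I4 I4 Y.coord p (mfderiv I4 I4 Y.coord.symm (Y.coord p) w : ℂ × ℂ) : ℂ × ℂ) = w := by
    have h5 := hmd.comp_symm_deriv (Y.coord.map_source hp)
    have h6 : (mfderiv I4 I4 Y.coord (Y.coord.symm (Y.coord p))
        (mfderiv I4 I4 Y.coord.symm (Y.coord p) w) : ℂ × ℂ) = w := congrArg (fun A => A w) h5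
    rw [Y.coord.left_inv hp] at h6
    exact h6
  have h2 := Y.Ω.apply_eq_inChart Y.coord_mem hp (X p)
    (mfderiv I4 I4 Y.coord.symm (Y.coord p) w : ℂ × ℂ)
  rw [h1] at h2
  replace h2 := h2.trans (Y.form_coord _ hy ξ w)
  have h3 : fderiv ℝ (hamiltonian V) (Y.coord p) w =
      mfderiv I4 𝓘(ℝ, ℝ) Y.H p (mfderiv I4 I4 Y.coord.symm (Y.coord p) w : ℂ × ℂ) := by
    have h4 : MDifferentiableAt I4 𝓘(ℝ, ℝ) Y.H (Y.coord.symm (Y.coord p)) :=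
      Y.H_smooth.mdifferentiable (by simp) _
    have h5 := (h4.hasMFDerivAt.comp (Y.coord p)
      (hmd.mdifferentiableAt_symm (Y.coord.map_source hp)).hasMFDerivAt).congr_of_eventuallyEq
      (f₁ := hamiltonian V) (by
        filter_upwards [hC.isOpen_cotangentBundle.mem_nhds hy] with y hy
        exact (Y.H_coord y hy).symm)
    have h6 := h5.mfderiv
    rw [mfderiv_eq_fderiv, Y.coord.left_inv hp] at h6
    exact congrArg (fun A : (ℂ × ℂ) →L[ℝ] ℝ => A w) h6
  have h7 := (hX p _).symm.trans h2
  have h8 := h3.trans h7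
  rw [fderiv_hamiltonian hC hy] at h8
  have h9 : ∀ a b : ℂ × ℂ, canonicalForm (a - b) w = canonicalForm a w - canonicalForm b w := by
    intro a b
    simp [canonicalForm]
    ring
  exact (h9 _ _).trans (sub_eq_zero.2 h8.symm)

theorem hasDerivAt_coord (hC : LocallyCoulomb S V) (Y : Extension S V) {Ψ : ℝ → Y.P → Y.P}
    (hΨ : IsCompleteHamiltonianFlow Y.Ω Y.H Ψ) {p : Y.P} {t : ℝ} (hp : Ψ t p ∈ Y.coord.source) :
    HasDerivAt (fun s => Y.coord (Ψ s p)) (newtonField V (Y.coord (Ψ t p))) t := by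
  obtain ⟨X, hX, hint⟩ := hΨ.generated
  have h1 := (mdifferentiable_of_mem_maximalAtlas Y.coord_mem).mdifferentiableAt hp
  have h2 := HasMFDerivAt.comp t h1.hasMFDerivAt (hint p t)
  have h3 : HasFDerivAt (𝕜 := ℝ) (E := ℝ) (F := ℂ × ℂ) (fun s => Y.coord (Ψ s p)) _ t :=
    hasMFDerivAt_iff_hasFDerivAt.1 h2
  refine h3.hasDerivAt.congr_deriv ?_
  rw [← Y.hamiltonianField_coord hC hX hp]
  show mfderiv I4 I4 Y.coord (Ψ t p) ((1 : ℝ) • X (Ψ t p)) = _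
  rw [one_smul]

variable [hC : CompleteCoulomb S V]

/-- Every complete flow extends that of the regularized trajectories. -/
theorem flow_coord_symm (Y : Extension S V) {Ψ : ℝ → Y.P → Y.P}
    (hΨ : IsCompleteHamiltonianFlow Y.Ω Y.H Ψ) {t : ℝ} {x : ℂ × ℂ}
    (hx : x ∈ Phase.flowDomain S V t) :
    Ψ t (Y.coord.symm x) = Y.coord.symm (Phase.flowMap S V t x) := by
  have hsmooth : ∀ {t x}, x ∈ cotangentBundle S →
      ContinuousAt (fun z : ℝ × ℂ × ℂ => Ψ z.1 (Y.coord.symm z.2)) (t, x) := fun {t x} hx =>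
    ContinuousAt.comp (g := fun z : ℝ × Y.P => Ψ z.1 z.2)
      (f := fun z : ℝ × ℂ × ℂ => (z.1, Y.coord.symm z.2)) hΨ.smooth.continuous.continuousAt
      (continuousAt_fst.prodMk (ContinuousAt.comp (g := Y.coord.symm) (f := fun z : ℝ × ℂ × ℂ => z.2)
        (Y.contMDiffAt_coord_symm hx).continuousAt continuousAt_snd))
  refine Phase.flow_induction (S := S) (V := V)
    (R := fun t x => Ψ t (Y.coord.symm x) = Y.coord.symm (Phase.flowMap S V t x)) ?_ ?_ ?_ hx
  · intro t u x h1 h2 h3 h4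
    rw [add_comm t u, hΨ.add, h3, h4, Phase.flowMap_add h1, add_comm]
  · intro x₀ hx₀
    have h1 : ∀ᶠ z : ℝ × ℂ × ℂ in 𝓝 (0, x₀), Ψ z.1 (Y.coord.symm z.2) ∈ Y.coord.source :=
      (hsmooth (t := 0) hx₀).eventually (Y.coord.open_source.mem_nhds (by
        show Ψ 0 (Y.coord.symm x₀) ∈ _
        rw [hΨ.zero]
        exact Y.symm_mem_source hx₀))
    rw [nhds_prod_eq] at h1
    obtain ⟨A, hA, B, hB, hAB⟩ := mem_prod_iff.1 h1
    obtain ⟨w, hw, hwA⟩ := Metric.mem_nhds_iff.1 hA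
    rw [Real.ball_eq_Ioo, zero_sub, zero_add] at hwA
    refine ⟨w, hw, ?_⟩
    filter_upwards [hB, hC.isOpen_cotangentBundle.mem_nhds hx₀] with x hxB hxT t ht
    have h2 : ∀ u ∈ Ioo (-w) w, Ψ u (Y.coord.symm x) ∈ Y.coord.source := fun u hu =>
      hAB (mk_mem_prod (hwA hu) hxB)
    have h3 := Phase.eq_of_hasDerivAt (γ := Phase.traj S V x)
      (α := fun u => Y.coord (Ψ u (Y.coord.symm x))) isPreconnected_Ioo isOpen_Ioo
      (fun u hu => Y.hasDerivAt_coord hC.toLocallyCoulomb hΨ (h2 u hu))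
      (fun u hu => Y.coord_mem_cotangentBundle (h2 u hu)) (t := 0) ⟨by linarith, hw⟩
      (by rw [Phase.state_traj hxT, hΨ.zero, Y.coord_symm_apply hxT]) t ht
    show _ = Y.coord.symm (state (Phase.traj S V x) t)
    rw [h3, Y.coord.left_inv (h2 t ht)]
  · intro t x hx hcl
    have h1 : ContinuousAt (fun y => Ψ t (Y.coord.symm y)) x :=
      ContinuousAt.comp (f := fun y : ℂ × ℂ => (t, y)) (hsmooth hx.1) (by fun_prop)
    have h2 : ContinuousAt (fun y => Y.coord.symm (Phase.flowMap S V t y)) x :=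
      ContinuousAt.comp (g := Y.coord.symm) (f := Phase.flowMap S V t)
        (Y.contMDiffAt_coord_symm (Phase.flowMap_mem hx)).continuousAt
        (Phase.contDiffAt_flowMap hx).2.continuousAt
    exact tendsto_nhds_unique_of_frequently_eq h1 h2
      ((mem_closure_iff_frequently.1 hcl).mono fun y hy => hy.2)

end Extension

/-! ### Accumulation of trajectories starting near a nucleus with bounded energy -/

namespace Phase

variable {S : Set ℂ} {V : ℂ → ℝ} [hC : CompleteCoulomb S V]

/-- Trajectories with bounded energy that start close to a nucleus accumulate. -/
theorem exists_mapClusterPt_traj {ι : Type*} {l : Filter ι} [NeBot l] {x : ι → ℂ × ℂ} {σ : ℂ}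
    (hσ : σ ∈ S) {A : ℝ} (hx : ∀ᶠ i in l, x i ∈ cotangentBundle S)
    (hq : Tendsto (fun i => (x i).2) l (𝓝 σ)) (hE : ∀ᶠ i in l, |hamiltonian V (x i)| ≤ A) :
    ∃ γ : Phase S V, MapClusterPt γ l fun i => traj S V (x i) := by
  obtain ⟨Z, ε, h⟩ := hC.exists_collisionChart hσ
  choose Q hQ using fun i => exists_sqrt ((x i).2 - σ)
  have hne : ∀ {i}, x i ∈ cotangentBundle S → (x i).2 ≠ σ := fun hi h => hi (h ▸ hσ)
  have hQ0 : Tendsto Q l (𝓝 0) := by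
    refine tendsto_zero_of_sq hQ ?_
    simpa using hq.sub_const σ
  obtain ⟨z₀, hz₀, h0, hK, hT⟩ := h.exists_mapClusterPt (A := A) (t₀ := 0)
    (z := fun i => lcLift V (Q i) (x i) 0)
    (hx.mono fun i hi => lcEnergy_lcLift (hQ i) (hne hi) 0) hQ0 hE tendsto_const_nhds
  obtain ⟨w, N, ψ, F, hzN⟩ := h.exists_lcFlow h0
  obtain ⟨γ, hγ⟩ := F.exists_follows hzN hK
  obtain ⟨s₁, hs₁, hQ₁⟩ := F.exists_ne_zero hzN hK
  obtain ⟨τ, hτ, -, hτ₁, hτev⟩ := F.exists_section hs₁ hzN hK hQ₁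
  have hst : state γ (ψ s₁ z₀).2.2.2 = lcDown σ (ψ (τ z₀) z₀) := by
    rw [hτ₁]
    exact (hγ s₁ hs₁).2 hQ₁
  have hmem : γ (ψ s₁ z₀).2.2.2 ∉ S := (F.notMem_iff hzN hK hγ hs₁).2 hQ₁
  have hmem' : lcDown σ (ψ (τ z₀) z₀) ∈ cotangentBundle S := by
    rw [← hst]
    exact hmem
  -- Along the ultrafilter the Levi-Civita lifts converge. At a time when the limit trajectory is
  -- collision-free the states then converge too, and this is convergence in phase space.
  obtain ⟨U, hU, hUz⟩ := mapClusterPt_iff_ultrafilter.1 hz₀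
  refine ⟨γ, mapClusterPt_iff_ultrafilter.2 ⟨U, hU, ?_⟩⟩
  have h1 : Tendsto (fun i => (stateChart S V (ψ s₁ z₀).2.2.2).symm
      (lcDown σ (ψ (τ (lcLift V (Q i) (x i) 0)) (lcLift V (Q i) (x i) 0)))) U (𝓝 γ) := by
    have h2 := ((stateChart S V (ψ s₁ z₀).2.2.2).symm.continuousAt hmem').tendsto.comp
      (hτ.continuousAt.tendsto.comp hUz)
    have h3 : (stateChart S V (ψ s₁ z₀).2.2.2).symm (lcDown σ (ψ (τ z₀) z₀)) = γ := by
      rw [← hst, ← stateChart_apply]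
      exact (stateChart S V (ψ s₁ z₀).2.2.2).left_inv hmem
    rw [h3] at h2
    exact h2
  refine h1.congr' ?_
  filter_upwards [hUz.eventually hτev, hU hx] with i ⟨h2, h3, h4, h5⟩ h6
  have hK' : lcEnergy (leviCivita V σ Z) (lcLift V (Q i) (x i) 0) = 0 :=
    lcEnergy_lcLift (hQ i) (hne h6) 0
  have hQi : Q i ≠ 0 := fun h => hne h6 (sub_eq_zero.1 (by rw [← hQ i, h]; simp))
  have hfol := F.follows_of_zero (γ := traj S V (x i)) h2 hK' hQi (by
    rw [lcDown_lcLift (hQ i) (hne h6)]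
    exact state_traj h6)
  have h7 := (hfol _ h3).2 h4
  rw [h5] at h7
  have h8 := (F.notMem_iff h2 hK' hfol h3).2 h4
  rw [h5] at h8
  rw [← h7, ← stateChart_apply]
  exact (stateChart S V (ψ s₁ z₀).2.2.2).left_inv h8

end Phase


/-! ### The comparison map onto a complete extension -/

namespace Extension

variable {S : Set ℂ} {V : ℂ → ℝ} [hC : CompleteCoulomb S V] (Y : Extension S V)
  {Ψ : ℝ → Y.P → Y.P} (hΨ : IsCompleteHamiltonianFlow Y.Ω Y.H Ψ)

/-- The comparison map from the space of trajectories to a complete extension. -/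
def comparison (Ψ : ℝ → Y.P → Y.P) (γ : Phase S V) : Y.P :=
  Ψ (-γ.exists_notMem.choose) (Y.coord.symm (state γ γ.exists_notMem.choose))

include hΨ

omit hC in
theorem flow_neg_flow (t : ℝ) (p : Y.P) : Ψ (-t) (Ψ t p) = p := by
  rw [← hΨ.add, neg_add_cancel, hΨ.zero]

omit hC in
theorem flow_flow_neg (t : ℝ) (p : Y.P) : Ψ t (Ψ (-t) p) = p := by
  rw [← hΨ.add, add_neg_cancel, hΨ.zero]

omit hC in
theorem contMDiff_flow (t : ℝ) : ContMDiff I4 I4 ∞ (Ψ t) :=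
  hΨ.smooth.comp (contMDiff_const.prodMk contMDiff_id)

/-- Any two collision-free times give the same point, because the flow of the extension agrees on
coordinates with the regularized flow. The map can thus be studied with a time that is fixed
locally. -/
theorem comparison_eq {γ : Phase S V} {t : ℝ} (h : γ t ∉ S) :
    Y.comparison Ψ γ = Ψ (-t) (Y.coord.symm (state γ t)) := by
  have h1 := γ.exists_notMem.choose_spec
  set u := γ.exists_notMem.choose with hu
  have h2 := Y.flow_coord_symm hΨ (Phase.state_mem_flowDomain h h1)
  rw [Phase.flowMap_state h, add_sub_cancel] at h2
  rw [comparison, ← hu, ← h2, ← hΨ.add]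
  congr 1
  ring

theorem comparison_coord {y : ℂ × ℂ} (hy : y ∈ cotangentBundle S) :
    Y.comparison Ψ ((Phase.stateChart S V 0).symm y) = Y.coord.symm y := by
  have h1 : (Phase.stateChart S V 0).symm y ∈ (Phase.stateChart S V 0).source :=
    (Phase.stateChart S V 0).map_target hy
  have h2 : state ((Phase.stateChart S V 0).symm y).toFun 0 = y :=
    (Phase.stateChart S V 0).right_inv hy
  rw [Y.comparison_eq hΨ h1, h2, neg_zero, hΨ.zero]

theorem coord_flow_comparison {γ : Phase S V} {t : ℝ} (h : γ t ∉ S) :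
    Ψ t (Y.comparison Ψ γ) ∈ Y.coord.source ∧ Y.coord (Ψ t (Y.comparison Ψ γ)) = state γ t := by
  rw [Y.comparison_eq hΨ h, Y.flow_flow_neg hΨ]
  exact ⟨Y.symm_mem_source h, Y.coord_symm_apply h⟩

theorem comparison_injective : Function.Injective (Y.comparison (V := V) Ψ) := by
  intro γ δ hγδ
  obtain ⟨t, h1, h2⟩ := Phase.exists_common_time γ δ
  refine Phase.eq_of_state_eq h1 ?_
  rw [← (Y.coord_flow_comparison hΨ h1).2, ← (Y.coord_flow_comparison hΨ h2).2, hγδ]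

theorem contMDiff_comparison : ContMDiff I4 I4 ∞ (Y.comparison (V := V) Ψ) := by
  intro γ
  obtain ⟨t, ht⟩ := γ.exists_notMem
  have h1 : ContMDiffAt I4 I4 ∞ (Phase.stateChart S V t) γ :=
    contMDiffAt_of_mem_maximalAtlas (Phase.stateChart_mem t) ht
  have h2 : ContMDiffAt I4 I4 ∞ (fun δ => Ψ (-t) (Y.coord.symm (Phase.stateChart S V t δ))) γ :=
    ((Y.contMDiff_flow hΨ (-t)).contMDiffAt.comp _ (Y.contMDiffAt_coord_symm ht)).comp γ h1
  refine h2.congr_of_eventuallyEq ?_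
  filter_upwards [(Phase.stateChart S V t).open_source.mem_nhds ht] with δ hδ
  exact Y.comparison_eq hΨ hδ

/-- A point off the coordinate domain lies over a nucleus and is approached by coordinate points
with bounded energy, by continuity of the Hamiltonian. Their trajectories accumulate, and by
continuity the comparison map sends an accumulation point to the given point. -/
theorem comparison_surjective : Function.Surjective (Y.comparison (V := V) Ψ) := by
  intro p
  by_cases hp : p ∈ Y.coord.source
  · refine ⟨(Phase.stateChart S V 0).symm (Y.coord p), ?_⟩
    rw [Y.comparison_coord hΨ (Y.coord_mem_cotangentBundle hp), Y.coord.left_inv hp]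
  obtain ⟨σ, z, hz⟩ := Y.cyl_cover p hp
  have hproj : Y.proj p = σ := by rw [← hz, Y.proj_cyl]
  have hne : NeBot (𝓝[Y.coord.source] p) := mem_closure_iff_nhdsWithin_neBot.1 (Y.dense_source p)
  have hmem : ∀ᶠ x in 𝓝[Y.coord.source] p, x ∈ Y.coord.source := self_mem_nhdsWithin
  have hq : Tendsto (fun x => (Y.coord x).2) (𝓝[Y.coord.source] p) (𝓝 (σ : ℂ)) := by
    have h1 := (Y.proj_continuous.tendsto p).mono_left (nhdsWithin_le_nhds (s := Y.coord.source))
    rw [hproj] at h1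
    refine h1.congr' ?_
    filter_upwards [hmem] with x hx
    exact Y.proj_coord x hx
  have hE : ∀ᶠ x in 𝓝[Y.coord.source] p, |hamiltonian V (Y.coord x)| ≤ |Y.H p| + 1 := by
    have h1 := (Y.H_smooth.continuous.abs.tendsto p).mono_left
      (nhdsWithin_le_nhds (s := Y.coord.source))
    filter_upwards [hmem, h1.eventually (gt_mem_nhds (lt_add_one |Y.H p|))] with x hx hlt
    rw [← Y.H_coord _ (Y.coord_mem_cotangentBundle hx), Y.coord.left_inv hx]
    exact hlt.le
  obtain ⟨γ, hγ⟩ := Phase.exists_mapClusterPt_traj (V := V) σ.2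
    (hmem.mono fun x hx => Y.coord_mem_cotangentBundle hx) hq hE
  have h1 := hγ.continuousAt_comp (Y.contMDiff_comparison hΨ).continuous.continuousAt
  refine ⟨γ, ?_⟩
  obtain ⟨U, hU, hU'⟩ := mapClusterPt_iff_ultrafilter.1 h1
  refine tendsto_nhds_unique (hU'.congr' (f₂ := fun x => x) ?_)
    ((hU.trans nhdsWithin_le_nhds : (U : Filter Y.P) ≤ 𝓝 p))
  filter_upwards [hU hmem] with x hx
  have h2 := Y.comparison_coord hΨ (Y.coord_mem_cotangentBundle hx)
  rw [Y.coord.left_inv hx, Phase.stateChart_symm_apply, neg_zero, Phase.shift_zero] at h2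
  exact h2

/-- The comparison map is a diffeomorphism. -/
def comparisonDiffeomorph : Phase S V ≃ₘ^∞⟮I4, I4⟯ Y.P where
  toEquiv := Equiv.ofBijective (Y.comparison Ψ)
    ⟨Y.comparison_injective hΨ, Y.comparison_surjective hΨ⟩
  contMDiff_toFun := Y.contMDiff_comparison hΨ
  contMDiff_invFun := by
    intro p
    set e := Equiv.ofBijective (Y.comparison (V := V) Ψ)
      ⟨Y.comparison_injective hΨ, Y.comparison_surjective hΨ⟩ with he
    obtain ⟨t, ht⟩ := (e.symm p).exists_notMem
    have hp : Y.comparison Ψ (e.symm p) = p := e.apply_symm_apply p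
    obtain ⟨h1, h2⟩ := Y.coord_flow_comparison hΨ ht
    rw [hp] at h1 h2
    have h3 : ContMDiffAt I4 I4 ∞ (fun x => (Phase.stateChart S V t).symm (Y.coord (Ψ t x))) p := by
      have h4 : ContMDiffAt I4 I4 ∞ (fun x => Y.coord (Ψ t x)) p :=
        (contMDiffAt_of_mem_maximalAtlas Y.coord_mem h1).comp p
          (Y.contMDiff_flow hΨ t).contMDiffAt
      exact ContMDiffAt.comp (g := (Phase.stateChart S V t).symm) p
        (contMDiffAt_symm_of_mem_maximalAtlas (Phase.stateChart_mem t)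
          (Y.coord_mem_cotangentBundle h1)) h4
    refine h3.congr_of_eventuallyEq ?_
    filter_upwards [(Y.contMDiff_flow hΨ t).continuous.continuousAt.eventually
      (Y.coord.open_source.mem_nhds h1)] with x hx
    show e.symm x = _
    rw [Equiv.symm_apply_eq]
    have h5 : (Phase.stateChart S V t).symm (Y.coord (Ψ t x)) ∈ (Phase.stateChart S V t).source :=
      (Phase.stateChart S V t).map_target (Y.coord_mem_cotangentBundle hx)
    have h6 : state ((Phase.stateChart S V t).symm (Y.coord (Ψ t x))).toFun t = Y.coord (Ψ t x) :=
      (Phase.stateChart S V t).right_inv (Y.coord_mem_cotangentBundle hx)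
    show x = Y.comparison Ψ _
    rw [Y.comparison_eq hΨ h5, h6, Y.coord.left_inv hx, Y.flow_neg_flow hΨ]

end Extension


/-! ### The comparison map preserves the structure and is unique -/

namespace Extension

variable {S : Set ℂ} {V : ℂ → ℝ}

theorem inChart_coord (Y : Extension S V) {y : ℂ × ℂ} (hy : y ∈ cotangentBundle S) :
    Y.Ω.inChart Y.coord y = canonicalAlt := by
  ext m
  have h1 : m = ![m 0, m 1] := by
    funext i
    fin_cases i <;> rfl
  rw [canonicalAlt_apply, ← Y.form_coord y hy, ← h1]

variable [hC : CompleteCoulomb S V]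

/-- Read in the chart at time `t`, this is the density of the trajectories that are collision-free
at time `0`. -/
theorem _root_.CoulombRegularization.Phase.mem_closure_flowDomain {y : ℂ × ℂ} (hy : y ∈ cotangentBundle S) (t : ℝ) :
    y ∈ closure (Phase.flowDomain S V (-t)) := by
  set γ := (Phase.stateChart S V t).symm y
  have hγ : γ ∈ (Phase.stateChart S V t).source := (Phase.stateChart S V t).map_target hy
  have hne : NeBot (𝓝[(Phase.stateChart S V 0).source] γ) :=
    mem_closure_iff_nhdsWithin_neBot.1 (Phase.dense_source γ)
  have h1 := ((Phase.stateChart S V t).continuousAt hγ).tendsto.mono_left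
    (nhdsWithin_le_nhds (s := (Phase.stateChart S V 0).source))
  rw [(Phase.stateChart S V t).right_inv hy] at h1
  refine mem_closure_of_tendsto h1 ?_
  filter_upwards [self_mem_nhdsWithin,
    nhdsWithin_le_nhds ((Phase.stateChart S V t).open_source.mem_nhds hγ)] with δ h0 ht
  have h2 := Phase.state_mem_flowDomain (γ := δ) ht h0
  rw [zero_sub] at h2
  exact h2

variable (Y : Extension S V) {Ψ : ℝ → Y.P → Y.P} (hΨ : IsCompleteHamiltonianFlow Y.Ω Y.H Ψ)

include hΨ

/-- The chart of a complete extension given by the state of trajectories at time `t`. -/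
theorem exists_comparisonChart (t : ℝ) : ∃ e ∈ IsManifold.maximalAtlas I4 ∞ Y.P,
    e.target = cotangentBundle S ∧
      (∀ γ : Phase S V, Y.comparison Ψ γ ∈ e.source ↔ γ ∈ (Phase.stateChart S V t).source) ∧
      (∀ γ, e (Y.comparison Ψ γ) = Phase.stateChart S V t γ) ∧
      ∀ y, e.symm y = Y.comparison Ψ ((Phase.stateChart S V t).symm y) := by
  set φ := Y.comparisonDiffeomorph hΨ
  have hφ : ∀ γ, φ.symm (Y.comparison Ψ γ) = γ := fun γ => φ.symm_apply_apply γ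
  refine ⟨φ.symm.toHomeomorph.toOpenPartialHomeomorph.trans (Phase.stateChart S V t), ?_, ?_, ?_,
    ?_, ?_⟩
  · refine OpenPartialHomeomorph.mem_maximalAtlas_of_contMDiffOn _ ?_ ?_
    · exact (contMDiffOn_of_mem_maximalAtlas (Phase.stateChart_mem t)).comp
        φ.symm.contMDiff.contMDiffOn fun x hx => hx.2
    · exact φ.contMDiff.comp_contMDiffOn
        ((contMDiffOn_symm_of_mem_maximalAtlas (Phase.stateChart_mem t)).mono fun y hy => hy.1)
  · ext y
    exact ⟨fun h => h.1, fun h => ⟨h, mem_univ _⟩⟩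
  · intro γ
    refine ⟨fun h => ?_, fun h => ⟨mem_univ _, ?_⟩⟩
    · have h1 : φ.symm (Y.comparison Ψ γ) ∈ (Phase.stateChart S V t).source := h.2
      rwa [hφ] at h1
    · show φ.symm (Y.comparison Ψ γ) ∈ (Phase.stateChart S V t).source
      rwa [hφ]
  · intro γ
    show Phase.stateChart S V t (φ.symm (Y.comparison Ψ γ)) = _
    rw [hφ]
  · intro y
    rfl

/-- On the dense set of states that are collision-free after time `-t`, the chart differs from the
given coordinates by a symplectic flow map. Elsewhere the identity follows from continuity of the
form. -/
theorem inChart_comparisonChart {t : ℝ} {e : OpenPartialHomeomorph Y.P (ℂ × ℂ)}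
    (he : e ∈ IsManifold.maximalAtlas I4 ∞ Y.P) (het : e.target = cotangentBundle S)
    (hes : ∀ y, e.symm y = Y.comparison Ψ ((Phase.stateChart S V t).symm y)) {y : ℂ × ℂ}
    (hy : y ∈ cotangentBundle S) : Y.Ω.inChart e y = canonicalAlt := by
  have hflow : ∀ x ∈ Phase.flowDomain S V (-t),
      e.symm x = Y.coord.symm (Phase.flowMap S V (-t) x) := by
    intro x hx
    have h1 : (Phase.stateChart S V t).symm x =
        (Phase.stateChart S V 0).symm (Phase.flowMap S V (-t) x) := by
      rw [Phase.stateChart_symm_apply, Phase.stateChart_symm_apply, Phase.traj_flowMap hx, neg_zero,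
        Phase.shift_zero]
    rw [hes, h1, Y.comparison_coord hΨ (Phase.flowMap_mem hx)]
  have hdom : ∀ x ∈ Phase.flowDomain S V (-t), Y.Ω.inChart e x = canonicalAlt := by
    intro x hx
    have h1 : e.symm x ∈ Y.coord.source := by
      rw [hflow x hx]
      exact Y.symm_mem_source (Phase.flowMap_mem hx)
    have h2 : Y.coord ∘ e.symm =ᶠ[𝓝 x] Phase.flowMap S V (-t) := by
      filter_upwards [(Phase.isOpen_flowDomain (-t)).mem_nhds hx] with z hz
      rw [Function.comp_apply, hflow z hz, Y.coord_symm_apply (Phase.flowMap_mem hz)]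
    rw [Y.Ω.inChart_eq he Y.coord_mem (by rw [het]; exact hx.1) h1, h2.fderiv_eq,
      Y.inChart_coord (Y.coord_mem_cotangentBundle h1)]
    exact canonicalAlt_comp (Phase.canonicalForm_fderiv_flowMap hx)
  have hcont : ContinuousAt (Y.Ω.inChart e) y :=
    (Y.symplectic.smooth e he).continuousOn.continuousAt
      (e.open_target.mem_nhds (by rwa [het]))
  exact tendsto_nhds_unique_of_frequently_eq hcont tendsto_const_nhds
    ((mem_closure_iff_frequently.1 (Phase.mem_closure_flowDomain (V := V) hy t)).mono hdom)

theorem form_comparison (γ : Phase S V) (v w : TangentSpace I4 γ) :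
    Y.Ω (Y.comparison Ψ γ) ![mfderiv I4 I4 (Y.comparison Ψ) γ v, mfderiv I4 I4 (Y.comparison Ψ) γ w] =
      Phase.symplecticForm S V γ ![v, w] := by
  obtain ⟨t, ht⟩ := γ.exists_notMem
  obtain ⟨e, he, het, hesrc, hea, hes⟩ := Y.exists_comparisonChart hΨ t
  have h0 : Phase.stateChart S V t γ ∈ cotangentBundle S := ht
  have h1 := Y.Ω.apply_eq_inChart he ((hesrc γ).2 ht)
    (mfderiv I4 I4 (Y.comparison Ψ) γ v) (mfderiv I4 I4 (Y.comparison Ψ) γ w)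
  have h2 := (Phase.symplecticForm S V).apply_eq_inChart (Phase.stateChart_mem t) (x := γ) ht v w
  have h3 : ∀ u : TangentSpace I4 γ, (mfderiv I4 I4 e (Y.comparison Ψ γ)
      (mfderiv I4 I4 (Y.comparison Ψ) γ u) : ℂ × ℂ) =
        (mfderiv I4 I4 (Phase.stateChart S V t) γ u : ℂ × ℂ) := by
    intro u
    have h4 : MDifferentiableAt I4 I4 (Y.comparison Ψ) γ :=
      (Y.contMDiff_comparison hΨ).mdifferentiable (by simp) γ
    have h5 : MDifferentiableAt I4 I4 e (Y.comparison Ψ γ) :=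
      (mdifferentiable_of_mem_maximalAtlas he).mdifferentiableAt ((hesrc γ).2 ht)
    have h6 := mfderiv_comp γ h5 h4
    have h7 : e ∘ Y.comparison Ψ = Phase.stateChart S V t := funext hea
    rw [h7] at h6
    exact (DFunLike.congr_fun h6 u).symm
  rw [h3 v, h3 w] at h1
  have h8 : Y.Ω.inChart e (e (Y.comparison Ψ γ)) = canonicalAlt := by
    rw [hea]
    exact Y.inChart_comparisonChart hΨ he het hes h0
  rw [h8] at h1
  rw [Phase.inChart_stateChart t h0] at h2
  exact h1.trans h2.symm

theorem isIso_comparison : (phaseExtension S V).IsIso Y (Y.comparisonDiffeomorph hΨ) where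
  coord y hy := Y.comparison_coord hΨ hy
  form := Y.form_comparison hΨ
  energy := by
    refine congrFun (Continuous.ext_on (phaseExtension S V).dense_source
      (Y.H_smooth.continuous.comp (Y.comparisonDiffeomorph hΨ).continuous)
      (phaseExtension S V).H_smooth.continuous ?_)
    intro γ hγ
    have hy := (phaseExtension S V).coord_mem_cotangentBundle hγ
    have h1 := (phaseExtension S V).coord.left_inv hγ
    have h2 := Y.comparison_coord hΨ hy
    rw [← h1, (phaseExtension S V).H_coord _ hy]
    exact (congrArg Y.H h2).trans (Y.H_coord _ hy)

/-- An isomorphism is prescribed on the cotangent bundle, which is dense, so continuity determines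
it. -/
theorem existsUnique_isIso : ∃! φ, (phaseExtension S V).IsIso Y φ := by
  refine ⟨Y.comparisonDiffeomorph hΨ, Y.isIso_comparison hΨ, fun φ hφ => ?_⟩
  refine Diffeomorph.ext fun γ => congrFun (Continuous.ext_on (phaseExtension S V).dense_source
    φ.continuous (Y.comparisonDiffeomorph hΨ).continuous fun δ hδ => ?_) γ
  have hy := (phaseExtension S V).coord_mem_cotangentBundle hδ
  have h1 := hφ.coord _ hy
  have h2 := (Y.isIso_comparison hΨ).coord _ hy
  rw [(phaseExtension S V).coord.left_inv hδ] at h1 h2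
  exact h1.trans h2.symm

end Extension


/-! ### Periods, and completeness by compactness modulo periods -/

section

variable {S : Set ℂ} {V : ℂ → ℝ}

/-- Invariance of the set of nuclei and of the potential under a translation. -/
structure IsPeriod (S : Set ℂ) (V : ℂ → ℝ) (l : ℂ) : Prop where
  add_mem_iff : ∀ q, q + l ∈ S ↔ q ∈ S
  periodic : ∀ q ∉ S, V (q + l) = V q

theorem IsPeriod.newtonField (hC : LocallyCoulomb S V) {l : ℂ} (hl : IsPeriod S V l) {x : ℂ × ℂ}
    (hx : x.2 ∉ S) :
    CoulombRegularization.newtonField V (x.1, x.2 + l) = CoulombRegularization.newtonField V x := by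
  have h1 : (fun q => V (q + l)) =ᶠ[𝓝 x.2] V := by
    filter_upwards [hC.isClosed.isOpen_compl.mem_nhds hx] with q hq
    exact hl.periodic q hq
  have h2 : fderiv ℝ V (x.2 + l) = fderiv ℝ V x.2 := by
    rw [← fderiv_comp_add_right, h1.fderiv_eq]
  simp only [CoulombRegularization.newtonField, grad, h2]

theorem IsRegularizedAt.add_period (hC : LocallyCoulomb S V) {l : ℂ} (hl : IsPeriod S V l)
    {γ : ℝ → ℂ} {t : ℝ} (h : IsRegularizedAt S V γ t) :
    IsRegularizedAt S V (fun u => γ u + l) t := by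
  have hst : ∀ u, state (fun u => γ u + l) u = state γ u + (0, l) := fun u => by
    simp [state]
  refine ⟨h.continuousAt.add_const l, fun hS => ?_, fun hS => ?_, fun hS => ?_⟩
  · have hS' : γ t ∉ S := fun h' => hS ((hl.add_mem_iff _).2 h')
    have h1 := (h.newton hS').add_const (0, l)
    have h2 : newtonField V (state (fun u => γ u + l) t) = newtonField V (state γ t) := by
      rw [← hl.newtonField hC (x := state γ t) hS']
      simp [state]
    rw [h2]
    exact h1.congr_of_eventuallyEq (Eventually.of_forall hst)
  · filter_upwards [h.reflect ((hl.add_mem_iff _).1 hS)] with u hu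
    rw [hu]
  · filter_upwards [h.isolated ((hl.add_mem_iff _).1 hS)] with u hu
    rwa [hl.add_mem_iff]

theorem HasCurve.add_period (hC : LocallyCoulomb S V) {l : ℂ} (hl : IsPeriod S V l) {x : ℂ × ℂ}
    {δ : ℝ} (h : HasCurve S V x δ) : HasCurve S V (x.1, x.2 + l) δ := by
  obtain ⟨γ, h1, h2⟩ := h
  refine ⟨fun u => γ u + l, fun t ht => (h1 t ht).add_period hC hl, ?_⟩
  rw [← h2]
  simp [state]

/-- A Coulombic potential that is periodic up to a compact set has complete regularized dynamics. -/
theorem LocallyCoulomb.completeCoulomb_of_isPeriod (hC : LocallyCoulomb S V) {K : Set ℂ}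
    (hK : IsCompact K) (h : ∀ q, ∃ l, IsPeriod S V l ∧ ∃ q' ∈ K, q = q' + l) :
    CompleteCoulomb S V := by
  refine hC.completeCoulomb fun A => ?_
  choose r hr δ hδ hcurve using fun q₀ => hC.exists_uniform_time q₀ A
  obtain ⟨F, hF⟩ := hK.elim_finite_subcover (fun q₀ => Metric.ball q₀ (r q₀))
    (fun _ => Metric.isOpen_ball) fun q _ => mem_iUnion.2 ⟨q, Metric.mem_ball_self (hr q)⟩
  obtain ⟨δ₀, hδ₀, hmin⟩ : ∃ δ₀ > 0, ∀ q₀ ∈ F, δ₀ ≤ δ q₀ := by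
    rcases F.eq_empty_or_nonempty with rfl | hne
    · exact ⟨1, one_pos, by simp⟩
    · obtain ⟨q₁, -, hq₁⟩ := F.exists_min_image δ hne
      exact ⟨δ q₁, hδ q₁, hq₁⟩
  refine ⟨δ₀, hδ₀, fun x hx hA => ?_⟩
  obtain ⟨l, hl, q', hq', hxq⟩ := h x.2
  have hq'S : q' ∉ S := fun h' => hx (hxq ▸ (hl.add_mem_iff _).2 h')
  obtain ⟨q₀, hq₀, hball⟩ := mem_iUnion₂.1 (hF hq')
  have hE : hamiltonian V (x.1, q') = hamiltonian V x := by
    simp only [hamiltonian, hxq, hl.periodic q' hq'S]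
  have h1 := ((hcurve q₀ (x.1, q') hq'S hball (by rwa [hE])).mono (hmin q₀ hq₀)).add_period hC hl
  rwa [← hxq] at h1

end

/-! ### Application to the lattice potential -/

section

variable (b : Module.Basis (Fin 2) ℝ ℂ) {m : ℕ} {s : Fin m → ℂ} {Z : Fin m → ℝ} {V : ℂ → ℝ}

theorem add_mem_nuclei_iff {l : ℂ} (hl : l ∈ Submodule.span ℤ (range b)) (q : ℂ) :
    q + l ∈ nuclei b s ↔ q ∈ nuclei b s := by
  constructor
  · rintro ⟨i, l', hl', h⟩
    exact ⟨i, l' - l, sub_mem hl' hl, by linear_combination h⟩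
  · rintro ⟨i, l', hl', h⟩
    exact ⟨i, l' + l, add_mem hl' hl, by linear_combination h⟩

theorem IsCoulombic.isPeriod (hV : IsCoulombic b s Z V) {l : ℂ}
    (hl : l ∈ Submodule.span ℤ (range b)) : IsPeriod (nuclei b s) V l :=
  ⟨add_mem_nuclei_iff b hl, fun q hq => hV.periodic q hq l hl⟩

/-- The lattice meets bounded sets in finitely many points, and finitely many cosets of it make up
the nuclei, so a unit ball contains only finitely many nuclei. -/
theorem eventually_notMem_nuclei (s : Fin m → ℂ) (q : ℂ) : ∀ᶠ u in 𝓝[≠] q, u ∉ nuclei b s := by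
  have hfin : (nuclei b s ∩ Metric.ball q 1).Finite := by
    refine (finite_iUnion fun i => ((ZSpan.setFinite_inter b
      (Metric.isBounded_ball (x := q - s i) (r := 1))).image fun l => s i + l)).subset ?_
    rintro u ⟨⟨i, l, hl, rfl⟩, hu⟩
    refine mem_iUnion.2 ⟨i, l, ⟨?_, hl⟩, rfl⟩
    rw [Metric.mem_ball, Complex.dist_eq] at hu ⊢
    convert hu using 2
    ring
  have h1 := (hfin.subset (sdiff_subset (t := {q}))).isClosed.isOpen_compl.mem_nhds (x := q)
    fun h => h.2 rfl
  filter_upwards [nhdsWithin_le_nhds h1, nhdsWithin_le_nhds (Metric.ball_mem_nhds q one_pos),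
    self_mem_nhdsWithin] with u h2 h3 h4 h5
  exact h2 ⟨⟨h5, h3⟩, h4⟩

/-- The Coulomb condition is given at the representatives `s i` and is carried to their translates
by periodicity. Periodicity is available only off the nuclei, so the radius is shrunk until `s i +
Q²` meets no other nucleus. -/
theorem IsCoulombic.locallyCoulomb (hZ : ∀ i, 0 < Z i) (hV : IsCoulombic b s Z V) :
    LocallyCoulomb (nuclei b s) V where
  smooth := hV.smooth
  isolated := eventually_notMem_nuclei b s
  coulomb := by
    rintro _ ⟨i, l, hl, rfl⟩
    obtain ⟨ε, hε, hsm⟩ := hV.coulomb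
    have h1 : Tendsto (fun Q : ℂ => s i + Q ^ 2) (𝓝[≠] 0) (𝓝[≠] (s i)) := by
      refine tendsto_nhdsWithin_iff.2 ⟨?_, ?_⟩
      · have h2 : Continuous fun Q : ℂ => s i + Q ^ 2 := by fun_prop
        simpa using (h2.tendsto 0).mono_left nhdsWithin_le_nhds
      · filter_upwards [self_mem_nhdsWithin] with Q hQ h
        have h3 : Q ^ 2 = 0 := by simpa using h
        exact hQ (pow_eq_zero_iff two_ne_zero |>.1 h3)
    obtain ⟨r, hr, hball⟩ := Metric.mem_nhds_iff.1
      (eventually_nhdsWithin_iff.1 (h1.eventually (eventually_notMem_nuclei b s (s i))))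
    refine ⟨Z i, hZ i, min r ε, lt_min hr hε, ((hsm i).mono (Metric.ball_subset_ball
      (min_le_right r ε))).congr fun Q hQ => ?_⟩
    simp only [leviCivita]
    split_ifs with h0
    · rfl
    · have h2 := hball (Metric.ball_subset_ball (min_le_left r ε) hQ) h0
      rw [show s i + l + Q ^ 2 = s i + Q ^ 2 + l by ring, hV.periodic _ h2 l hl]

/-- The closure of the fundamental domain is compact, and each position is a lattice translate of a
point in it. -/
theorem IsCoulombic.completeCoulomb (hZ : ∀ i, 0 < Z i) (hV : IsCoulombic b s Z V) :
    CompleteCoulomb (nuclei b s) V := by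
  have hK : IsCompact (closure (ZSpan.fundamentalDomain b)) :=
    (ZSpan.fundamentalDomain_isBounded b).isCompact_closure
  refine (hV.locallyCoulomb b hZ).completeCoulomb_of_isPeriod hK fun q => ?_
  refine ⟨ZSpan.floor b q, hV.isPeriod b (ZSpan.floor b q).2, ZSpan.fract b q,
    subset_closure (ZSpan.fract_mem_fundamentalDomain b q), ?_⟩
  rw [ZSpan.fract_apply, sub_add_cancel]

end

end CoulombRegularization

end

theorem mainTheorem11 (b : Module.Basis (Fin 2) ℝ ℂ) (m : ℕ) (hm : 1 ≤ m)
    (s : Fin m → ℂ) (hs : Function.Injective s) (hsD : ∀ i, s i ∈ ZSpan.fundamentalDomain b)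
    (Z : Fin m → ℝ) (hZ : ∀ i, 0 < Z i)
    (V : ℂ → ℝ) (hV : IsCoulombic b s Z V) :
    ∃ X : Extension (nuclei b s) V,
      (∀ σ, IsSmoothEmbedding (𝓘(ℝ, ℝ).prod (𝓡 1)) I4 ∞ (X.cyl σ)) ∧
      (∃ Φ : ℝ → X.P → X.P, IsCompleteHamiltonianFlow X.Ω X.H Φ ∧
        ∀ E : ℝ, IsRegularValue (nuclei b s) V E →
          IsEmbeddedSubmanifold 3 (X.energyShell E) ∧
          ∀ t, MapsTo (Φ t) (X.energyShell E) (X.energyShell E)) ∧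
      (∀ Y : Extension (nuclei b s) V, Y.IsComplete →
        ∃! φ : X.P ≃ₘ^∞⟮I4, I4⟯ Y.P, X.IsIso Y φ) := by
  have := hV.completeCoulomb b hZ
  exact ⟨phaseExtension (nuclei b s) V, Phase.isSmoothEmbedding_collision,
    ⟨fun t (γ : Phase (nuclei b s) V) => γ.shift t, Phase.isCompleteHamiltonianFlow, fun E hE =>
      ⟨Phase.isEmbeddedSubmanifold_energyShell hE, fun t (γ : Phase (nuclei b s) V) hγ =>
        (Phase.energy_shift t γ).trans hγ⟩⟩,
    fun Y ⟨_, hΨ⟩ => Y.existsUnique_isIso hΨ⟩
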